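/- **Setting.** Let $n\ge 1$. An index-$n$ grid diagram $\mathbb G$ is the torus obtained from $[0,n]\times[0,n]$ by identifying opposite edges, with horizontal circles $\alpha_1,\dots,\alpha_n$ and vertical circles $\beta_1,\dots,\beta_n$ ($\alpha_i$ is the image of $[0,n]\times\{i-1\}$, $\beta_i$ of $\{i-1\}\times[0,n]$), cutting it into $n$ rows, $n$ columns and $n^2$ squares, together with markings $O_1,\dots,O_n$ and $X_1,\dots,X_n$ in the squares such that each row and each column contains exactly one $O$ and exactly one $X$, and $X_n$ lies in the top-right square. Let $H_j$ and $V_j$ be the row and the column containing $O_j$. A generator is $x^\sigma=(\alpha_{\sigma(1)}\cap\beta_1,\dots,\alpha_{\sigma(n)}\cap\beta_n)$ for a permutation $\sigma$ of $\{1,\dots,n\}$. For generators $x,y$ let $\mathscr D^+(x,y)$ be the set of combinations $D$ of squares with coefficients in $\mathbb N=\{0,1,2,\dots\}$, with coefficient $0$ at $X_n$, and with $\partial(\partial D\cap\alpha)=y-x$. Write $R*E\in\mathscr D^+(x,y)$ for the sum of $R\in\mathscr D^+(x,w)$ and $E\in\mathscr D^+(w,y)$, and $c_x\in\mathscr D^+(x,x)$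 for the zero domain. The Maslov index is $\mu(D)=n_x(D)+n_y(D)$, where $n_x(D)$ is the sum over the coordinates $p$ of $x$ of the average of the four multiplicities of $D$ around $p$. Let $\mathscr R(x,y)=\{D\in\mathscr D^+(x,y):\mu(D)=1\}$ (the rectangles). A sign assignment is a function $s:\bigcup_{x,y}\mathscr R(x,y)\to\{\pm1\}$ such that: if $R_1*S_1=R_2*S_2$ are two different decompositions into two rectangles of a domain that is neither a row nor a column, then $s(R_1)s(S_1)=-s(R_2)s(S_2)$; if $R*S$ is a decomposition of a row into rectangles, then $s(R)s(S)=1$; if $R*S$ is a decomposition of a column into rectangles, then $s(R)s(S)=-1$. For $N\in\mathbb N$, $\mathrm{Part}(N)$ is the set of ordered partitions $\lambda=(\lambda_1,\dots,\lambda_m)$ of $N$ into positive integers, and $\ell(\lambda)=m$. The complex $\mathit{CDP}_*=\mathit{CDP}_*(\mathbb G,s)$ is the free abelian group on the triples $(D,\vec N,\vec\lambda)$ with $D\in\mathscr D^+(x,y)$ for some generators $x,y$, $\vec N\in\mathbb N^n$, $\vec\lambda=(\lambda_1,\dots,\lambda_n)$, $\lambda_j\in\mathrm{Part}(N_j)$,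 graded by $\mu(D)+\ell(\lambda_1)+\dots+\ell(\lambda_n)$. Put $\varepsilon_j=(-1)^{\ell(\lambda_1)+\dots+\ell(\lambda_{j-1})}$. The differential is $\delta=\delta^{\mathrm I}+\delta^{\mathrm{II}}+\delta^{\mathrm{III}}+\delta^{\mathrm{IV}}$, where, for $D\in\mathscr D^+(x,y)$, - $\delta^{\mathrm I}(D,\vec N,\vec\lambda)=\sum_{R*E=D}s(R)(E,\vec N,\vec\lambda)+(-1)^{\mu(D)}\sum_{E*R=D}s(R)(E,\vec N,\vec\lambda)$, the sums being over all decompositions into a rectangle $R$ and a positive domain $E$; - $\delta^{\mathrm{II}}(D,\vec N,\vec\lambda)=(-1)^{\mu(D)}\sum_j\varepsilon_j\sum_E\sum_{k=1}^{\ell(\lambda_j)+1}(-1)^{k-1}(E,\vec N',\vec\lambda')$, where $E\in\mathscr D^+(x,y)$ runs over the domains with $E+H_j=D$ or $E+V_j=D$, and $\vec\lambda'$ arises from $\vec\lambda$ by inserting a part $1$ in the $k$-th position of $\lambda_j$; - $\delta^{\mathrm{III}}(D,\vec N,\vec\lambda)=(-1)^{\mu(D)}\sum_j\varepsilon_j\sum_{k=1}^{\ell(\lambda_j)-1}(-1)^{k}(D,\vec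 N,\vec\lambda')$, where $\vec\lambda'$ arises by replacing the $k$-th and $(k+1)$-st parts of $\lambda_j$ by their sum; - $\delta^{\mathrm{IV}}(D,\vec N,\vec\lambda)=(-1)^{\mu(D)}\sum_{j:\,N_j>0}\varepsilon_j\big((D,\vec N',\vec\lambda')+(-1)^{\ell(\lambda_j)}(D,\vec N'',\vec\lambda'')\big)$, where $\vec\lambda'$ arises by deleting the first part of $\lambda_j$ and $\vec\lambda''$ by deleting the last part of $\lambda_j$; in each case the vectors $\vec N',\vec N''$ are adjusted so that their entries are the sums of the partitions. Let $\mathit{CDP}^\dagger_*\subset\mathit{CDP}_*$ be spanned by the triples $(c_{x^{\mathrm{Id}}},\vec N,\vec\lambda)$ with $\vec N\in\{0,1\}^n$. **Proposition 4.6.** For every grid diagram $\mathbb G$ of size $n\ge1$ and every sign assignment $s$, $(\mathit{CDP}_*,\delta)$ is a chain complex with subcomplex $\mathit{CDP}^\dagger_*$, and: (a) The quotient complex $\mathit{CDP}'_*=\mathit{CDP}_*/\mathit{CDP}^\dagger_*$ is acyclic, and the inclusion $\mathit{CDP}^\dagger_*\subset\mathit{CDP}_*$ is a quasi-isomorphism.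 (b) The homology of $\mathit{CDP}^\dagger_*$, and hence also that of $\mathit{CDP}_*$, is isomorphic to $\mathbb Z^{2^n}$; in degree $k$ it is free abelian of rank $\binom nk$, for every $k\ge 0$. -/

import Mathlib

namespace GridCDP

open Finset CategoryTheory

/-! ## Grid diagrams, domains, Maslov index

The torus is `[0,n] × [0,n]` with opposite edges identified. Columns, rows and the circles
bounding them are numbered from `0` and indexed cyclically by `Fin n`: the circle `β_i` is the
left edge of column `i`, the circle `α_j` is the bottom edge of row `j`. A generator is
a permutation `x`, whose coordinates are the points `α_{x i} ∩ β_i`. -/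

/-- The last index. -/
def last (n : ℕ) [NeZero n] : Fin n := ⟨n - 1, Nat.sub_lt (NeZero.pos n) one_pos⟩

/-- An index-`n` grid diagram: the marking `O_j` lies in column `oCol j` and row `oRow j`, the
marking `X_j` in column `xCol j` and row `xRow j`; every row and every column contains exactly one
`O` and one `X`, and the last `X` lies in the top-right square. -/
structure GridDiagram (n : ℕ) [NeZero n] where
  oCol : Equiv.Perm (Fin n)
  oRow : Equiv.Perm (Fin n)
  xCol : Equiv.Perm (Fin n)
  xRow : Equiv.Perm (Fin n)
  xCol_last : xCol (last n) = last n
  xRow_last : xRow (last n) = last n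

/-- A nonnegative combination of squares: `c i j` is the multiplicity of the square in column `i`
and row `j`. -/
abbrev Chain (n : ℕ) : Type := Fin n → Fin n → ℕ

section

variable {n : ℕ} [NeZero n]

/-- The row number `j` (a horizontal annulus). -/
def rowChain (j : Fin n) : Chain n := fun _ r => if r = j then 1 else 0

/-- The column number `i` (a vertical annulus). -/
def colChain (i : Fin n) : Chain n := fun c _ => if c = i then 1 else 0

/-- The coefficient of the point `α_j ∩ β_i` in `∂(∂D ∩ α)`: the edge of `α_j` from `β_i` to
`β_{i+1}` has coefficient `c i j - c i (j - 1)` in `∂D`. -/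
def alphaBoundary (c : Chain n) (i j : Fin n) : ℤ :=
  ((c (i - 1) j : ℤ) - c (i - 1) (j - 1)) - ((c i j : ℤ) - c i (j - 1))

/-- The sum of the four multiplicities around the point `α_j ∩ β_i`. -/
def aroundPoint (c : Chain n) (i j : Fin n) : ℕ :=
  c i j + c (i - 1) j + c i (j - 1) + c (i - 1) (j - 1)

/-- A positive domain from the generator `src` to the generator `tgt` that avoids the
last `X`-marking: the union over all `x, y` of the sets `𝒟⁺(x, y)`. -/
@[ext]
structure PosDomain (G : GridDiagram n) where
  src : Equiv.Perm (Fin n)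
  tgt : Equiv.Perm (Fin n)
  coeff : Chain n
  boundary : ∀ i j, alphaBoundary coeff i j
    = (if tgt i = j then 1 else 0) - (if src i = j then 1 else 0)
  avoids : coeff (G.xCol (last n)) (G.xRow (last n)) = 0

namespace PosDomain

variable {G : GridDiagram n}

/-- The Maslov index `μ(D) = n_x(D) + n_y(D)` of a domain on a grid (Lipshitz' formula; the Euler
measure of every square is zero), where `n_p` is the average of the multiplicities around `p`,
summed over the coordinates of the generator. The division by `4` is exact for domains. -/
def mu (D : PosDomain G) : ℕ :=
  (∑ i, (aroundPoint D.coeff i (D.src i) + aroundPoint D.coeff i (D.tgt i))) / 4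

/-- `D = R * E`. -/
def IsComp (R E D : PosDomain G) : Prop :=
  R.src = D.src ∧ R.tgt = E.src ∧ E.tgt = D.tgt ∧ R.coeff + E.coeff = D.coeff

theorem finite_le (c : Chain n) : {R : PosDomain G | R.coeff ≤ c}.Finite := by
  let f : PosDomain G → Equiv.Perm (Fin n) × Equiv.Perm (Fin n) × Chain n :=
    fun R => (R.src, R.tgt, R.coeff)
  have hf : Function.Injective f := by
    intro R S h
    simp only [f, Prod.mk.injEq] at h
    exact PosDomain.ext h.1 h.2.1 h.2.2
  refine Set.Finite.of_finite_image (f := f) ?_ hf.injOn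
  refine (Set.finite_univ.prod (Set.finite_univ.prod (Set.finite_Icc 0 c))).subset ?_
  rintro _ ⟨R, hR, rfl⟩
  exact ⟨trivial, trivial, fun _ _ => Nat.zero_le _, hR⟩

theorem finite_comp (D : PosDomain G) :
    {p : PosDomain G × PosDomain G | IsComp p.1 p.2 D}.Finite := by
  refine ((finite_le D.coeff).prod (finite_le D.coeff)).subset ?_
  rintro ⟨R, E⟩ ⟨-, -, -, h⟩
  have h' : R.coeff + E.coeff = D.coeff := h
  exact ⟨show R.coeff ≤ D.coeff from h' ▸ le_self_add,
    show E.coeff ≤ D.coeff from h' ▸ le_add_self⟩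

theorem finite_remove (D : PosDomain G) (c : Chain n) :
    {E : PosDomain G | E.src = D.src ∧ E.tgt = D.tgt ∧ E.coeff + c = D.coeff}.Finite := by
  refine (finite_le D.coeff).subset ?_
  rintro E ⟨-, -, h⟩
  exact show E.coeff ≤ D.coeff from h ▸ le_self_add

/-- All pairs `(R, E)` of positive domains with `R * E = D`. -/
noncomputable def decompositions (D : PosDomain G) : Finset (PosDomain G × PosDomain G) :=
  (finite_comp D).toFinset

/-- All positive domains `E` with the same ends as `D` and `E + c = D`. -/
noncomputable def remove (D : PosDomain G) (c : Chain n) : Finset (PosDomain G) :=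
  (finite_remove D c).toFinset

end PosDomain

/-- The rectangles: the positive domains of Maslov index one. -/
abbrev Rectangle (G : GridDiagram n) : Type := {R : PosDomain G // R.mu = 1}

/-- A sign assignment. -/
structure SignAssignment (G : GridDiagram n) where
  sign : Rectangle G → ℤˣ
  /-- two different decompositions of a domain of index two that is not an annulus -/
  anticomm : ∀ (R₁ S₁ R₂ S₂ : Rectangle G) (D : PosDomain G),
    PosDomain.IsComp R₁.1 S₁.1 D → PosDomain.IsComp R₂.1 S₂.1 D → (R₁, S₁) ≠ (R₂, S₂) →
    (∀ j, D.coeff ≠ rowChain j) → (∀ i, D.coeff ≠ colChain i) →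
    sign R₁ * sign S₁ = -(sign R₂ * sign S₂)
  row : ∀ (R S : Rectangle G) (D : PosDomain G), PosDomain.IsComp R.1 S.1 D →
    (∃ j, D.coeff = rowChain j) → sign R * sign S = 1
  col : ∀ (R S : Rectangle G) (D : PosDomain G), PosDomain.IsComp R.1 S.1 D →
    (∃ i, D.coeff = colChain i) → sign R * sign S = -1

/-! ## Ordered partitions -/

/-- Ordered partitions, as lists of positive integers. A list `lam` is an
element of `Part(N)` exactly for `N = size lam`, and `ℓ(lam) = lam.length`. -/
abbrev OrdPart : Type := List ℕ+

/-- The number `N` of which `lam` is a partition. -/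
def size (lam : OrdPart) : ℕ := (lam.map (fun a => (a : ℕ))).sum

/-- The unit enlargement that inserts a part `1` after the first `k` parts (`0 ≤ k ≤ ℓ(lam)`). -/
def unitEnlarge (lam : OrdPart) (k : ℕ) : OrdPart := lam.take k ++ 1 :: lam.drop k

/-- The elementary coarsening that merges the two parts following the first `k` parts
(`k + 1 < ℓ(lam)`). -/
def coarsen : OrdPart → ℕ → OrdPart
  | a :: b :: l, 0 => (a + b) :: l
  | a :: l, k + 1 => a :: coarsen l k
  | l, _ => l

/-! ## The complex of positive domains with partitions -/

/-- The generators `(D, N, lam)` of the complex; the vector `N` is determined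
by the partitions, `N_j = size (lam j)`. -/
abbrev Gen (G : GridDiagram n) : Type := PosDomain G × (Fin n → OrdPart)

/-- The free abelian group on all generators. -/
abbrev Total (G : GridDiagram n) : Type := Gen G →₀ ℤ

variable {G : GridDiagram n}

/-- The grading `μ(D) + ℓ(lam_1) + ... + ℓ(lam_n)`. -/
def gr (g : Gen G) : ℕ := g.1.mu + ∑ j, (g.2 j).length

/-- The sign `(-1)^(ℓ(lam_1) + ... + ℓ(lam_{j-1}))`. -/
def lenSign (lam : Fin n → OrdPart) (j : Fin n) : ℤ :=
  (-1) ^ ∑ i ∈ univ.filter (fun i => i < j), (lam i).length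

open Classical in
/-- The value on rectangles of a sign assignment, extended by zero to all positive domains. -/
noncomputable def SignAssignment.val (s : SignAssignment G) (R : PosDomain G) : ℤ :=
  if h : R.mu = 1 then (s.sign ⟨R, h⟩ : ℤ) else 0

/-- Type I terms: take out an initial or a final rectangle. -/
noncomputable def deltaI (s : SignAssignment G) (g : Gen G) : Total G :=
  (∑ p ∈ g.1.decompositions, s.val p.1 • Finsupp.single (p.2, g.2) (1 : ℤ))
  + (-1 : ℤ) ^ g.1.mu •
    ∑ p ∈ g.1.decompositions, s.val p.2 • Finsupp.single (p.1, g.2) (1 : ℤ)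

/-- Type II terms: take out the row or the column through `O_j` and enlarge the
`j`-th partition. -/
noncomputable def deltaII (g : Gen G) : Total G :=
  (-1 : ℤ) ^ g.1.mu • ∑ j, lenSign g.2 j •
    (∑ E ∈ g.1.remove (rowChain (G.oRow j)), ∑ k ∈ range ((g.2 j).length + 1),
        (-1 : ℤ) ^ k •
          Finsupp.single (E, Function.update g.2 j (unitEnlarge (g.2 j) k)) (1 : ℤ)
      + ∑ E ∈ g.1.remove (colChain (G.oCol j)), ∑ k ∈ range ((g.2 j).length + 1),
        (-1 : ℤ) ^ k •
          Finsupp.single (E, Function.update g.2 j (unitEnlarge (g.2 j) k)) (1 : ℤ))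

/-- Type III terms: coarsen one of the partitions. -/
noncomputable def deltaIII (g : Gen G) : Total G :=
  (-1 : ℤ) ^ g.1.mu • ∑ j, lenSign g.2 j •
    ∑ k ∈ range ((g.2 j).length - 1), (-1 : ℤ) ^ (k + 1) •
      Finsupp.single (g.1, Function.update g.2 j (coarsen (g.2 j) k)) (1 : ℤ)

/-- Type IV terms: remove the first or the last part of one of the nonempty partitions. -/
noncomputable def deltaIV (g : Gen G) : Total G :=
  (-1 : ℤ) ^ g.1.mu • ∑ j, (if g.2 j = [] then 0 else
    lenSign g.2 j • Finsupp.single (g.1, Function.update g.2 j (g.2 j).tail) (1 : ℤ)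
    + (lenSign g.2 j * (-1) ^ (g.2 j).length) •
      Finsupp.single (g.1, Function.update g.2 j (g.2 j).dropLast) (1 : ℤ))

/-- The differential on the free abelian group on all generators. -/
noncomputable def delta (s : SignAssignment G) : Total G →ₗ[ℤ] Total G :=
  Finsupp.linearCombination ℤ (fun g => deltaI s g + deltaII g + deltaIII g + deltaIV g)

variable (G) in
/-- The chain group `CDP_k`. -/
def chains (k : ℕ) : Submodule ℤ (Total G) := Finsupp.supported ℤ ℤ {g | gr g = k}

/-- The generators `(c_{x^Id}, N, lam)` with `N` made of `0`'s and `1`'s, where `c_{x^Id}` is the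
trivial domain at the identity permutation. -/
def IsDagger (g : Gen G) : Prop :=
  g.1.src = 1 ∧ g.1.tgt = 1 ∧ g.1.coeff = 0 ∧ ∀ j, size (g.2 j) ≤ 1

variable (G) in
/-- The chain group `CDP†_k`. -/
def daggerChains (k : ℕ) : Submodule ℤ (Total G) :=
  Finsupp.supported ℤ ℤ {g | gr g = k ∧ IsDagger g}

theorem daggerChains_le (k : ℕ) : daggerChains G k ≤ chains G k :=
  Finsupp.supported_mono fun _ h => h.1

/-- `delta` is a differential on `CDP_*`: it lowers the degree by one, squares to zero, and
preserves `CDP†_*`. -/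
structure IsDifferential (s : SignAssignment G) : Prop where
  map_chains : ∀ k, ∀ c ∈ chains G (k + 1), delta s c ∈ chains G k
  map_chains_zero : ∀ c ∈ chains G 0, delta s c = 0
  sq_zero : ∀ c, delta s (delta s c) = 0
  map_dagger : ∀ k, ∀ c ∈ daggerChains G (k + 1), delta s c ∈ daggerChains G k

variable {s : SignAssignment G}

/-- The chain complex `CDP_*`. -/
noncomputable def CDP (h : IsDifferential s) : ChainComplex (ModuleCat ℤ) ℕ :=
  ChainComplex.of (fun k => ModuleCat.of ℤ (chains G k))
    (fun k => ModuleCat.ofHom ((delta s).restrict (h.map_chains k)))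
    (fun k => by
      refine ModuleCat.hom_ext (LinearMap.ext fun c => Subtype.ext ?_)
      exact h.sq_zero _)

/-- The chain complex `CDP†_*`. -/
noncomputable def CDPDagger (h : IsDifferential s) : ChainComplex (ModuleCat ℤ) ℕ :=
  ChainComplex.of (fun k => ModuleCat.of ℤ (daggerChains G k))
    (fun k => ModuleCat.ofHom ((delta s).restrict (h.map_dagger k)))
    (fun k => by
      refine ModuleCat.hom_ext (LinearMap.ext fun c => Subtype.ext ?_)
      exact h.sq_zero _)

/-- The inclusion `CDP†_* ⊂ CDP_*`. -/
noncomputable def inclusion (h : IsDifferential s) : CDPDagger h ⟶ CDP h :=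
  ChainComplex.ofHom (fun k => ModuleCat.ofHom (Submodule.inclusion (daggerChains_le k)))
    (fun k => by
      simp only [CDP, CDPDagger, ChainComplex.of_d]
      ext c
      rfl)

variable (G) in
/-- `CDP†_k` as a subgroup of `CDP_k`. -/
noncomputable def daggerIn (k : ℕ) : Submodule ℤ (chains G k) := (daggerChains G k).comap (chains G k).subtype

/-- The quotient complex `CDP'_* = CDP_* / CDP†_*`. -/
noncomputable def CDPQuot (h : IsDifferential s) : ChainComplex (ModuleCat ℤ) ℕ :=
  ChainComplex.of (fun k => ModuleCat.of ℤ (chains G k ⧸ daggerIn G k))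
    (fun k => ModuleCat.ofHom (Submodule.mapQ (daggerIn G (k + 1)) (daggerIn G k)
      ((delta s).restrict (h.map_chains k)) (fun c hc => h.map_dagger k c.1 hc)))
    (fun k => by
      refine ModuleCat.hom_ext (LinearMap.ext fun q => ?_)
      obtain ⟨c, rfl⟩ := Submodule.Quotient.mk_surjective _ q
      refine (Submodule.Quotient.mk_eq_zero _).2 ?_
      have : (delta s).restrict (h.map_chains k) ((delta s).restrict (h.map_chains (k + 1)) c)
          = 0 := Subtype.ext (h.sq_zero _)
      rw [this]
      exact Submodule.zero_mem _)

end

end GridCDP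

/-! Write chains as the tensor product of chains on domains and chains on vectors of partitions. The
differential then has the form `A + P * (-1)^μ`, where `A` takes out rectangles and `P` changes the
partitions (`delta_eq`). In `A²` the terms that remove one rectangle at each end cancel by sign. Two
rectangles removed at the front leave rows minus columns (`sum_val_mul_val`, from the axioms of a
sign assignment), and two removed at the rear leave the same operator with the opposite sign,
because a periodic domain can be removed at either end (`rectPart_sq`). `P` combines the bar
differential of the monoid of natural numbers with the signed insertion of a part one, which is the
shuffle product with the partition `(1)`. These operators are odd and anticommute, the annulus
removals commute, and so `P² = 0` (`partitionPart_sq`). The mixed terms cancel since `(-1)^μ`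
anticommutes with `A`, and `A` and `(-1)^μ` both commute with `P`.

Acyclicity of the quotient comes from an acyclic matching whose critical generators are exactly
those of `CDP†`. A nontrivial domain, or a trivial one at a generator other than the identity, has a
pivot: an inner column or row chosen from the multiplicities in the last row and column and from the
final generator only. A concavity condition on the pivot guarantees that, if the initial generator
ascends across it, the rectangle in that strip is contained in the domain (`one_le_of_goodColumn`,
`Strip.rect_le_of_good`). Removing or adding this rectangle changes none of the data that determine
the pivot, so it pairs the domains with and without ascent. The position of `X_n` enters through the
zero multiplicity in the top-right square: it makes a pivot exist except for the trivial domain at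
the identity (`pivot_eq_none`). On that domain, partition vectors are paired by merging an initial
part one with its successor, in the first partition of a number bigger than one; what remains
unpaired has all sizes at most one.

A lexicographic rank with five entries shows that every term of the differential other than the
matched partner has smaller rank (`Below.rank_lt_or_matched`), and the partner occurs with
coefficient `±1` (`Matched.exists_unit`). Hence a chain with boundary in `CDP†` is homologous to a
chain in `CDP†`. The long exact sequence gives the quasi-isomorphism. The differential vanishes on
`CDP†`, whose generators in degree `k` are the `k`-element sets of indices `j` with partition `(1)`.
-/

namespace GridCDP

open Finset

set_option linter.unusedSectionVars false

/-! ### Cyclic intervals -/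

section Interval

variable {n : ℕ}

/-- The indicator function of the cyclic interval `[a, b)`. -/
def ind (a b i : Fin n) : ℕ :=
  -- For `a = b` this is the whole cycle, which is why later statements assume distinct end points.
  if (if a < b then a ≤ i ∧ i < b else a ≤ i ∨ i < b) then 1 else 0

theorem ind_le_one (a b i : Fin n) : ind a b i ≤ 1 := by
  unfold ind; split_ifs <;> omega

theorem ind_left (a b : Fin n) : ind a b a = 1 := by
  unfold ind; split_ifs <;> simp_all

theorem ind_right {a b : Fin n} (h : a ≠ b) : ind a b b = 0 := by
  unfold ind; split_ifs <;> simp_all; omega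

theorem ind_add_swap {a b : Fin n} (hab : a ≠ b) (i : Fin n) : ind a b i + ind b a i = 1 := by
  unfold ind
  simp only [Fin.lt_def, Fin.le_def, Fin.ext_iff, ne_eq] at *
  split_ifs <;> omega

theorem ind_le_add (p q r i : Fin n) (_ : p ≠ r) : ind p r i ≤ ind p q i + ind q r i := by
  unfold ind
  simp only [Fin.lt_def, Fin.le_def, Fin.ext_iff, ne_eq] at *
  split_ifs <;> omega

theorem ind_le_left {p q r : Fin n} (h : ind p r q = 1) (hpq : p ≠ q) (i : Fin n) :
    ind p q i ≤ ind p r i := by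
  unfold ind at *
  simp only [Fin.lt_def, Fin.le_def, Fin.ext_iff, ne_eq] at *
  split_ifs at * <;> omega

theorem ind_le_right {p q r : Fin n} (h : ind p r q = 1) (i : Fin n) :
    ind q r i ≤ ind p r i := by
  unfold ind at *
  simp only [Fin.lt_def, Fin.le_def] at *
  split_ifs at * <;> omega

/-- Going round the cycle from `p`, one of `q` and `r` is met before the other. -/
theorem ind_trichotomy {p q r : Fin n} (hqr : q ≠ r) (hpr : p ≠ r) :
    ind p r q = 1 ∨ ind p q r = 1 := by
  unfold ind
  simp only [Fin.lt_def, Fin.le_def, Fin.ext_iff, ne_eq] at *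
  split_ifs <;> omega

end Interval

/-! ### Functions on a cycle and their jumps -/

section Cyclic

variable {n : ℕ} [NeZero n]

theorem val_pred (i : Fin n) : ((i - 1 : Fin n) : ℕ) = if (i : ℕ) = 0 then n - 1 else (i : ℕ) - 1 := by
  obtain ⟨m, rfl⟩ := Nat.exists_eq_succ_of_ne_zero (NeZero.ne n)
  rcases Nat.eq_zero_or_pos m with rfl | hm
  · have := i.2
    have h2 := (i - 1).2
    generalize ((i - 1 : Fin _) : ℕ) = k at h2 ⊢
    split_ifs <;> omega
  have hi := i.2
  rw [Fin.sub_def]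
  simp only [Fin.val_one', Nat.mod_eq_of_lt (show 1 < m.succ by omega)]
  split_ifs with h
  · rw [h, Nat.mod_eq_of_lt] <;> omega
  · rw [show m.succ - 1 + (i : ℕ) = ((i : ℕ) - 1) + m.succ by omega, Nat.add_mod_right,
      Nat.mod_eq_of_lt (by omega)]

theorem val_succ (i : Fin n) : ((i + 1 : Fin n) : ℕ) = if (i : ℕ) = n - 1 then 0 else (i : ℕ) + 1 := by
  have h := val_pred (i + 1)
  rw [add_sub_cancel_right] at h
  have h1 := (i + 1).2
  have h2 := i.2
  generalize ((i + 1 : Fin n) : ℕ) = k at h h1 ⊢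
  split_ifs at h ⊢ <;> omega

/-- From `a` one climbs to the last index, passes to index zero, and from there reaches every index.
-/
theorem cyclic_induction {P : Fin n → Prop} (a : Fin n) (ha : P a)
    (h : ∀ i, P (i - 1) → P i) (i : Fin n) : P i := by
  have up : ∀ b : Fin n, P b → ∀ k, (b : ℕ) ≤ k → ∀ hk : k < n, P ⟨k, hk⟩ := by
    intro b hb k hbk
    induction k, hbk using Nat.le_induction with
    | base => intro _; exact hb
    | succ k _ ih =>
      intro hk
      apply h
      convert ih (by omega)
      rw [val_pred]
      simp
  have hl : P (last n) := up a ha (n - 1) (by have := a.2; omega) _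
  have h0 : P ⟨0, NeZero.pos n⟩ := by
    apply h
    convert hl using 1
    rw [Fin.ext_iff, val_pred]
    simp [last]
  exact up _ h0 i (Nat.zero_le _) i.2

theorem ind_sub_pred (a b i : Fin n) :
    (ind a b i : ℤ) - ind a b (i - 1) = (if i = a then 1 else 0) - (if i = b then 1 else 0) := by
  unfold ind
  have h := val_pred i
  have h1 := i.2
  have h2 := a.2
  have h3 := b.2
  simp only [Fin.lt_def, Fin.le_def, Fin.ext_iff] at *
  rw [h]
  split_ifs <;> simp <;> omega

theorem ind_pred {a b i : Fin n} (ha : i ≠ a) (hb : i ≠ b) : ind a b (i - 1) = ind a b i := by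
  by_cases hab : a = b
  · subst hab; unfold ind
    simp only [lt_irrefl, if_false]
    rw [if_pos (le_or_gt _ _), if_pos (le_or_gt _ _)]
  have := ind_sub_pred a b i
  rw [if_neg ha, if_neg hb] at this
  omega

theorem ind_pred_right {a b : Fin n} (hab : a ≠ b) : ind a b (b - 1) = 1 := by
  have := ind_sub_pred a b b
  rw [if_neg hab.symm, if_pos rfl, ind_right hab] at this
  omega

theorem ind_pred_left {a b : Fin n} (hab : a ≠ b) : ind a b (a - 1) = 0 := by
  have := ind_sub_pred a b a
  rw [if_pos rfl, if_neg hab, ind_left] at this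
  omega

theorem ind_succ (j i : Fin n) :
    ind j (j + 1) i = if i = j then 1 else 0 := by
  have hs := val_succ j
  have h1 := i.2
  have h2 := j.2
  unfold ind
  simp only [Fin.lt_def, Fin.le_def, Fin.ext_iff] at *
  generalize ((j + 1 : Fin n) : ℕ) = k at hs ⊢
  split_ifs at * <;> omega

/-- The first point `c` and the last point `d - 1` of the interval must both be `j`. -/
theorem eq_of_ind_le_single {c d j : Fin n} (hcd : c ≠ d)
    (h : ∀ i, i ≠ j → ind c d i = 0) : c = j ∧ d = j + 1 := by
  constructor
  · by_contra hc
    have := h c hc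
    rw [ind_left] at this
    omega
  · by_contra hd
    have : d - 1 ≠ j := fun e => hd (by rw [← e, sub_add_cancel])
    have := h _ this
    rw [ind_pred_right hcd] at this
    omega

/-- A function on the cycle whose only jumps are `+1` at `p` and `-1` at `q`. -/
theorem eq_add_ind {f : Fin n → ℤ} {p q : Fin n} (hpq : p ≠ q)
    (h : ∀ j, f j - f (j - 1) = (if j = p then 1 else 0) - (if j = q then 1 else 0)) (j : Fin n) :
    f j = f q + ind p q j := by
  refine cyclic_induction (P := fun j => f j = f q + ind p q j) q ?_ ?_ j
  · simp [ind_right hpq]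
  · intro i hi
    have h1 := h i
    have h2 := ind_sub_pred p q i
    linarith

/-- A function on the cycle that jumps only at two places. -/
theorem eq_of_const_off_pair {f : Fin n → ℤ} {p q : Fin n} (hpq : p ≠ q)
    (h : ∀ j, j ≠ p → j ≠ q → f j = f (j - 1)) (j : Fin n) :
    f j = f q + (f p - f q) * ind p q j := by
  -- No jump occurs on the way from `q` round to `p - 1`.
  have hp : f (p - 1) = f q := by
    have key : ∀ j, ind p q j = 0 → f j = f q := by
      refine cyclic_induction (P := fun j => ind p q j = 0 → f j = f q) q (fun _ => rfl) ?_
      intro i hi h0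
      by_cases hiq : i = q
      · rw [hiq]
      by_cases hip : i = p
      · rw [hip, ind_left] at h0; omega
      rw [h i hip hiq]
      exact hi (by rw [ind_pred hip hiq, h0])
    exact key _ (ind_pred_left hpq)
  refine cyclic_induction (P := fun j => f j = f q + (f p - f q) * ind p q j) p ?_ ?_ j
  · simp [ind_left]
  · intro i hi
    by_cases hiq : i = q
    · rw [hiq]; simp [ind_right hpq]
    by_cases hip : i = p
    · rw [hip]; simp [ind_left]
    rw [h i hip hiq, hi, ind_pred hip hiq]

end Cyclic

/-! ### The Maslov index: integrality and additivity -/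

section Maslov

variable {n : ℕ} [NeZero n]

/-- The chain `c` connects the generator `x` to the generator `y`. -/
def Connects (x y : Equiv.Perm (Fin n)) (c : Chain n) : Prop :=
  ∀ i j, alphaBoundary c i j = (if y i = j then 1 else 0) - (if x i = j then 1 else 0)

theorem alphaBoundary_add (c d : Chain n) (i j : Fin n) :
    alphaBoundary (c + d) i j = alphaBoundary c i j + alphaBoundary d i j := by
  simp only [alphaBoundary, Pi.add_apply]; push_cast; ring

theorem Connects.add {x w y : Equiv.Perm (Fin n)} {c d : Chain n} (hc : Connects x w c)
    (hd : Connects w y d) : Connects x y (c + d) := by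
  intro i j
  rw [alphaBoundary_add, hc, hd]; ring

theorem Connects.right {x w y : Equiv.Perm (Fin n)} {c d : Chain n} (h : Connects x y (c + d))
    (hc : Connects x w c) : Connects w y d := by
  intro i j
  have := alphaBoundary_add c d i j
  rw [h, hc] at this
  linarith

theorem eq_of_connects {x y : Equiv.Perm (Fin n)} {c : Chain n}
    (h : Connects x y c) (hc : ∀ i j, alphaBoundary c i j = 0) : x = y := by
  ext i : 1
  have := h i (x i)
  rw [hc] at this
  by_contra hne
  simp [Ne.symm hne] at this

/-- Four times the Maslov index. -/
def around (x y : Equiv.Perm (Fin n)) (c : Chain n) : ℕ :=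
  ∑ i, (aroundPoint c i (x i) + aroundPoint c i (y i))

theorem sum_pred (f : Fin n → ℤ) : ∑ i, f (i - 1) = ∑ i, f i :=
  Equiv.sum_comp (Equiv.subRight (1 : Fin n)) f

/-- Summation by parts on the torus: the antisymmetrized integrand is a sum of differences of
products and their translates, which cancel after shifting an index. -/
theorem aroundPoint_alphaBoundary_symm (d e : Chain n) :
    ∑ i, ∑ j, (aroundPoint d i j : ℤ) * alphaBoundary e i j
      = ∑ i, ∑ j, (aroundPoint e i j : ℤ) * alphaBoundary d i j := by
  have sh1 : ∀ f : Fin n → Fin n → ℤ, ∑ i, ∑ j, f (i - 1) j = ∑ i, ∑ j, f i j := fun f =>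
    sum_pred (fun i => ∑ j, f i j)
  have sh2 : ∀ f : Fin n → Fin n → ℤ, ∑ i, ∑ j, f i (j - 1) = ∑ i, ∑ j, f i j := fun f =>
    Finset.sum_congr rfl fun i _ => sum_pred (f i)
  have e1 := sh2 (fun i j => (d i j : ℤ) * e (i - 1) j)
  have e2 := sh2 (fun i j => (d (i - 1) j : ℤ) * e i j)
  have e3 := sh1 (fun i j => (d i j : ℤ) * e i (j - 1))
  have e4 := sh1 (fun i j => (d i (j - 1) : ℤ) * e i j)
  have key : ∑ i, ∑ j, ((aroundPoint d i j : ℤ) * alphaBoundary e i j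
      - (aroundPoint e i j : ℤ) * alphaBoundary d i j)
      = 2 * (∑ i, ∑ j, (d i j : ℤ) * e (i - 1) j - ∑ i, ∑ j, (d i (j - 1) : ℤ) * e (i - 1) (j - 1))
      + 2 * (∑ i, ∑ j, (d (i - 1) (j - 1) : ℤ) * e i (j - 1) - ∑ i, ∑ j, (d (i - 1) j : ℤ) * e i j)
      + 2 * (∑ i, ∑ j, (d i j : ℤ) * e i (j - 1) - ∑ i, ∑ j, (d (i - 1) j : ℤ) * e (i - 1) (j - 1))
      + 2 * (∑ i, ∑ j, (d (i - 1) (j - 1) : ℤ) * e (i - 1) j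
        - ∑ i, ∑ j, (d i (j - 1) : ℤ) * e i j) := by
    simp only [← Finset.sum_sub_distrib, Finset.mul_sum, ← Finset.sum_add_distrib]
    refine Finset.sum_congr rfl fun i _ => Finset.sum_congr rfl fun j _ => ?_
    simp only [aroundPoint, alphaBoundary]
    push_cast; ring
  rw [← sub_eq_zero]
  simp only [← Finset.sum_sub_distrib]
  rw [key, e1, e2, e3, e4]
  ring

theorem sum_around_sub {w y : Equiv.Perm (Fin n)} {e : Chain n} (h : Connects w y e)
    (d : Chain n) : ∑ i, ((aroundPoint d i (y i) : ℤ) - aroundPoint d i (w i))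
      = ∑ i, ∑ j, (aroundPoint d i j : ℤ) * alphaBoundary e i j := by
  refine Finset.sum_congr rfl fun i _ => ?_
  simp only [h i, mul_sub, Finset.sum_sub_distrib, mul_ite, mul_one, mul_zero, Finset.sum_ite_eq,
    Finset.mem_univ, if_true]

/-- The defect of additivity is the pairing of `e` with the boundary of `d` minus the pairing of `d`
with the boundary of `e`, so the symmetry of the pairing makes it vanish. -/
theorem around_comp {x w y : Equiv.Perm (Fin n)} {d e : Chain n} (hd : Connects x w d)
    (he : Connects w y e) : around x w d + around w y e = around x y (d + e) := by
  have h1 := sum_around_sub he d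
  have h2 := sum_around_sub hd e
  have h3 := aroundPoint_alphaBoundary_symm d e
  have hadd : ∀ i j, aroundPoint (d + e) i j = aroundPoint d i j + aroundPoint e i j := by
    intro i j; simp only [aroundPoint, Pi.add_apply]; ring
  rw [Finset.sum_sub_distrib] at h1 h2
  have h4 : ∀ (a b : Equiv.Perm (Fin n)) (c : Chain n), (around a b c : ℤ)
      = ∑ i, (aroundPoint c i (a i) : ℤ) + ∑ i, (aroundPoint c i (b i) : ℤ) := by
    intro a b c
    rw [← Finset.sum_add_distrib]
    simp [around]
  have h5 : ∀ a : Equiv.Perm (Fin n), ∑ i, (aroundPoint (d + e) i (a i) : ℤ)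
      = ∑ i, (aroundPoint d i (a i) : ℤ) + ∑ i, (aroundPoint e i (a i) : ℤ) := by
    intro a
    rw [← Finset.sum_add_distrib]
    simp [hadd]
  rw [← @Nat.cast_inj ℤ]
  push_cast
  rw [h4, h4, h4, h5, h5]
  linarith

/-- With `f` and `g` the horizontal and vertical differences of `c`, the sum around a point is `4c -
2f - 2g` plus a correction that cancels between `x` and `y`. If `m` coordinates move, the sums of
`f` over `x` and over `y` differ by `m`, and likewise for `g`; the two excess terms `2m` add up to
`4m`. -/
theorem four_dvd_around {x y : Equiv.Perm (Fin n)} {c : Chain n} (h : Connects x y c) :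
    4 ∣ around x y c := by
  set f : Fin n → Fin n → ℤ := fun i j => (c i j : ℤ) - c (i - 1) j with hf
  set g : Fin n → Fin n → ℤ := fun i j => (c i j : ℤ) - c i (j - 1) with hg
  have hfj : ∀ i j, f i j - f i (j - 1) = (if x i = j then 1 else 0) - (if y i = j then 1 else 0) := by
    intro i j
    have := h i j
    simp only [alphaBoundary] at this
    simp only [hf]; linarith
  have hgj : ∀ i j, g i j - g (i - 1) j = (if x i = j then 1 else 0) - (if y i = j then 1 else 0) := by
    intro i j
    have := h i j
    simp only [alphaBoundary] at this
    simp only [hg]; linarith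
  have hap : ∀ i j, (aroundPoint c i j : ℤ) = 4 * c i j - 2 * f i j - 2 * g i j
      + ((if x i = j then 1 else 0) - (if y i = j then 1 else 0)) := by
    intro i j
    rw [← hfj]
    simp only [aroundPoint, hf, hg]; push_cast; ring
  have hfx : ∀ i, f i (x i) = f i (y i) + if x i = y i then 0 else 1 := by
    intro i
    by_cases hxy : x i = y i
    · simp [hxy]
    · rw [if_neg hxy, eq_add_ind hxy (f := f i) (fun j => by simpa [eq_comm] using hfj i j) (x i),
        ind_left]; simp
  have hgx : ∀ j, g (x.symm j) j = g (y.symm j) j + if x.symm j = y.symm j then 0 else 1 := by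
    intro j
    by_cases hxy : x.symm j = y.symm j
    · simp [hxy]
    · have := eq_add_ind hxy (f := fun i => g i j) (fun i => by
        rw [hgj]
        simp only [Equiv.eq_symm_apply]) (x.symm j)
      rw [if_neg hxy, this, ind_left]; simp
  have hgx' : ∑ i, g i (x i) = ∑ i, g i (y i) + ∑ i, (if x i = y i then 0 else 1) := by
    have e1 := Equiv.sum_comp x (fun j => g (x.symm j) j)
    have e2 := Equiv.sum_comp y (fun j => g (y.symm j) j)
    have e3 := Equiv.sum_comp x (fun j => (if x.symm j = y.symm j then (0 : ℤ) else 1))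
    simp only [Equiv.symm_apply_apply] at e1 e2 e3
    rw [e1, e2]
    simp only [hgx, Finset.sum_add_distrib]
    rw [← e3]
    simp only [Equiv.eq_symm_apply, eq_comm]
  have hfx' : ∑ i, f i (x i) = ∑ i, f i (y i) + ∑ i, (if x i = y i then 0 else 1) := by
    simp only [hfx, Finset.sum_add_distrib]
  have tot : (around x y c : ℤ) = 4 * (∑ i, (c i (x i) : ℤ) + ∑ i, (c i (y i) : ℤ)
      - ∑ i, f i (y i) - ∑ i, g i (y i) - ∑ i, (if x i = y i then 0 else 1)) := by
    have : (around x y c : ℤ) = 4 * (∑ i, (c i (x i) : ℤ)) + 4 * (∑ i, (c i (y i) : ℤ))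
      - 2 * ∑ i, f i (x i) - 2 * ∑ i, g i (x i) - 2 * ∑ i, f i (y i) - 2 * ∑ i, g i (y i) := by
      simp only [around, Finset.mul_sum, ← Finset.sum_add_distrib, ← Finset.sum_sub_distrib]
      push_cast
      refine Finset.sum_congr rfl fun i _ => ?_
      rw [hap i (x i), hap i (y i), if_pos rfl, if_pos rfl]
      by_cases hxy : x i = y i
      · rw [if_pos hxy, if_pos hxy.symm]; ring
      · rw [if_neg hxy, if_neg (Ne.symm hxy)]; ring
    rw [this, hfx', hgx']; ring
  rw [← Int.natCast_dvd_natCast, tot]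
  exact Dvd.intro _ rfl

namespace PosDomain

variable {G : GridDiagram n}

theorem connects (D : PosDomain G) : Connects D.src D.tgt D.coeff := D.boundary

theorem four_mul_mu (D : PosDomain G) : 4 * D.mu = around D.src D.tgt D.coeff :=
  Nat.mul_div_cancel' (four_dvd_around D.connects)

theorem IsComp.mu_add {R E D : PosDomain G} (h : IsComp R E D) : R.mu + E.mu = D.mu := by
  obtain ⟨h1, h2, h3, h4⟩ := h
  have := around_comp R.connects (h2 ▸ E.connects)
  rw [h1, h3, h4, ← D.four_mul_mu] at this
  have hR := R.four_mul_mu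
  have hE := E.four_mul_mu
  rw [h1] at hR
  rw [h3, ← h2] at hE
  omega

theorem mu_eq_zero_of_coeff {D : PosDomain G} (h : D.coeff = 0) : D.mu = 0 := by
  have := D.four_mul_mu
  rw [h] at this
  simpa [around, aroundPoint] using this

theorem src_eq_tgt_of_coeff {D : PosDomain G} (h : D.coeff = 0) : D.src = D.tgt :=
  eq_of_connects D.connects (by rw [h]; intro i j; simp [alphaBoundary])

theorem one_le_aroundPoint_src {D : PosDomain G} {i : Fin n} (h : D.src i ≠ D.tgt i) :
    1 ≤ aroundPoint D.coeff i (D.src i) := by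
  have := D.boundary i (D.src i)
  rw [if_neg (Ne.symm h), if_pos rfl] at this
  simp only [alphaBoundary] at this
  simp only [aroundPoint]
  omega

theorem one_le_aroundPoint_tgt {D : PosDomain G} {i : Fin n} (h : D.src i ≠ D.tgt i) :
    1 ≤ aroundPoint D.coeff i (D.tgt i) := by
  have := D.boundary i (D.tgt i)
  rw [if_neg h, if_pos rfl] at this
  simp only [alphaBoundary] at this
  simp only [aroundPoint]
  omega

theorem one_le_mu {D : PosDomain G} (h : D.src ≠ D.tgt) : 1 ≤ D.mu := by
  obtain ⟨i, hi⟩ : ∃ i, D.src i ≠ D.tgt i := by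
    by_contra hc
    push Not at hc
    exact h (Equiv.ext hc)
  have h1 := one_le_aroundPoint_src hi
  have h2 := D.four_mul_mu
  have h3 := Finset.single_le_sum (f := fun i => aroundPoint D.coeff i (D.src i)
    + aroundPoint D.coeff i (D.tgt i)) (fun _ _ => Nat.zero_le _) (Finset.mem_univ i)
  simp only [around] at h2
  omega

end PosDomain

end Maslov

/-! ### Domains of index one and two -/

section Rectangles

variable {n : ℕ} [NeZero n]

/-- The indicator chain of the rectangle `[a, b) × [x a, x b)`. -/
def rect (x : Equiv.Perm (Fin n)) (a b : Fin n) : Chain n :=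
  fun i j => ind a b i * ind (x a) (x b) j

theorem alphaBoundary_mul (f g : Fin n → ℕ) (i j : Fin n) :
    alphaBoundary (fun i j => f i * g j) i j
      = -(((f i : ℤ) - f (i - 1)) * ((g j : ℤ) - g (j - 1))) := by
  simp only [alphaBoundary]; push_cast; ring

theorem aroundPoint_mul (f g : Fin n → ℕ) (i j : Fin n) :
    aroundPoint (fun i j => f i * g j) i j = (f i + f (i - 1)) * (g j + g (j - 1)) := by
  simp only [aroundPoint]; ring

theorem connects_rect (x : Equiv.Perm (Fin n)) {a b : Fin n} (hab : a ≠ b) :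
    Connects x (x * Equiv.swap a b) (rect x a b) := by
  intro i j
  have hx : x a ≠ x b := x.injective.ne hab
  unfold rect
  rw [alphaBoundary_mul, ind_sub_pred _ _, ind_sub_pred _ _, Equiv.Perm.mul_apply]
  by_cases hia : i = a
  · subst hia
    simp only [Equiv.swap_apply_left, if_true, if_neg hab, @eq_comm _ j]
    ring
  by_cases hib : i = b
  · subst hib
    simp only [Equiv.swap_apply_right, if_true, if_neg hia, @eq_comm _ j]
    ring
  rw [Equiv.swap_apply_of_ne_of_ne hia hib]
  simp [hia, hib]

theorem around_rect (x : Equiv.Perm (Fin n)) {a b : Fin n} (hab : a ≠ b)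
    (hemp : ∀ i, i ≠ a → i ≠ b → rect x a b i (x i) = 0) :
    around x (x * Equiv.swap a b) (rect x a b) = 4 := by
  have hx : x a ≠ x b := x.injective.ne hab
  have e1 : ∀ {p q : Fin n}, p ≠ q → ind p q p + ind p q (p - 1) = 1 := fun h => by
    rw [ind_left, ind_pred_left h]
  have e2 : ∀ {p q : Fin n}, p ≠ q → ind p q q + ind p q (q - 1) = 1 := fun h => by
    rw [ind_right h, ind_pred_right h]
  unfold around
  rw [← Finset.sum_subset (Finset.subset_univ {a, b})]
  · rw [Finset.sum_pair hab]
    simp only [Equiv.Perm.mul_apply, Equiv.swap_apply_left, Equiv.swap_apply_right]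
    unfold rect
    simp only [aroundPoint_mul, e1 hab, e2 hab, e1 hx, e2 hx]
  · intro i _ hi
    simp only [Finset.mem_insert, Finset.mem_singleton, not_or] at hi
    obtain ⟨hia, hib⟩ := hi
    have hz := hemp i hia hib
    rw [Equiv.Perm.mul_apply, Equiv.swap_apply_of_ne_of_ne hia hib]
    unfold rect at hz ⊢
    rw [aroundPoint_mul, ind_pred hia hib, ind_pred (x.injective.ne hia) (x.injective.ne hib)]
    rcases Nat.mul_eq_zero.1 hz with h | h <;> simp [h]

/-- The multiplicities of a periodic domain split as a function of the column plus a function of the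
row, and each unit in a column or row contributes `8`. So the Maslov index is even, which excludes
index one. -/
theorem around_of_src_eq_tgt {x : Equiv.Perm (Fin n)} {c : Chain n} (h : Connects x x c) :
    8 ∣ around x x c := by
  have hT : ∀ i j, (c i j : ℤ) - c i (j - 1) = c (i - 1) j - c (i - 1) (j - 1) := by
    intro i j
    have := h i j
    simp only [alphaBoundary] at this
    linarith
  have h1 : ∀ i j, (c i j : ℤ) - c i (j - 1) = c 0 j - c 0 (j - 1) := by
    intro i j
    refine cyclic_induction (P := fun i => (c i j : ℤ) - c i (j - 1) = c 0 j - c 0 (j - 1)) 0 rfl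
      (fun i hi => ?_) i
    rw [hT, hi]
  have h2 : ∀ i j, (c i j : ℤ) = c i 0 + c 0 j - c 0 0 := by
    intro i j
    refine cyclic_induction (P := fun j => (c i j : ℤ) = c i 0 + c 0 j - c 0 0) 0 (by ring)
      (fun j hj => ?_) j
    linarith [h1 i j]
  have s1 := sum_pred (fun i => (c i 0 : ℤ))
  have s2 := sum_pred (fun j => (c 0 j : ℤ) - c 0 0)
  have s3 := Equiv.sum_comp x (fun j => (c 0 j : ℤ) - c 0 0)
  have s4 := Equiv.sum_comp x (fun j => (c 0 (j - 1) : ℤ) - c 0 0)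
  have key : (around x x c : ℤ) = 8 * (∑ i, (c i 0 : ℤ) + ∑ j, ((c 0 j : ℤ) - c 0 0)) := by
    have : (around x x c : ℤ) = 4 * ∑ i, (c i 0 : ℤ) + 4 * ∑ i, (c (i - 1) 0 : ℤ)
        + 4 * ∑ i, ((c 0 (x i) : ℤ) - c 0 0) + 4 * ∑ i, ((c 0 (x i - 1) : ℤ) - c 0 0) := by
      simp only [around, Finset.mul_sum, ← Finset.sum_add_distrib]
      push_cast
      refine Finset.sum_congr rfl fun i _ => ?_
      simp only [aroundPoint]
      push_cast
      rw [h2 i (x i), h2 (i - 1) (x i), h2 i (x i - 1), h2 (i - 1) (x i - 1)]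
      ring
    rw [this, s1, s3, s4, s2]; ring
  rw [← Int.natCast_dvd_natCast, key]
  exact Dvd.intro _ rfl

theorem const_of_alphaBoundary {c : Chain n} {i : Fin n} (h : ∀ j, alphaBoundary c i j = 0)
    {k : Fin n} (hk : c i k = 0) (hk' : c (i - 1) k = 0) (j : Fin n) : c i j = c (i - 1) j := by
  refine cyclic_induction (P := fun j => c i j = c (i - 1) j) k (by rw [hk, hk']) (fun j hj => ?_) j
  have := h j
  simp only [alphaBoundary] at this
  omega

theorem const_of_alphaBoundary' {c : Chain n} {j : Fin n} (h : ∀ i, alphaBoundary c i j = 0)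
    {k : Fin n} (hk : c k j = 0) (hk' : c k (j - 1) = 0) (i : Fin n) : c i j = c i (j - 1) := by
  refine cyclic_induction (P := fun i => c i j = c i (j - 1)) k (by rw [hk, hk']) (fun i hi => ?_) i
  have := h i
  simp only [alphaBoundary] at this
  omega

theorem rowChain_injective : Function.Injective (rowChain : Fin n → Chain n) := by
  intro j j' h
  have := congrFun (congrFun h 0) j
  by_contra hne
  simp [rowChain, hne] at this

theorem colChain_injective : Function.Injective (colChain : Fin n → Chain n) := by
  intro i i' h
  have := congrFun (congrFun h i) 0
  by_contra hne
  simp [colChain, hne] at this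

namespace PosDomain

variable {G : GridDiagram n}

/-- Each moving coordinate accounts for at least `2` of the total `4`: at least `1` at its old and
at its new place. Hence exactly two coordinates move and the multiplicities around the others
vanish. The multiplicities then jump only at the two columns and two rows involved, so four values
determine the domain. -/
theorem exists_rect {R : PosDomain G} (hR : R.mu = 1) :
    ∃ a b, a ≠ b ∧ R.tgt = R.src * Equiv.swap a b ∧ R.coeff = rect R.src a b ∧
      ∀ i, i ≠ a → i ≠ b → rect R.src a b i (R.src i) = 0 := by
  obtain ⟨x, y, c, hc, hav⟩ := R
  replace hc : Connects x y c := hc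
  have h4 := four_mul_mu (⟨x, y, c, hc, hav⟩ : PosDomain G)
  rw [hR] at h4
  simp only at h4 ⊢
  have hxy : x ≠ y := by
    rintro rfl
    have := around_of_src_eq_tgt hc
    omega
  obtain ⟨a, ha⟩ : ∃ i, x i ≠ y i := by
    by_contra hcon
    push Not at hcon
    exact hxy (Equiv.ext hcon)
  obtain ⟨b, hb⟩ := x.surjective (y a)
  have hab : a ≠ b := by rintro rfl; exact ha hb
  have hyb : x b ≠ y b := by
    intro h; exact hab (y.injective (by rw [← h, hb]))
  have mv : ∀ i, x i ≠ y i → 1 ≤ aroundPoint c i (x i) ∧ 1 ≤ aroundPoint c i (y i) := fun i hi =>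
    ⟨one_le_aroundPoint_src (D := (⟨x, y, c, hc, hav⟩ : PosDomain G)) hi,
      one_le_aroundPoint_tgt (D := (⟨x, y, c, hc, hav⟩ : PosDomain G)) hi⟩
  have hma := mv a ha
  have hmb := mv b hyb
  set F : Fin n → ℕ := fun i => aroundPoint c i (x i) + aroundPoint c i (y i) with hF
  have hsum : ∑ i, F i = 4 := by rw [hF]; exact h4.symm
  have hoth : ∀ i, i ≠ a → i ≠ b → F i = 0 := by
    intro i hia hib
    have h3 : ∑ k ∈ ({a, b, i} : Finset (Fin n)), F k ≤ ∑ k, F k :=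
      Finset.sum_le_sum_of_subset (Finset.subset_univ _)
    rw [Finset.sum_insert (by simp [hab, Ne.symm hia]), Finset.sum_pair (Ne.symm hib), hsum] at h3
    simp only [hF] at h3 ⊢
    omega
  have hsum2 : F a + F b = 4 := by
    rw [← Finset.sum_pair hab, ← hsum]
    refine Finset.sum_subset (Finset.subset_univ _) fun i _ hi => ?_
    simp only [Finset.mem_insert, Finset.mem_singleton, not_or] at hi
    exact hoth i hi.1 hi.2
  have hfix : ∀ i, i ≠ a → i ≠ b → y i = x i := by
    intro i hia hib
    by_contra hne
    have h1 := mv i (Ne.symm hne)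
    have h2 := hoth i hia hib
    simp only [hF] at h2
    omega
  have hyb' : y b = x a := by
    obtain ⟨k, hk⟩ := x.surjective (y b)
    by_cases hka : k = a
    · rw [← hk, hka]
    by_cases hkb : k = b
    · exact absurd (hkb ▸ hk) hyb
    exact absurd (y.injective ((hfix k hka hkb).trans hk)) hkb
  have hyx : y = x * Equiv.swap a b := by
    ext i : 1
    rw [Equiv.Perm.mul_apply]
    by_cases hia : i = a
    · rw [hia, Equiv.swap_apply_left, hb]
    by_cases hib : i = b
    · rw [hib, Equiv.swap_apply_right, hyb']
    rw [Equiv.swap_apply_of_ne_of_ne hia hib, hfix i hia hib]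
  have hx : x a ≠ x b := x.injective.ne hab
  have hz : ∀ i, i ≠ a → i ≠ b → aroundPoint c i (x i) = 0 := by
    intro i hia hib
    have := hoth i hia hib
    simp only [hF] at this
    omega
  have hcol : ∀ i, i ≠ a → i ≠ b → ∀ j, c i j = c (i - 1) j := by
    intro i hia hib
    have h0 := hz i hia hib
    simp only [aroundPoint] at h0
    refine const_of_alphaBoundary (k := x i) (fun j => ?_) (by omega) (by omega)
    rw [hc, hfix i hia hib]; ring
  have hrow : ∀ j, j ≠ x a → j ≠ x b → ∀ i, c i j = c i (j - 1) := by
    intro j hja hjb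
    obtain ⟨k, rfl⟩ := x.surjective j
    have hka : k ≠ a := fun h => hja (by rw [h])
    have hkb : k ≠ b := fun h => hjb (by rw [h])
    have h0 := hz k hka hkb
    simp only [aroundPoint] at h0
    refine const_of_alphaBoundary' (k := k) (fun i => ?_) (by omega) (by omega)
    rw [hc]
    simp only [show (y i = x k) ↔ (x i = x k) by
      rw [← hfix k hka hkb, y.injective.eq_iff, hfix k hka hkb, x.injective.eq_iff], sub_self]
  have cf : ∀ i j, (c i j : ℤ) = c b j + ((c a j : ℤ) - c b j) * ind a b i := fun i j =>
    eq_of_const_off_pair (f := fun i => (c i j : ℤ)) hab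
      (fun i hia hib => by simp only [hcol i hia hib j]) i
  have rf : ∀ i j, (c i j : ℤ) = c i (x b) + ((c i (x a) : ℤ) - c i (x b)) * ind (x a) (x b) j :=
    fun i j => eq_of_const_off_pair (f := fun j => (c i j : ℤ)) hx
      (fun j hja hjb => by simp only [hrow j hja hjb i]) j
  have ca : ∀ j, c (a - 1) j = c b j := by
    intro j
    have := cf (a - 1) j
    rw [ind_pred_left hab] at this
    simpa using this
  have ra : ∀ i, c i (x a - 1) = c i (x b) := by
    intro i
    have := rf i (x a - 1)
    rw [ind_pred_left hx] at this
    simpa using this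
  have hA : aroundPoint c a (x a) = 1 := by
    simp only [hF] at hsum2; omega
  have hB := hc a (x a)
  rw [if_neg (Ne.symm ha), if_pos rfl] at hB
  simp only [alphaBoundary, aroundPoint, ca, ra] at hA hB
  have hem : ∀ i, i ≠ a → i ≠ b → c i (x i) = 0 := by
    intro i hia hib
    have := hz i hia hib
    simp only [aroundPoint] at this
    omega
  -- The four values add up to `1`, and the boundary condition at the corner puts this `1` in one of
  -- two diagonally opposite blocks. The second possibility is the rectangle with `a` and `b`
  -- exchanged.
  have hcases : (c a (x a) = 1 ∧ c a (x b) = 0 ∧ c b (x a) = 0 ∧ c b (x b) = 0) ∨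
      (c a (x a) = 0 ∧ c a (x b) = 0 ∧ c b (x a) = 0 ∧ c b (x b) = 1) := by omega
  rcases hcases with ⟨h1, h2, h3, h5⟩ | ⟨h1, h2, h3, h5⟩
  · have hcr : c = rect x a b := by
      ext i j
      have e := cf i j
      rw [rf a j, rf b j, h1, h2, h3, h5] at e
      zify [rect]
      rw [e]; push_cast; ring
    exact ⟨a, b, hab, hyx, hcr, fun i hia hib => hcr ▸ hem i hia hib⟩
  · have hcr : c = rect x b a := by
      ext i j
      have e := cf i j
      rw [rf a j, rf b j, h1, h2, h3, h5] at e
      have i1 := ind_add_swap hab i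
      have i2 := ind_add_swap hx j
      have i1' : (ind a b i : ℤ) = 1 - ind b a i := by omega
      have i2' : (ind (x a) (x b) j : ℤ) = 1 - ind (x b) (x a) j := by omega
      zify [rect]
      rw [e, i1', i2']; push_cast; ring
    exact ⟨b, a, hab.symm, by rw [Equiv.swap_comm]; exact hyx, hcr,
      fun i hia hib => hcr ▸ hem i hib hia⟩

theorem mu_eq_one_of_rect {R : PosDomain G} {a b : Fin n} (hab : a ≠ b)
    (ht : R.tgt = R.src * Equiv.swap a b) (hc : R.coeff = rect R.src a b)
    (hemp : ∀ i, i ≠ a → i ≠ b → rect R.src a b i (R.src i) = 0) : R.mu = 1 := by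
  have := R.four_mul_mu
  rw [ht, hc, around_rect _ hab hemp] at this
  omega

theorem IsComp.ext_of_fst {R S S' D : PosDomain G} (h : IsComp R S D)
    (h' : IsComp R S' D) : S = S' := by
  refine PosDomain.ext (h.2.1.symm.trans h'.2.1) (h.2.2.1.trans h'.2.2.1.symm) ?_
  exact add_left_cancel (h.2.2.2.trans h'.2.2.2.symm)

theorem exists_isComp_of_le (D : PosDomain G) {w : Equiv.Perm (Fin n)} {c : Chain n}
    (hc : Connects D.src w c) (hle : c ≤ D.coeff) :
    ∃ R S : PosDomain G, IsComp R S D ∧ R.tgt = w ∧ R.coeff = c := by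
  have hadd : c + (D.coeff - c) = D.coeff := by
    ext i j
    have : c i j ≤ D.coeff i j := hle i j
    simp only [Pi.add_apply, Pi.sub_apply]
    omega
  have hS : Connects w D.tgt (D.coeff - c) := Connects.right (hadd.symm ▸ D.connects) hc
  refine ⟨⟨D.src, w, c, hc, ?_⟩, ⟨w, D.tgt, D.coeff - c, hS, ?_⟩, ⟨rfl, rfl, rfl, hadd⟩, rfl, rfl⟩
  · have : c _ _ ≤ D.coeff _ _ := hle (G.xCol (last n)) (G.xRow (last n))
    rw [D.avoids] at this
    omega
  · simp [D.avoids]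

/-- Both factors have distinct ends, hence positive index, and the indices add up to two. -/
theorem exists_isComp_of_rect_le {D : PosDomain G} (hD : D.mu = 2) {p q : Fin n} (hpq : p ≠ q)
    (hle : rect D.src p q ≤ D.coeff) (hne : D.src * Equiv.swap p q ≠ D.tgt) :
    ∃ R S : PosDomain G, R.mu = 1 ∧ S.mu = 1 ∧ IsComp R S D ∧ R.tgt = D.src * Equiv.swap p q := by
  obtain ⟨R, S, h, ht, -⟩ := D.exists_isComp_of_le (connects_rect D.src hpq) hle
  have h1 : 1 ≤ R.mu := one_le_mu (by
    rw [ht, h.1]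
    intro e
    have := congrArg (fun σ => σ p) e
    simp [hpq] at this)
  have h2 : 1 ≤ S.mu := one_le_mu (by rw [← h.2.1, h.2.2.1, ht]; exact hne)
  have := h.mu_add
  exact ⟨R, S, by omega, by omega, h, ht⟩

theorem mem_decompositions {D : PosDomain G} {p : PosDomain G × PosDomain G} :
    p ∈ D.decompositions ↔ IsComp p.1 p.2 D := by
  simp [decompositions]

/-- If two rectangles in a row have exactly one column in common, a third rectangle with the same
initial generator is contained in their sum. -/
theorem exists_rect_le_of_shared {x : Equiv.Perm (Fin n)} {a b c d : Fin n} (hab : a ≠ b)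
    (hcd : c ≠ d) (h1 : ¬ (c = a ∧ d = b)) (h2 : ¬ (c = b ∧ d = a)) :
    ∃ p q, p ≠ q ∧ Equiv.swap p q ≠ Equiv.swap a b ∧
      rect x p q ≤ rect x a b + rect (x * Equiv.swap a b) c d := by
  have xin := x.injective
  have sw : ∀ p q, p ≠ q → ∀ e, e ≠ a → e ≠ b → (p = e ∨ q = e) →
      Equiv.swap p q ≠ Equiv.swap a b := by
    intro p q hpq e hea heb he h
    have := congrArg (fun σ => σ e) h
    simp only [Equiv.swap_apply_of_ne_of_ne hea heb] at this
    rcases he with rfl | rfl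
    · rw [Equiv.swap_apply_left] at this; exact hpq this.symm
    · rw [Equiv.swap_apply_right] at this; exact hpq this
  have ww : ∀ e, e ≠ a → e ≠ b → (x * Equiv.swap a b) e = x e := by
    intro e hea heb
    rw [Equiv.Perm.mul_apply, Equiv.swap_apply_of_ne_of_ne hea heb]
  have wa : (x * Equiv.swap a b) a = x b := by simp
  have wb : (x * Equiv.swap a b) b = x a := by simp
  by_cases hca : c = a
  · subst hca
    have hda : d ≠ c := hcd.symm
    have hdb : d ≠ b := fun h => h1 ⟨rfl, h⟩
    -- If the second rectangle is the narrower one, the rectangle over its columns and the combined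
    -- heights lies in the union. Otherwise the part of the second rectangle to the right of `b` is
    -- used.
    rcases ind_trichotomy hdb hab with h | h
    · refine ⟨c, d, hcd, sw c d hcd d hda hdb (Or.inr rfl), fun i j => ?_⟩
      have e1 := ind_le_left h hcd i
      have e2 := ind_le_add (x c) (x b) (x d) j (xin.ne hcd)
      have e3 : ind c d i * ind (x c) (x d) j
          ≤ ind c d i * ind (x c) (x b) j + ind c d i * ind (x b) (x d) j := by
        rw [← mul_add]; exact Nat.mul_le_mul_left _ e2
      have e4 := Nat.mul_le_mul_right (ind (x c) (x b) j) e1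
      simp only [rect, Pi.add_apply, wa, ww d hda hdb]
      omega
    · refine ⟨b, d, hdb.symm, sw b d hdb.symm d hda hdb (Or.inr rfl), fun i j => ?_⟩
      have e1 := Nat.mul_le_mul_right (ind (x b) (x d) j) (ind_le_right h i)
      simp only [rect, Pi.add_apply, wa, ww d hda hdb]
      omega
  by_cases hdb : d = b
  · subst hdb
    rcases ind_trichotomy hcd hab with h | h
    · refine ⟨c, d, hcd, sw c d hcd c hca hcd (Or.inl rfl), fun i j => ?_⟩
      have e1 := ind_le_right h i
      have e2 := ind_le_add (x c) (x a) (x d) j (xin.ne hcd)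
      have e3 : ind c d i * ind (x c) (x d) j
          ≤ ind c d i * ind (x c) (x a) j + ind c d i * ind (x a) (x d) j := by
        rw [← mul_add]; exact Nat.mul_le_mul_left _ e2
      have e4 := Nat.mul_le_mul_right (ind (x a) (x d) j) e1
      simp only [rect, Pi.add_apply, wb, ww c hca hcd]
      omega
    · have h' : ind c d a = 1 := by
        rcases ind_trichotomy hab hcd with h'' | h''
        · exact h''
        · exfalso
          clear sw ww wa wb
          unfold ind at h h''
          simp only [Fin.lt_def, Fin.le_def, Fin.ext_iff, ne_eq] at *
          split_ifs at * <;> omega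
      refine ⟨c, a, hca, sw c a hca c hca hcd (Or.inl rfl), fun i j => ?_⟩
      have e1 := Nat.mul_le_mul_right (ind (x c) (x a) j) (ind_le_left h' hca i)
      simp only [rect, Pi.add_apply, wb, ww c hca hcd]
      omega
  by_cases hcb : c = b
  · subst hcb
    have hda : d ≠ a := fun h => h2 ⟨rfl, h⟩
    rcases ind_trichotomy (xin.ne hdb) (xin.ne hab) with h | h
    · refine ⟨a, d, Ne.symm hda, sw a d (Ne.symm hda) d hda hdb (Or.inr rfl), fun i j => ?_⟩
      have e1 := ind_le_left h (xin.ne (Ne.symm hda)) j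
      have e2 := ind_le_add a c d i (Ne.symm hda)
      have e3 : ind a d i * ind (x a) (x d) j
          ≤ ind a c i * ind (x a) (x d) j + ind c d i * ind (x a) (x d) j := by
        rw [← add_mul]; exact Nat.mul_le_mul_right _ e2
      have e4 := Nat.mul_le_mul_left (ind a c i) e1
      simp only [rect, Pi.add_apply, wb, ww d hda hdb]
      omega
    · refine ⟨c, d, hcd, sw c d hcd d hda hdb (Or.inr rfl), fun i j => ?_⟩
      have e1 := Nat.mul_le_mul_left (ind c d i) (ind_le_right h j)
      simp only [rect, Pi.add_apply, wb, ww d hda hdb]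
      omega
  by_cases hda : d = a
  · subst hda
    rcases ind_trichotomy (xin.ne hcb) (xin.ne hab) with h | h
    · refine ⟨c, b, hcb, sw c b hcb c hca hcb (Or.inl rfl), fun i j => ?_⟩
      have e1 := ind_le_right h j
      have e2 := ind_le_add c d b i hcb
      have e3 : ind c b i * ind (x c) (x b) j
          ≤ ind c d i * ind (x c) (x b) j + ind d b i * ind (x c) (x b) j := by
        rw [← add_mul]; exact Nat.mul_le_mul_right _ e2
      have e4 := Nat.mul_le_mul_left (ind d b i) e1
      simp only [rect, Pi.add_apply, wa, ww c hca hcb]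
      omega
    · have h' : ind (x c) (x b) (x d) = 1 := by
        rcases ind_trichotomy (xin.ne hab) (xin.ne hcb) with h'' | h''
        · exact h''
        · exfalso
          have := xin.ne hab
          have := xin.ne hca
          have := xin.ne hcb
          clear sw ww wa wb
          generalize x c = p at *
          generalize x b = q at *
          generalize x d = r at *
          clear xin
          unfold ind at h h''
          simp only [Fin.lt_def, Fin.le_def, Fin.ext_iff, ne_eq] at *
          split_ifs at * <;> omega
      refine ⟨c, d, hcd, sw c d hcd c hca hcb (Or.inl rfl), fun i j => ?_⟩
      have e1 := Nat.mul_le_mul_left (ind c d i) (ind_le_left h' (xin.ne hca) j)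
      simp only [rect, Pi.add_apply, wa, ww c hca hcb]
      omega
  -- When no column is shared, the second rectangle has the same corners for `x` and can be taken
  -- first.
  · refine ⟨c, d, hcd, sw c d hcd c hca hcb (Or.inl rfl), fun i j => ?_⟩
    simp only [rect, Pi.add_apply, ww c hca hcb, ww d hda hdb]
    omega

/-- If both rectangles use the same two columns, emptiness forces their sum to be a single column or
a single row. Otherwise `exists_rect_le_of_shared` supplies a different rectangle to start with, and
its complement is again a rectangle. -/
theorem exists_other_isComp {R S D : PosDomain G} (hR : R.mu = 1) (hS : S.mu = 1)
    (h : IsComp R S D) (hrow : ∀ j, D.coeff ≠ rowChain j) (hcol : ∀ i, D.coeff ≠ colChain i) :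
    ∃ R' S' : PosDomain G, R'.mu = 1 ∧ S'.mu = 1 ∧ IsComp R' S' D ∧ R' ≠ R := by
  obtain ⟨a, b, hab, hRt, hRc, hRe⟩ := exists_rect hR
  obtain ⟨c, d, hcd, hSt, hSc, hSe⟩ := exists_rect hS
  have hD : D.mu = 2 := by rw [← h.mu_add, hR, hS]
  obtain ⟨h1, h2, h3, h4⟩ := h
  rw [← h2] at hSt hSc hSe
  rw [h1] at hRt hRc hRe
  rw [hRt] at hSt hSc hSe
  rw [hRc, hSc] at h4
  set x := D.src with hx
  have hxab := x.injective.ne hab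
  have wa : (x * Equiv.swap a b) a = x b := by simp
  have wb : (x * Equiv.swap a b) b = x a := by simp
  have ww : ∀ e, e ≠ a → e ≠ b → (x * Equiv.swap a b) e = x e := by
    intro e hea heb
    rw [Equiv.Perm.mul_apply, Equiv.swap_apply_of_ne_of_ne hea heb]
  by_cases k1 : c = a ∧ d = b
  · obtain ⟨rfl, rfl⟩ := k1
    exfalso
    -- The rectangles lie over the same columns and have complementary rows, so a coordinate in a
    -- further column would lie in one of them.
    have hz : ∀ i, i ≠ c → ind c d i = 0 := by
      intro i hic
      by_cases hid : i = d
      · rw [hid, ind_right hcd]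
      have e1 := hRe i hic hid
      have e2 := hSe i hic hid
      have e3 := ind_add_swap hxab (x i)
      simp only [rect, wa, wb, ww i hic hid] at e1 e2
      rcases Nat.mul_eq_zero.1 e1 with e1 | e1
      · exact e1
      rcases Nat.mul_eq_zero.1 e2 with e2 | e2
      · exact e2
      omega
    apply hcol c
    rw [← h4]
    ext i j
    have e3 := ind_add_swap hxab j
    simp only [rect, wa, wb, Pi.add_apply, colChain]
    rw [← mul_add, e3, mul_one]
    split_ifs with hi
    · rw [hi, ind_left]
    · exact hz i hi
  by_cases k2 : c = b ∧ d = a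
  · obtain ⟨rfl, rfl⟩ := k2
    exfalso
    have hz : ∀ j, j ≠ x d → ind (x d) (x c) j = 0 := by
      intro j hj
      obtain ⟨i, rfl⟩ := x.surjective j
      have hid : i ≠ d := fun e => hj (by rw [e])
      by_cases hic : i = c
      · rw [hic, ind_right hxab]
      have e1 := hRe i hid hic
      have e2 := hSe i hic hid
      have e3 := ind_add_swap hab i
      simp only [rect, wa, wb, ww i hid hic] at e1 e2
      rcases Nat.mul_eq_zero.1 e1 with e1 | e1
      · rcases Nat.mul_eq_zero.1 e2 with e2 | e2
        · omega
        · exact e2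
      · exact e1
    apply hrow (x d)
    rw [← h4]
    ext i j
    have e3 := ind_add_swap hab i
    simp only [rect, wa, wb, Pi.add_apply, rowChain]
    rw [← add_mul, e3, one_mul]
    split_ifs with hi
    · rw [hi, ind_left]
    · exact hz j hi
  obtain ⟨p, q, hpq, hsw, hle⟩ := exists_rect_le_of_shared (x := x) hab hcd k1 k2
  rw [h4] at hle
  -- A single transposition is not a product of two, because the signs differ.
  obtain ⟨R', S', hR', hS', hcomp, ht⟩ := exists_isComp_of_rect_le hD hpq hle (by
    rw [← h3, hSt]
    intro e
    have := congrArg Equiv.Perm.sign e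
    simp [Equiv.Perm.sign_swap hab, Equiv.Perm.sign_swap hcd, Equiv.Perm.sign_swap hpq, ← hx] at this)
  refine ⟨R', S', hR', hS', hcomp, ?_⟩
  rintro rfl
  rw [hRt] at ht
  exact hsw (mul_left_cancel ht).symm

theorem src_eq_tgt_of_rowChain {D : PosDomain G} {j : Fin n} (h : D.coeff = rowChain j) :
    D.src = D.tgt :=
  eq_of_connects D.connects (by intro i k; simp [h, alphaBoundary, rowChain])

theorem src_eq_tgt_of_colChain {D : PosDomain G} {j : Fin n} (h : D.coeff = colChain j) :
    D.src = D.tgt :=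
  eq_of_connects D.connects (by intro i k; simp [h, alphaBoundary, colChain])

theorem mu_of_rowChain {D : PosDomain G} {j : Fin n} (h : D.coeff = rowChain j) : D.mu = 2 := by
  have := D.four_mul_mu
  rw [src_eq_tgt_of_rowChain h, h] at this
  have e : ∀ i, aroundPoint (rowChain j) i (D.tgt i)
      = (if D.tgt i = j then 2 else 0) + (if D.tgt i = j + 1 then 2 else 0) := by
    intro i
    simp only [aroundPoint, rowChain, sub_eq_iff_eq_add]
    split_ifs <;> rfl
  simp only [around, e, Finset.sum_add_distrib] at this
  rw [Equiv.sum_comp D.tgt (fun k => if k = j then 2 else 0),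
    Equiv.sum_comp D.tgt (fun k => if k = j + 1 then 2 else 0)] at this
  simp at this
  omega

theorem mu_of_colChain {D : PosDomain G} {j : Fin n} (h : D.coeff = colChain j) : D.mu = 2 := by
  have := D.four_mul_mu
  rw [src_eq_tgt_of_colChain h, h] at this
  have e : ∀ i, aroundPoint (colChain j) i (D.tgt i)
      = (if i = j then 2 else 0) + (if i = j + 1 then 2 else 0) := by
    intro i
    simp only [aroundPoint, colChain, sub_eq_iff_eq_add]
    split_ifs <;> rfl
  simp only [around, e, Finset.sum_add_distrib] at this
  simp at this
  omega

/-- For `n = 1` the only square carries the marking `X`, so every domain is zero. This rules out the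
degenerate torus, where a row is also a column. -/
theorem ne_succ_of_coeff_ne (h : ∃ (D : PosDomain G), D.coeff ≠ 0) (j : Fin n) : j ≠ j + 1 := by
  obtain ⟨D, hD⟩ := h
  intro hj
  have h2 := val_succ j
  rw [← hj] at h2
  have hjn := j.2
  have hn : n = 1 := by split_ifs at h2 <;> omega
  subst hn
  apply hD
  ext i k
  have := D.avoids
  rw [Subsingleton.elim i (G.xCol (last 1)), Subsingleton.elim k (G.xRow (last 1)), this]
  rfl

/-- The row is cut at the coordinates of the generator on its lower and upper circles. -/
theorem exists_isComp_of_rowChain {D : PosDomain G} {j : Fin n} (h : D.coeff = rowChain j) :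
    ∃ R S : PosDomain G, R.mu = 1 ∧ S.mu = 1 ∧ IsComp R S D := by
  have hj : j ≠ j + 1 := ne_succ_of_coeff_ne ⟨D, fun e => by
    have := congrFun (congrFun (h.symm.trans e) 0) j
    simp [rowChain] at this⟩ j
  have hab : D.src.symm j ≠ D.src.symm (j + 1) := D.src.symm.injective.ne hj
  obtain ⟨R, S, h1, h2, h3, -⟩ := exists_isComp_of_rect_le (mu_of_rowChain h) hab (by
    rw [h]
    intro i k
    simp only [rect, Equiv.apply_symm_apply, ind_succ, rowChain]
    have := ind_le_one (D.src.symm j) (D.src.symm (j + 1)) i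
    split_ifs <;> omega) (by
    rw [← src_eq_tgt_of_rowChain h]
    intro e
    have := congrArg (fun σ => σ (D.src.symm j)) e
    simp [hj.symm] at this)
  exact ⟨R, S, h1, h2, h3⟩

theorem exists_isComp_of_colChain {D : PosDomain G} {j : Fin n} (h : D.coeff = colChain j) :
    ∃ R S : PosDomain G, R.mu = 1 ∧ S.mu = 1 ∧ IsComp R S D := by
  have hj : j ≠ j + 1 := ne_succ_of_coeff_ne ⟨D, fun e => by
    have := congrFun (congrFun (h.symm.trans e) j) 0
    simp [colChain] at this⟩ j
  obtain ⟨R, S, h1, h2, h3, -⟩ := exists_isComp_of_rect_le (mu_of_colChain h) hj (by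
    rw [h]
    intro i k
    simp only [rect, ind_succ, colChain]
    have := ind_le_one (D.src j) (D.src (j + 1)) k
    split_ifs <;> omega) (by
    rw [← src_eq_tgt_of_colChain h]
    intro e
    have := congrArg (fun σ => σ j) e
    simp [hj.symm] at this)
  exact ⟨R, S, h1, h2, h3⟩

/-- A rectangle inside a row has height one, so its corners are the coordinates on the two sides of
the row. -/
theorem IsComp.fst_eq_of_rowChain {R S R' S' D : PosDomain G} (hR : R.mu = 1) (h : IsComp R S D)
    (hR' : R'.mu = 1) (h' : IsComp R' S' D) {j : Fin n} (hD : D.coeff = rowChain j) : R = R' := by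
  have key : ∀ {R S : PosDomain G}, R.mu = 1 → IsComp R S D →
      R.tgt = D.src * Equiv.swap (D.src.symm j) (D.src.symm (j + 1)) ∧
      R.coeff = rect D.src (D.src.symm j) (D.src.symm (j + 1)) := by
    intro R S hR h
    obtain ⟨a, b, hab, ht, hc, -⟩ := exists_rect hR
    rw [h.1] at ht hc
    have hle : ∀ i k, R.coeff i k ≤ rowChain j i k := by
      intro i k
      rw [← hD, ← h.2.2.2]
      exact Nat.le_add_right _ _
    obtain ⟨e1, e2⟩ := eq_of_ind_le_single (D.src.injective.ne hab) (j := j) (fun k hk => by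
      have := hle a k
      rw [hc, rect, ind_left, rowChain, if_neg hk] at this
      omega)
    rw [← e2, ← e1, Equiv.symm_apply_apply, Equiv.symm_apply_apply]
    exact ⟨ht, hc⟩
  obtain ⟨k1, k2⟩ := key hR h
  obtain ⟨k3, k4⟩ := key hR' h'
  exact PosDomain.ext (h.1.trans h'.1.symm) (k1.trans k3.symm) (k2.trans k4.symm)

theorem IsComp.fst_eq_of_colChain {R S R' S' D : PosDomain G} (hR : R.mu = 1) (h : IsComp R S D)
    (hR' : R'.mu = 1) (h' : IsComp R' S' D) {j : Fin n} (hD : D.coeff = colChain j) : R = R' := by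
  have key : ∀ {R S : PosDomain G}, R.mu = 1 → IsComp R S D →
      R.tgt = D.src * Equiv.swap j (j + 1) ∧ R.coeff = rect D.src j (j + 1) := by
    intro R S hR h
    obtain ⟨a, b, hab, ht, hc, -⟩ := exists_rect hR
    rw [h.1] at ht hc
    have hle : ∀ i k, R.coeff i k ≤ colChain j i k := by
      intro i k
      rw [← hD, ← h.2.2.2]
      exact Nat.le_add_right _ _
    obtain ⟨e1, e2⟩ := eq_of_ind_le_single hab (j := j) (fun k hk => by
      have := hle k (D.src a)
      rw [hc, rect, ind_left, colChain, if_neg hk] at this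
      omega)
    rw [ht, hc, e1, e2]
    exact ⟨rfl, rfl⟩
  obtain ⟨k1, k2⟩ := key hR h
  obtain ⟨k3, k4⟩ := key hR' h'
  exact PosDomain.ext (h.1.trans h'.1.symm) (k1.trans k3.symm) (k2.trans k4.symm)

theorem rowChain_ne_colChain_of {D : PosDomain G} {j i : Fin n} (hr : D.coeff = rowChain j)
    (hc : D.coeff = colChain i) : False := by
  have hi : i ≠ i + 1 := ne_succ_of_coeff_ne ⟨D, fun e => by
    have := congrFun (congrFun (hr.symm.trans e) 0) j
    simp [rowChain] at this⟩ i
  have := congrFun (congrFun (hr.symm.trans hc) (i + 1)) j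
  simp [rowChain, colChain, hi.symm] at this

end PosDomain

open PosDomain

variable {G : GridDiagram n}

theorem SignAssignment.val_of_mu (s : SignAssignment G) {R : PosDomain G} (h : R.mu = 1) :
    s.val R = s.sign ⟨R, h⟩ := dif_pos h

theorem SignAssignment.val_of_mu_ne (s : SignAssignment G) {R : PosDomain G} (h : R.mu ≠ 1) :
    s.val R = 0 := dif_neg h

theorem SignAssignment.mu_of_val_mul_ne (s : SignAssignment G) {R S : PosDomain G}
    (h : s.val R * s.val S ≠ 0) : R.mu = 1 ∧ S.mu = 1 := by
  constructor
  · by_contra h1; exact h (by rw [s.val_of_mu_ne h1, zero_mul])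
  · by_contra h1; exact h (by rw [s.val_of_mu_ne h1, mul_zero])

/-- The signed count of the decompositions of a domain into two rectangles. -/
theorem sum_val_mul_val (s : SignAssignment G) (D : PosDomain G) :
    ∑ p ∈ D.decompositions, s.val p.1 * s.val p.2
      = ∑ j, (if D.coeff = rowChain j then 1 else 0)
        - ∑ i, (if D.coeff = colChain i then 1 else 0) := by
  classical
  by_cases hrow : ∃ j, D.coeff = rowChain j
  · obtain ⟨j, hj⟩ := hrow
    obtain ⟨R, S, hR, hS, h⟩ := exists_isComp_of_rowChain hj
    rw [Finset.sum_eq_single (R, S)]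
    · rw [Finset.sum_eq_single j, Finset.sum_eq_zero, if_pos hj]
      · have := s.row ⟨R, hR⟩ ⟨S, hS⟩ D h ⟨j, hj⟩
        rw [s.val_of_mu hR, s.val_of_mu hS, ← Units.val_mul, this]
        rfl
      · intro i _
        exact if_neg fun hc => rowChain_ne_colChain_of hj hc
      · intro k _ hk
        exact if_neg fun e => hk (rowChain_injective (e.symm.trans hj))
      · simp
    · rintro ⟨R', S'⟩ hp hne
      by_contra hv
      obtain ⟨hR', hS'⟩ := s.mu_of_val_mul_ne hv
      have h' := mem_decompositions.1 hp
      obtain rfl := h'.fst_eq_of_rowChain hR' hR h hj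
      obtain rfl := h'.ext_of_fst h
      exact hne rfl
    · intro hp
      exact absurd (mem_decompositions.2 h) hp
  by_cases hcol : ∃ j, D.coeff = colChain j
  · obtain ⟨j, hj⟩ := hcol
    obtain ⟨R, S, hR, hS, h⟩ := exists_isComp_of_colChain hj
    rw [Finset.sum_eq_single (R, S)]
    · rw [Finset.sum_eq_zero, Finset.sum_eq_single j, if_pos hj]
      · have := s.col ⟨R, hR⟩ ⟨S, hS⟩ D h ⟨j, hj⟩
        rw [s.val_of_mu hR, s.val_of_mu hS, ← Units.val_mul, this]
        rfl
      · intro k _ hk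
        exact if_neg fun e => hk (colChain_injective (e.symm.trans hj))
      · simp
      · intro i _
        exact if_neg fun hc => hrow ⟨i, hc⟩
    · rintro ⟨R', S'⟩ hp hne
      by_contra hv
      obtain ⟨hR', hS'⟩ := s.mu_of_val_mul_ne hv
      have h' := mem_decompositions.1 hp
      obtain rfl := h'.fst_eq_of_colChain hR' hR h hj
      obtain rfl := h'.ext_of_fst h
      exact hne rfl
    · intro hp
      exact absurd (mem_decompositions.2 h) hp
  push Not at hrow hcol
  rw [Finset.sum_eq_zero (fun j _ => if_neg (hrow j)),
    Finset.sum_eq_zero (fun j _ => if_neg (hcol j)), sub_zero]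
  -- Any two different decompositions have opposite values. A second one always exists, and a third
  -- would force the values to vanish, so exactly two contribute and they cancel.
  by_cases hex : ∃ p ∈ D.decompositions, s.val p.1 * s.val p.2 ≠ 0
  · obtain ⟨⟨R, S⟩, hp, hv⟩ := hex
    obtain ⟨hR, hS⟩ := s.mu_of_val_mul_ne hv
    simp only at hR hS
    have h := mem_decompositions.1 hp
    obtain ⟨R', S', hR', hS', h', hne⟩ := exists_other_isComp hR hS h hrow hcol
    have hne2 : (R, S) ≠ (R', S') := fun e => hne (congrArg Prod.fst e).symm
    have opp : ∀ {R S R' S' : PosDomain G} (hR : R.mu = 1) (hS : S.mu = 1) (hR' : R'.mu = 1)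
        (hS' : S'.mu = 1), IsComp R S D → IsComp R' S' D → (R, S) ≠ (R', S') →
        s.val R * s.val S = -(s.val R' * s.val S') := by
      intro R S R' S' hR hS hR' hS' h h' hne
      have := s.anticomm ⟨R, hR⟩ ⟨S, hS⟩ ⟨R', hR'⟩ ⟨S', hS'⟩ D h h' (fun e => hne (by
        simpa using e)) hrow hcol
      rw [s.val_of_mu hR, s.val_of_mu hS, s.val_of_mu hR', s.val_of_mu hS', ← Units.val_mul, this]
      simp
    rw [← Finset.sum_subset (s₁ := {(R, S), (R', S')})]
    · rw [Finset.sum_pair hne2]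
      linarith [opp hR hS hR' hS' h h' hne2]
    · intro p hp
      simp only [Finset.mem_insert, Finset.mem_singleton] at hp
      rcases hp with rfl | rfl
      · exact mem_decompositions.2 h
      · exact mem_decompositions.2 h'
    · rintro ⟨R'', S''⟩ hp'' hnot
      by_contra hv''
      obtain ⟨hR'', hS''⟩ := s.mu_of_val_mul_ne hv''
      simp only [Finset.mem_insert, Finset.mem_singleton, not_or] at hnot
      have h'' := mem_decompositions.1 hp''
      have o1 := opp hR hS hR' hS' h h' hne2
      have o2 := opp hR'' hS'' hR hS h'' h hnot.1
      have o3 := opp hR'' hS'' hR' hS' h'' h' hnot.2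
      apply hv
      simp only
      linarith
  · push Not at hex
    exact Finset.sum_eq_zero hex

end Rectangles

/-! ### Operators on a tensor product of free groups -/

section TensorOperators

variable {A B : Type}

/-- The action of an operator on the first factor. -/
noncomputable def onLeft : Module.End ℤ (A →₀ ℤ) →+* Module.End ℤ (A × B →₀ ℤ) :=
  (LinearEquiv.conjRingEquiv (finsuppTensorFinsupp' ℤ A B)).toRingHom.comp
    (Module.End.rTensorAlgHom ℤ (A →₀ ℤ) (B →₀ ℤ)).toRingHom

/-- The action of an operator on the second factor. -/
noncomputable def onRight : Module.End ℤ (B →₀ ℤ) →+* Module.End ℤ (A × B →₀ ℤ) :=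
  (LinearEquiv.conjRingEquiv (finsuppTensorFinsupp' ℤ A B)).toRingHom.comp
    (Module.End.lTensorAlgHom ℤ (B →₀ ℤ) (A →₀ ℤ)).toRingHom

/-- The operators commute strictly, without a Koszul sign; the sign is carried by `parity` instead.
-/
theorem onLeft_onRight_comm (T : Module.End ℤ (A →₀ ℤ)) (U : Module.End ℤ (B →₀ ℤ)) :
    onRight U * onLeft T = onLeft T * onRight U := by
  have : (U.lTensor (A →₀ ℤ) : Module.End ℤ _) * T.rTensor (B →₀ ℤ)
      = (T.rTensor (B →₀ ℤ) : Module.End ℤ _) * U.lTensor (A →₀ ℤ) :=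
    (LinearMap.lTensor_comp_rTensor (A →₀ ℤ) T U).trans
      (LinearMap.rTensor_comp_lTensor (A →₀ ℤ) T U).symm
  have h2 := congrArg (LinearEquiv.conjRingEquiv (finsuppTensorFinsupp' ℤ A B)) this
  rw [map_mul, map_mul] at h2
  exact h2

theorem tensor_single_left (m : A →₀ ℤ) (b : B) :
    finsuppTensorFinsupp' ℤ A B (m ⊗ₜ[ℤ] Finsupp.single b 1)
      = Finsupp.lmapDomain ℤ ℤ (fun a => (a, b)) m := by
  induction m using Finsupp.induction_linear with
  | zero => simp
  | add f g hf hg => rw [TensorProduct.add_tmul, map_add, map_add, hf, hg]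
  | single a r => simp [finsuppTensorFinsupp'_single_tmul_single]

theorem tensor_single_right (a : A) (m : B →₀ ℤ) :
    finsuppTensorFinsupp' ℤ A B (Finsupp.single a 1 ⊗ₜ[ℤ] m)
      = Finsupp.lmapDomain ℤ ℤ (fun b => (a, b)) m := by
  induction m using Finsupp.induction_linear with
  | zero => simp
  | add f g hf hg => rw [TensorProduct.tmul_add, map_add, map_add, hf, hg]
  | single a r => simp [finsuppTensorFinsupp'_single_tmul_single]

theorem onLeft_single (T : Module.End ℤ (A →₀ ℤ)) (g : A × B) :
    onLeft T (Finsupp.single g 1)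
      = Finsupp.lmapDomain ℤ ℤ (fun a => (a, g.2)) (T (Finsupp.single g.1 1)) := by
  rw [← tensor_single_left]
  simp [onLeft, LinearEquiv.conjRingEquiv_apply_apply,
    finsuppTensorFinsupp'_symm_single_eq_single_one_tmul, Module.End.rTensorAlgHom]
  rfl

theorem onRight_single (U : Module.End ℤ (B →₀ ℤ)) (g : A × B) :
    onRight U (Finsupp.single g 1)
      = Finsupp.lmapDomain ℤ ℤ (fun b => (g.1, b)) (U (Finsupp.single g.2 1)) := by
  rw [← tensor_single_right]
  simp [onRight, LinearEquiv.conjRingEquiv_apply_apply,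
    finsuppTensorFinsupp'_symm_single_eq_single_one_tmul, Module.End.lTensorAlgHom]
  rfl

/-- Free abelian groups have no 2-torsion. This disposes of double sums that change sign when the
two indices are exchanged. -/
theorem eq_zero_of_eq_neg {T : Module.End ℤ (A →₀ ℤ)} (h : T = -T) : T = 0 := by
  refine LinearMap.ext fun m => Finsupp.ext fun a => ?_
  have := DFunLike.congr_fun (LinearMap.congr_fun h m) a
  simp only [LinearMap.neg_apply, Finsupp.neg_apply] at this
  simp only [LinearMap.zero_apply, Finsupp.zero_apply]
  omega

/-- The operator with the given values on generators. -/
noncomputable def ofBasis (f : A → (A →₀ ℤ)) : Module.End ℤ (A →₀ ℤ) :=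
  Finsupp.linearCombination ℤ f

theorem ofBasis_single (f : A → (A →₀ ℤ)) (a : A) : ofBasis f (Finsupp.single a 1) = f a := by
  simp [ofBasis]

theorem end_ext {M : Type*} [AddCommGroup M] {S T : (A →₀ ℤ) →ₗ[ℤ] M}
    (h : ∀ a, S (Finsupp.single a 1) = T (Finsupp.single a 1)) : S = T :=
  Finsupp.lhom_ext' fun a => LinearMap.ext_ring (h a)

end TensorOperators

/-! ### Removing factors from domains -/

section DomainOperators

variable {n : ℕ} [NeZero n] {G : GridDiagram n}

namespace PosDomain

/-- The composition of two positive domains. -/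
def comp (R E : PosDomain G) (h : R.tgt = E.src) : PosDomain G where
  src := R.src
  tgt := E.tgt
  coeff := R.coeff + E.coeff
  boundary := Connects.add R.connects (h ▸ E.connects)
  avoids := by simp [R.avoids, E.avoids]

theorem isComp_comp (R E : PosDomain G) (h : R.tgt = E.src) : IsComp R E (R.comp E h) :=
  ⟨rfl, h, rfl, rfl⟩

/-- Both sides run over the factorizations of `D` into three domains. -/
theorem sum_decompositions_assoc {M : Type*} [AddCommMonoid M] (D : PosDomain G)
    (F : PosDomain G → PosDomain G → PosDomain G → M) :
    ∑ p ∈ D.decompositions, ∑ q ∈ p.2.decompositions, F p.1 q.1 q.2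
      = ∑ p ∈ D.decompositions, ∑ q ∈ p.1.decompositions, F q.1 q.2 p.2 := by
  rw [Finset.sum_sigma', Finset.sum_sigma']
  have mem1 : ∀ {a : (_ : PosDomain G × PosDomain G) × (PosDomain G × PosDomain G)},
      a ∈ D.decompositions.sigma (fun p => p.2.decompositions) →
        IsComp a.1.1 a.1.2 D ∧ IsComp a.2.1 a.2.2 a.1.2 := by
    intro a ha
    rw [Finset.mem_sigma, mem_decompositions, mem_decompositions] at ha
    exact ha
  have mem2 : ∀ {a : (_ : PosDomain G × PosDomain G) × (PosDomain G × PosDomain G)},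
      a ∈ D.decompositions.sigma (fun p => p.1.decompositions) →
        IsComp a.1.1 a.1.2 D ∧ IsComp a.2.1 a.2.2 a.1.1 := by
    intro a ha
    rw [Finset.mem_sigma, mem_decompositions, mem_decompositions] at ha
    exact ha
  refine Finset.sum_bij'
    (fun a ha => ⟨(a.1.1.comp a.2.1 ((mem1 ha).1.2.1.trans (mem1 ha).2.1.symm), a.2.2),
      (a.1.1, a.2.1)⟩)
    (fun a ha => ⟨(a.2.1, a.2.2.comp a.1.2 ((mem2 ha).2.2.2.1.trans (mem2 ha).1.2.1)),
      (a.2.2, a.1.2)⟩) ?_ ?_ ?_ ?_ ?_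
  · intro a ha
    obtain ⟨h1, h2⟩ := mem1 ha
    rw [Finset.mem_sigma, mem_decompositions, mem_decompositions]
    refine ⟨⟨h1.1, h2.2.1, h2.2.2.1.trans h1.2.2.1, ?_⟩,
      isComp_comp a.1.1 a.2.1 (h1.2.1.trans h2.1.symm)⟩
    simp only [comp]
    rw [add_assoc, h2.2.2.2, h1.2.2.2]
  · intro a ha
    obtain ⟨h1, h2⟩ := mem2 ha
    rw [Finset.mem_sigma, mem_decompositions, mem_decompositions]
    refine ⟨⟨h2.1.trans h1.1, h2.2.1, h1.2.2.1, ?_⟩,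
      isComp_comp a.2.2 a.1.2 (h2.2.2.1.trans h1.2.1)⟩
    simp only [comp]
    rw [← add_assoc, h2.2.2.2, h1.2.2.2]
  · rintro ⟨⟨R, E⟩, ⟨S, E'⟩⟩ ha
    obtain ⟨h1, h2⟩ := mem1 ha
    have : S.comp E' h2.2.1 = E := PosDomain.ext h2.1 h2.2.2.1 h2.2.2.2
    simp only [this]
  · rintro ⟨⟨R, E⟩, ⟨S, E'⟩⟩ ha
    obtain ⟨h1, h2⟩ := mem2 ha
    have : S.comp E' h2.2.1 = R := PosDomain.ext h2.1 h2.2.2.1 h2.2.2.2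
    simp only [this]
  · intro a ha
    rfl

end PosDomain

open PosDomain

/-- Take out an initial factor, with weight `φ`. -/
noncomputable def front (φ : PosDomain G → ℤ) : Module.End ℤ (PosDomain G →₀ ℤ) :=
  ofBasis fun D => ∑ p ∈ D.decompositions, φ p.1 • Finsupp.single p.2 1

/-- Take out a final factor, with weight `φ`. -/
noncomputable def rear (φ : PosDomain G → ℤ) : Module.End ℤ (PosDomain G →₀ ℤ) :=
  ofBasis fun D => ∑ p ∈ D.decompositions, φ p.2 • Finsupp.single p.1 1

/-- The convolution product of two weights. -/
noncomputable def conv (φ ψ : PosDomain G → ℤ) (D : PosDomain G) : ℤ :=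
  ∑ p ∈ D.decompositions, φ p.1 * ψ p.2

/-- The operator applied first removes the first factor, so the weights appear in reverse order. -/
theorem front_mul_front (φ ψ : PosDomain G → ℤ) : front φ * front ψ = front (conv ψ φ) := by
  refine end_ext fun D => ?_
  simp only [Module.End.mul_apply, front, ofBasis_single, map_sum, map_smul, conv,
    Finset.smul_sum, Finset.sum_smul]
  rw [sum_decompositions_assoc D (fun R S E => ψ R • φ S • Finsupp.single E (1 : ℤ))]
  simp only [mul_smul]

theorem rear_mul_rear (φ ψ : PosDomain G → ℤ) : rear φ * rear ψ = rear (conv φ ψ) := by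
  refine end_ext fun D => ?_
  simp only [Module.End.mul_apply, rear, ofBasis_single, map_sum, map_smul, conv,
    Finset.smul_sum, Finset.sum_smul]
  rw [← sum_decompositions_assoc D (fun E S R => ψ R • φ S • Finsupp.single E (1 : ℤ))]
  simp only [← mul_smul, mul_comm]

theorem front_mul_rear (φ ψ : PosDomain G → ℤ) : front φ * rear ψ = rear ψ * front φ := by
  refine end_ext fun D => ?_
  simp only [Module.End.mul_apply, rear, front, ofBasis_single, map_sum, map_smul,
    Finset.smul_sum]
  rw [sum_decompositions_assoc D (fun S E R => φ S • ψ R • Finsupp.single E (1 : ℤ))]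
  simp only [← mul_smul, mul_comm]

open Classical in
/-- The indicator weight of the domains with underlying chain `c`. -/
noncomputable def chainWeight (c : Chain n) (D : PosDomain G) : ℤ := if D.coeff = c then 1 else 0

/-- Take out a periodic chain `c`. -/
noncomputable def takeOut (c : Chain n) : Module.End ℤ (PosDomain G →₀ ℤ) :=
  ofBasis fun D => ∑ E ∈ D.remove c, Finsupp.single E 1

/-- A chain without `α`-boundary points. -/
def IsPeriodic (c : Chain n) : Prop := ∀ i j, alphaBoundary c i j = 0

theorem isPeriodic_rowChain (j : Fin n) : IsPeriodic (rowChain j) := by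
  intro i k; simp [alphaBoundary, rowChain]

theorem isPeriodic_colChain (j : Fin n) : IsPeriodic (colChain j) := by
  intro i k; simp [alphaBoundary, colChain]

theorem mem_remove {D E : PosDomain G} {c : Chain n} :
    E ∈ D.remove c ↔ E.src = D.src ∧ E.tgt = D.tgt ∧ E.coeff + c = D.coeff := by
  simp [remove]

/-- A periodic domain has equal ends, so taking it out changes neither generator. Together with
`rear_chainWeight` this identifies removal at the front with removal at the rear, and all
commutation rules for annuli then follow from `front_mul_rear`. -/
theorem front_chainWeight {c : Chain n} (hc : IsPeriodic c) :
    front (chainWeight c) = (takeOut c : Module.End ℤ (PosDomain G →₀ ℤ)) := by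
  classical
  refine end_ext fun D => ?_
  simp only [front, takeOut, ofBasis_single, chainWeight, ite_smul, one_smul, zero_smul]
  rw [← Finset.sum_filter]
  refine Finset.sum_bij (fun p _ => p.2) ?_ ?_ ?_ (fun _ _ => rfl)
  · rintro ⟨R, E⟩ hp
    rw [Finset.mem_filter, mem_decompositions] at hp
    obtain ⟨⟨h1, h2, h3, h4⟩, hR⟩ := hp
    simp only at *
    have hs : R.src = R.tgt := eq_of_connects R.connects (hR ▸ hc)
    rw [mem_remove]
    refine ⟨by rw [← h2, ← hs, h1], h3, by rw [← h4, ← hR, add_comm]⟩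
  · rintro ⟨R, E⟩ hp ⟨R', E'⟩ hp' h
    rw [Finset.mem_filter, mem_decompositions] at hp hp'
    simp only at *
    subst h
    have : R = R' := PosDomain.ext (hp.1.1.trans hp'.1.1.symm) (hp.1.2.1.trans hp'.1.2.1.symm)
      (hp.2.trans hp'.2.symm)
    rw [this]
  · intro E hE
    rw [mem_remove] at hE
    obtain ⟨h1, h2, h3⟩ := hE
    have hz : c (G.xCol (last n)) (G.xRow (last n)) = 0 := by
      have := congrFun (congrFun h3 (G.xCol (last n))) (G.xRow (last n))
      rw [D.avoids] at this
      exact (Nat.add_eq_zero_iff.1 this).2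
    refine ⟨(⟨D.src, D.src, c, fun i j => by rw [hc]; ring, hz⟩, E), ?_, rfl⟩
    rw [Finset.mem_filter, mem_decompositions]
    exact ⟨⟨rfl, h1.symm, h2, by rw [← h3, add_comm]⟩, rfl⟩

theorem rear_chainWeight {c : Chain n} (hc : IsPeriodic c) :
    rear (chainWeight c) = (takeOut c : Module.End ℤ (PosDomain G →₀ ℤ)) := by
  classical
  refine end_ext fun D => ?_
  simp only [rear, takeOut, ofBasis_single, chainWeight, ite_smul, one_smul, zero_smul]
  rw [← Finset.sum_filter]
  refine Finset.sum_bij (fun p _ => p.1) ?_ ?_ ?_ (fun _ _ => rfl)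
  · rintro ⟨E, R⟩ hp
    rw [Finset.mem_filter, mem_decompositions] at hp
    obtain ⟨⟨h1, h2, h3, h4⟩, hR⟩ := hp
    simp only at *
    have hs : R.src = R.tgt := eq_of_connects R.connects (hR ▸ hc)
    rw [mem_remove]
    refine ⟨h1, by rw [h2, hs, h3], by rw [← h4, ← hR]⟩
  · rintro ⟨E, R⟩ hp ⟨E', R'⟩ hp' h
    rw [Finset.mem_filter, mem_decompositions] at hp hp'
    simp only at *
    subst h
    have : R = R' := PosDomain.ext (hp.1.2.1.symm.trans hp'.1.2.1)
      (hp.1.2.2.1.trans hp'.1.2.2.1.symm) (hp.2.trans hp'.2.symm)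
    rw [this]
  · intro E hE
    rw [mem_remove] at hE
    obtain ⟨h1, h2, h3⟩ := hE
    have hz : c (G.xCol (last n)) (G.xRow (last n)) = 0 := by
      have := congrFun (congrFun h3 (G.xCol (last n))) (G.xRow (last n))
      rw [D.avoids] at this
      exact (Nat.add_eq_zero_iff.1 this).2
    refine ⟨(E, ⟨D.tgt, D.tgt, c, fun i j => by rw [hc]; ring, hz⟩), ?_, rfl⟩
    rw [Finset.mem_filter, mem_decompositions]
    exact ⟨⟨h1, h2, rfl, h3⟩, rfl⟩

theorem front_mul_takeOut (φ : PosDomain G → ℤ) {c : Chain n} (hc : IsPeriodic c) :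
    front φ * takeOut c = takeOut c * front φ := by
  rw [← rear_chainWeight hc, front_mul_rear]

theorem rear_mul_takeOut (φ : PosDomain G → ℤ) {c : Chain n} (hc : IsPeriodic c) :
    rear φ * takeOut c = takeOut c * rear φ := by
  rw [← front_chainWeight hc, front_mul_rear]

theorem takeOut_mul_takeOut {c d : Chain n} (hc : IsPeriodic c) (hd : IsPeriodic d) :
    takeOut c * takeOut d = (takeOut d * takeOut c : Module.End ℤ (PosDomain G →₀ ℤ)) := by
  rw [← front_chainWeight hc, front_mul_takeOut _ hd]

theorem front_linear (φ : Fin n → PosDomain G → ℤ) (ψ : Fin n → PosDomain G → ℤ) :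
    front (fun D => ∑ j, φ j D - ∑ j, ψ j D) = ∑ j, front (φ j) - ∑ j, front (ψ j) := by
  refine end_ext fun D => ?_
  simp only [front, ofBasis_single, LinearMap.sub_apply, LinearMap.sum_apply, sub_smul,
    Finset.sum_smul, Finset.sum_sub_distrib]
  rw [Finset.sum_comm, Finset.sum_comm (s := D.decompositions)]

theorem rear_linear (φ : Fin n → PosDomain G → ℤ) (ψ : Fin n → PosDomain G → ℤ) :
    rear (fun D => ∑ j, φ j D - ∑ j, ψ j D) = ∑ j, rear (φ j) - ∑ j, rear (ψ j) := by
  refine end_ext fun D => ?_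
  simp only [rear, ofBasis_single, LinearMap.sub_apply, LinearMap.sum_apply, sub_smul,
    Finset.sum_smul, Finset.sum_sub_distrib]
  rw [Finset.sum_comm, Finset.sum_comm (s := D.decompositions)]

theorem conv_val (s : SignAssignment G) : conv s.val s.val
    = fun D => ∑ j, chainWeight (rowChain j) D - ∑ i, chainWeight (colChain i) D := by
  classical
  funext D
  rw [conv, sum_val_mul_val]
  simp only [chainWeight]

theorem front_val_sq (s : SignAssignment G) : front s.val * front s.val
    = ∑ j, takeOut (rowChain j) - ∑ i, takeOut (colChain i) := by
  rw [front_mul_front, conv_val, front_linear]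
  simp only [front_chainWeight (isPeriodic_rowChain _), front_chainWeight (isPeriodic_colChain _)]

theorem rear_val_sq (s : SignAssignment G) : rear s.val * rear s.val
    = ∑ j, takeOut (rowChain j) - ∑ i, takeOut (colChain i) := by
  rw [rear_mul_rear, conv_val, rear_linear]
  simp only [rear_chainWeight (isPeriodic_rowChain _), rear_chainWeight (isPeriodic_colChain _)]

/-- The sign `(-1)^μ`. -/
noncomputable def parity : Module.End ℤ (PosDomain G →₀ ℤ) :=
  ofBasis fun D => (-1 : ℤ) ^ D.mu • Finsupp.single D 1

theorem parity_sq : (parity * parity : Module.End ℤ (PosDomain G →₀ ℤ)) = 1 := by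
  refine end_ext fun D => ?_
  simp only [Module.End.mul_apply, parity, ofBasis_single, map_smul, smul_smul, ← mul_pow]
  simp

theorem parity_mul_front (s : SignAssignment G) :
    parity * front s.val = -(front s.val * parity) := by
  refine end_ext fun D => ?_
  simp only [Module.End.mul_apply, LinearMap.neg_apply, parity, front, ofBasis_single, map_smul,
    map_sum, Finset.smul_sum, ← Finset.sum_neg_distrib]
  refine Finset.sum_congr rfl fun p hp => ?_
  by_cases h : p.1.mu = 1
  · have := (mem_decompositions.1 hp).mu_add
    rw [← this, h, smul_smul, smul_smul, ← neg_smul, pow_add]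
    congr 1; ring
  · simp [s.val_of_mu_ne h]

theorem parity_mul_rear (s : SignAssignment G) :
    parity * rear s.val = -(rear s.val * parity) := by
  refine end_ext fun D => ?_
  simp only [Module.End.mul_apply, LinearMap.neg_apply, parity, rear, ofBasis_single, map_smul,
    map_sum, Finset.smul_sum, ← Finset.sum_neg_distrib]
  refine Finset.sum_congr rfl fun p hp => ?_
  by_cases h : p.2.mu = 1
  · have := (mem_decompositions.1 hp).mu_add
    rw [← this, h, smul_smul, smul_smul, ← neg_smul, pow_add]
    congr 1; ring
  · simp [s.val_of_mu_ne h]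

theorem mu_of_mem_remove {D E : PosDomain G} {c : Chain n}
    (hc : (∃ j, c = rowChain j) ∨ ∃ i, c = colChain i) (hE : E ∈ D.remove c) :
    D.mu = E.mu + 2 := by
  have hp : IsPeriodic c := by
    rcases hc with ⟨j, rfl⟩ | ⟨i, rfl⟩
    · exact isPeriodic_rowChain j
    · exact isPeriodic_colChain i
  rw [mem_remove] at hE
  obtain ⟨h1, h2, h3⟩ := hE
  have hz : c (G.xCol (last n)) (G.xRow (last n)) = 0 := by
    have := congrFun (congrFun h3 (G.xCol (last n))) (G.xRow (last n))
    rw [D.avoids] at this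
    exact (Nat.add_eq_zero_iff.1 this).2
  let Z : PosDomain G := ⟨D.tgt, D.tgt, c, fun i j => by rw [hp]; ring, hz⟩
  have hZ : Z.mu = 2 := by
    rcases hc with ⟨j, hj⟩ | ⟨i, hi⟩
    · exact mu_of_rowChain (D := Z) hj
    · exact mu_of_colChain (D := Z) hi
  have : IsComp E Z D := ⟨h1, h2, rfl, h3⟩
  rw [← this.mu_add, hZ]

theorem parity_mul_takeOut {c : Chain n} (hc : (∃ j, c = rowChain j) ∨ ∃ i, c = colChain i) :
    parity * takeOut c = (takeOut c * parity : Module.End ℤ (PosDomain G →₀ ℤ)) := by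
  refine end_ext fun D => ?_
  simp only [Module.End.mul_apply, parity, takeOut, ofBasis_single, map_smul,
    map_sum, Finset.smul_sum]
  refine Finset.sum_congr rfl fun E hE => ?_
  rw [mu_of_mem_remove hc hE, pow_add]
  simp

/-- The part of the differential that takes out a rectangle. -/
noncomputable def rectPart (s : SignAssignment G) : Module.End ℤ (PosDomain G →₀ ℤ) :=
  front s.val + rear s.val * parity

/-- Moving `parity` past a rectangle costs a sign. This cancels the mixed terms and leaves the
square of front removal minus the square of rear removal; both are rows minus columns. -/
theorem rectPart_sq (s : SignAssignment G) : rectPart s * rectPart s = 0 := by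
  have e1 := front_val_sq s
  have e2 := rear_val_sq s
  have e3 := parity_mul_front s
  have e4 := parity_mul_rear s
  have e5 := front_mul_rear s.val s.val
  have e6 := parity_sq (G := G)
  have k1 : rear s.val * parity * front s.val = -(front s.val * (rear s.val * parity)) := by
    rw [mul_assoc, e3, mul_neg, ← mul_assoc, ← e5, mul_assoc]
  have k2 : rear s.val * parity * (rear s.val * parity) = -(rear s.val * rear s.val) := by
    rw [mul_assoc, ← mul_assoc parity, e4, neg_mul, mul_assoc (rear s.val), e6, mul_one, mul_neg]
  rw [rectPart, add_mul, mul_add, mul_add, k1, k2, e1, e2]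
  abel

theorem parity_mul_rectPart (s : SignAssignment G) :
    parity * rectPart s = -(rectPart s * parity) := by
  rw [rectPart, mul_add, add_mul, ← mul_assoc, parity_mul_front, parity_mul_rear, neg_mul, neg_add]

theorem rectPart_mul_takeOut (s : SignAssignment G) {c : Chain n}
    (hc : (∃ j, c = rowChain j) ∨ ∃ i, c = colChain i) :
    rectPart s * takeOut c = takeOut c * rectPart s := by
  have hp : IsPeriodic c := by
    rcases hc with ⟨j, rfl⟩ | ⟨i, rfl⟩
    · exact isPeriodic_rowChain j
    · exact isPeriodic_colChain i
  rw [rectPart, add_mul, mul_add, front_mul_takeOut _ hp, mul_assoc, parity_mul_takeOut hc,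
    ← mul_assoc, rear_mul_takeOut _ hp, mul_assoc]

variable (G) in
/-- Take out the row or the column through the marking `O_j`. -/
noncomputable def annulusPart (j : Fin n) : Module.End ℤ (PosDomain G →₀ ℤ) :=
  takeOut (rowChain (G.oRow j)) + takeOut (colChain (G.oCol j))

theorem annulusPart_comm (j k : Fin n) :
    annulusPart G j * annulusPart G k = annulusPart G k * annulusPart G j := by
  have r := fun j : Fin n => isPeriodic_rowChain j
  have c := fun j : Fin n => isPeriodic_colChain j
  simp only [annulusPart, add_mul, mul_add]
  rw [takeOut_mul_takeOut (r (G.oRow j)) (r (G.oRow k)),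
    takeOut_mul_takeOut (r (G.oRow j)) (c (G.oCol k)),
    takeOut_mul_takeOut (c (G.oCol j)) (r (G.oRow k)),
    takeOut_mul_takeOut (c (G.oCol j)) (c (G.oCol k))]
  abel

theorem rectPart_mul_annulusPart (s : SignAssignment G) (j : Fin n) :
    rectPart s * annulusPart G j = annulusPart G j * rectPart s := by
  rw [annulusPart, mul_add, add_mul, rectPart_mul_takeOut s (Or.inl ⟨_, rfl⟩),
    rectPart_mul_takeOut s (Or.inr ⟨_, rfl⟩)]

theorem parity_mul_annulusPart (j : Fin n) :
    parity * annulusPart G j = annulusPart G j * parity := by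
  rw [annulusPart, mul_add, add_mul, parity_mul_takeOut (Or.inl ⟨_, rfl⟩),
    parity_mul_takeOut (Or.inr ⟨_, rfl⟩)]

end DomainOperators

/-! ### Ordered partitions and the bar complex of the natural numbers -/

section ListOperators

/-- Prepend a part. -/
noncomputable def consOp (a : ℕ+) : Module.End ℤ (OrdPart →₀ ℤ) :=
  ofBasis fun l => Finsupp.single (a :: l) 1

/-- Add to the first part, if there is one. -/
noncomputable def bumpOp (a : ℕ+) : Module.End ℤ (OrdPart →₀ ℤ) :=
  ofBasis fun l => match l with
    -- A part added to the end of the list disappears. With this value, merging the last part with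
    -- the end is its removal, so `mergeOp` includes that term.
    | [] => Finsupp.single [] 1
    | b :: l => Finsupp.single ((a + b) :: l) 1

/-- Remove the first part, if there is one. -/
noncomputable def tailOp : Module.End ℤ (OrdPart →₀ ℤ) :=
  ofBasis fun l => match l with
    | [] => 0
    | _ :: l => Finsupp.single l 1

/-- The alternating sum of all unit enlargements. -/
noncomputable def unitAux : OrdPart → (OrdPart →₀ ℤ)
  | [] => Finsupp.single [1] 1
  | a :: l => Finsupp.single (1 :: a :: l) 1 - consOp a (unitAux l)

/-- The alternating sum of all coarsenings and the removal of the last part. -/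
noncomputable def mergeAux : OrdPart → (OrdPart →₀ ℤ)
  | [] => 0
  | a :: l => -bumpOp a (Finsupp.single l 1) - consOp a (mergeAux l)

noncomputable def unitOp : Module.End ℤ (OrdPart →₀ ℤ) := ofBasis unitAux

noncomputable def mergeOp : Module.End ℤ (OrdPart →₀ ℤ) := ofBasis mergeAux

theorem consOp_single (a : ℕ+) (l : OrdPart) :
    consOp a (Finsupp.single l 1) = Finsupp.single (a :: l) 1 := ofBasis_single _ _

theorem bumpOp_single_cons (a b : ℕ+) (l : OrdPart) :
    bumpOp a (Finsupp.single (b :: l) 1) = Finsupp.single ((a + b) :: l) 1 := ofBasis_single _ _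

theorem bumpOp_single_nil (a : ℕ+) :
    bumpOp a (Finsupp.single [] 1) = Finsupp.single [] 1 := ofBasis_single _ _

theorem tailOp_single_cons (a : ℕ+) (l : OrdPart) :
    tailOp (Finsupp.single (a :: l) 1) = Finsupp.single l 1 := ofBasis_single _ _

theorem tailOp_single_nil : tailOp (Finsupp.single [] 1) = 0 := ofBasis_single _ _

theorem unitOp_single (l : OrdPart) : unitOp (Finsupp.single l 1) = unitAux l := ofBasis_single _ _

theorem mergeOp_single (l : OrdPart) : mergeOp (Finsupp.single l 1) = mergeAux l :=
  ofBasis_single _ _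

theorem unitOp_mul_consOp (a : ℕ+) : unitOp * consOp a = consOp 1 * consOp a - consOp a * unitOp := by
  refine end_ext fun l => ?_
  simp only [Module.End.mul_apply, LinearMap.sub_apply, consOp_single, unitOp_single, unitAux]

theorem mergeOp_mul_consOp (a : ℕ+) : mergeOp * consOp a = -bumpOp a - consOp a * mergeOp := by
  refine end_ext fun l => ?_
  simp only [Module.End.mul_apply, LinearMap.sub_apply, LinearMap.neg_apply, consOp_single,
    mergeOp_single, mergeAux]

theorem tailOp_mul_consOp (a : ℕ+) : tailOp * consOp a = 1 := by
  refine end_ext fun l => ?_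
  simp only [Module.End.mul_apply, consOp_single, tailOp_single_cons, Module.End.one_apply]

theorem bumpOp_mul_consOp (a b : ℕ+) : bumpOp a * consOp b = consOp (a + b) := by
  refine end_ext fun l => ?_
  simp only [Module.End.mul_apply, consOp_single, bumpOp_single_cons]

/-- Operators on lists agree if they agree on the empty list and if agreement propagates under
prepending a part. -/
theorem listOp_ext {S T : Module.End ℤ (OrdPart →₀ ℤ)}
    (h0 : S (Finsupp.single [] 1) = T (Finsupp.single [] 1))
    (hc : ∀ a l, S (Finsupp.single l 1) = T (Finsupp.single l 1) →
      (S * consOp a) (Finsupp.single l 1) = (T * consOp a) (Finsupp.single l 1)) : S = T := by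
  refine end_ext fun l => ?_
  induction l with
  | nil => exact h0
  | cons a l ih => simpa [consOp_single] using hc a l ih

/-- `unitOp` is the signed shuffle product with the odd element `[1]`, whose square is zero.
Concretely, the square commutes with prepending a part. -/
theorem unitOp_sq : unitOp * unitOp = 0 := by
  refine listOp_ext ?_ fun a l ih => ?_
  · simp only [Module.End.mul_apply, unitOp_single, unitAux, consOp_single, sub_self,
      LinearMap.zero_apply]
  · have : unitOp * unitOp * consOp a = consOp a * (unitOp * unitOp) := by
      rw [mul_assoc, unitOp_mul_consOp, mul_sub, ← mul_assoc, ← mul_assoc, unitOp_mul_consOp,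
        unitOp_mul_consOp, sub_mul, sub_mul, mul_assoc (consOp 1) unitOp, unitOp_mul_consOp]
      noncomm_ring
    rw [this, Module.End.mul_apply, ih]
    simp

theorem bumpOp_mul_bumpOp (a b : ℕ+) : bumpOp a * bumpOp b = bumpOp (a + b) := by
  refine listOp_ext ?_ fun c l _ => ?_
  · simp only [Module.End.mul_apply, bumpOp_single_nil]
  · rw [mul_assoc, bumpOp_mul_consOp, bumpOp_mul_consOp, bumpOp_mul_consOp, add_assoc]

theorem mergeOp_mul_bumpOp (a : ℕ+) : mergeOp * bumpOp a = bumpOp a * mergeOp := by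
  refine listOp_ext ?_ fun b l _ => ?_
  · simp only [Module.End.mul_apply, bumpOp_single_nil, mergeOp_single, mergeAux, map_zero]
  · rw [mul_assoc, bumpOp_mul_consOp, mergeOp_mul_consOp, mul_assoc, mergeOp_mul_consOp,
      mul_sub, mul_neg, bumpOp_mul_bumpOp, ← mul_assoc, bumpOp_mul_consOp]

theorem mergeOp_sq : mergeOp * mergeOp = 0 := by
  refine listOp_ext ?_ fun a l ih => ?_
  · simp only [Module.End.mul_apply, mergeOp_single, mergeAux, map_zero, LinearMap.zero_apply]
  · have : mergeOp * mergeOp * consOp a = consOp a * (mergeOp * mergeOp) := by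
      rw [mul_assoc, mergeOp_mul_consOp, mul_sub, mul_neg, mergeOp_mul_bumpOp, ← mul_assoc,
        mergeOp_mul_consOp]
      noncomm_ring
    rw [this, Module.End.mul_apply, ih]
    simp

/-- Removing the result of merging the first two parts amounts to removing both; the other merges
anticommute with removal of the first part. -/
theorem tail_merge_relation : tailOp * tailOp + tailOp * mergeOp + mergeOp * tailOp = 0 := by
  refine end_ext fun l => ?_
  match l with
  | [] =>
    simp [tailOp_single_nil, mergeOp_single, mergeAux]
  | [a] =>
    simp [tailOp_single_nil, tailOp_single_cons, mergeOp_single, mergeAux, bumpOp_single_nil]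
  | a :: b :: l =>
    have h : tailOp (consOp a (mergeAux (b :: l))) = mergeAux (b :: l) :=
      LinearMap.congr_fun (tailOp_mul_consOp a) _
    simp only [LinearMap.add_apply, Module.End.mul_apply, tailOp_single_cons, mergeOp_single,
      LinearMap.zero_apply]
    rw [mergeAux, map_sub, map_neg, bumpOp_single_cons, tailOp_single_cons, h]
    abel

/-- Only the part inserted in front and removed again survives. -/
theorem tail_unit_relation : tailOp * unitOp + unitOp * tailOp = 1 := by
  refine end_ext fun l => ?_
  match l with
  | [] =>
    simp [tailOp_single_nil, tailOp_single_cons, unitOp_single, unitAux]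
  | a :: l =>
    have h : tailOp (consOp a (unitAux l)) = unitAux l :=
      LinearMap.congr_fun (tailOp_mul_consOp a) _
    simp only [LinearMap.add_apply, Module.End.mul_apply, tailOp_single_cons, unitOp_single,
      Module.End.one_apply]
    rw [unitAux, map_sub, tailOp_single_cons, h]
    abel

/-- Only the insertion in front of the first part fails to commute with changing that part. -/
theorem bump_unit_relation (a : ℕ+) :
    bumpOp a * unitOp - unitOp * bumpOp a = bumpOp 1 * consOp a - consOp 1 * bumpOp a := by
  refine listOp_ext ?_ fun b l _ => ?_
  · simp [unitOp_single, unitAux, bumpOp_single_nil, bumpOp_single_cons, consOp_single, add_comm]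
  · have : (bumpOp a * unitOp - unitOp * bumpOp a) * consOp b
        = (bumpOp 1 * consOp a - consOp 1 * bumpOp a) * consOp b := by
      rw [sub_mul, sub_mul, mul_assoc, unitOp_mul_consOp, mul_sub, ← mul_assoc, ← mul_assoc,
        bumpOp_mul_consOp, bumpOp_mul_consOp, mul_assoc unitOp, bumpOp_mul_consOp,
        unitOp_mul_consOp, bumpOp_mul_consOp, mul_assoc (consOp 1), bumpOp_mul_consOp,
        add_comm a 1]
      abel
    rw [this]

/-- Merging an inserted part into a neighbour cancels against inserting it on the other side of that
neighbour. What survives is the part inserted at the end and removed there, with sign `-1`; it will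
cancel the `1` of `tail_unit_relation`. -/
theorem merge_unit_relation : mergeOp * unitOp + unitOp * mergeOp = -1 := by
  refine listOp_ext ?_ fun a l ih => ?_
  · simp [unitOp_single, unitAux, mergeOp_single, mergeAux, bumpOp_single_nil]
  · have : (mergeOp * unitOp + unitOp * mergeOp) * consOp a
        = consOp a * (mergeOp * unitOp + unitOp * mergeOp)
          + ((bumpOp a * unitOp - unitOp * bumpOp a) - (bumpOp 1 * consOp a - consOp 1 * bumpOp a))
          := by
      rw [add_mul, mul_assoc, unitOp_mul_consOp, mul_assoc, mergeOp_mul_consOp, mul_sub, mul_sub,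
        ← mul_assoc, ← mul_assoc, ← mul_assoc, unitOp_mul_consOp, mergeOp_mul_consOp,
        mergeOp_mul_consOp, sub_mul, mul_assoc (consOp 1) mergeOp, mergeOp_mul_consOp]
      noncomm_ring
    rw [this, bump_unit_relation, sub_self, add_zero, Module.End.mul_apply, ih]
    simp

/-- The differential of the bar complex of the monoid of natural numbers. -/
noncomputable def barOp : Module.End ℤ (OrdPart →₀ ℤ) := tailOp + mergeOp

theorem barOp_sq : barOp * barOp = 0 := by
  have h1 := tail_merge_relation
  have h2 := mergeOp_sq
  have : barOp * barOp = (tailOp * tailOp + tailOp * mergeOp + mergeOp * tailOp)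
      + mergeOp * mergeOp := by
    rw [barOp]; noncomm_ring
  rw [this, h1, h2, add_zero]

theorem barOp_unitOp : barOp * unitOp = -(unitOp * barOp) := by
  have h1 := tail_unit_relation
  have h2 := merge_unit_relation
  rw [eq_neg_iff_add_eq_zero]
  have : barOp * unitOp + unitOp * barOp = (tailOp * unitOp + unitOp * tailOp)
      + (mergeOp * unitOp + unitOp * mergeOp) := by
    rw [barOp]; noncomm_ring
  rw [this, h1, h2]
  abel

theorem unitAux_eq (l : OrdPart) : unitAux l
    = ∑ k ∈ range (l.length + 1), (-1 : ℤ) ^ k • Finsupp.single (unitEnlarge l k) (1 : ℤ) := by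
  induction l with
  | nil => simp [unitAux, unitEnlarge]
  | cons a l ih =>
    rw [unitAux, ih, List.length_cons, Finset.sum_range_succ' _ (l.length + 1), map_sum, sub_eq_add_neg, add_comm,
      ← Finset.sum_neg_distrib]
    congr 1
    · refine Finset.sum_congr rfl fun k _ => ?_
      rw [map_smul, consOp_single, pow_succ]
      simp [unitEnlarge]
    · simp [unitEnlarge]

theorem barOp_single (l : OrdPart) : barOp (Finsupp.single l 1)
    = ∑ k ∈ range (l.length - 1), (-1 : ℤ) ^ (k + 1) • Finsupp.single (coarsen l k) (1 : ℤ)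
      + if l = [] then 0 else Finsupp.single l.tail 1
        + (-1 : ℤ) ^ l.length • Finsupp.single l.dropLast 1 := by
  have key : ∀ l : OrdPart, mergeAux l
      = ∑ k ∈ range (l.length - 1), (-1 : ℤ) ^ (k + 1) • Finsupp.single (coarsen l k) (1 : ℤ)
        + if l = [] then 0 else (-1 : ℤ) ^ l.length • Finsupp.single l.dropLast 1 := by
    intro l
    induction l with
    | nil => simp [mergeAux]
    | cons a l ih =>
      cases l with
      | nil => simp [mergeAux, bumpOp_single_nil]
      | cons b l =>
        rw [mergeAux, ih, bumpOp_single_cons]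
        simp only [List.length_cons, Nat.add_sub_cancel, map_add, map_sum, map_smul, consOp_single,
          reduceCtorEq, if_false, List.dropLast_cons_cons]
        rw [Finset.sum_range_succ']
        simp only [coarsen, pow_succ, mul_neg, mul_one, neg_smul, Finset.sum_neg_distrib, neg_neg]
        simp
        abel
  cases l with
  | nil => simp [barOp, tailOp_single_nil, mergeOp_single, mergeAux]
  | cons a l =>
    rw [barOp, LinearMap.add_apply, tailOp_single_cons, mergeOp_single, key]
    simp only [reduceCtorEq, if_false, List.tail_cons]
    abel

/-- The operator changes the parity of the length. -/
def IsOddOp (f : Module.End ℤ (OrdPart →₀ ℤ)) : Prop :=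
  ∀ l, ∀ l' ∈ (f (Finsupp.single l 1)).support, (-1 : ℤ) ^ l'.length = -(-1) ^ l.length

theorem length_unitEnlarge (l : OrdPart) (k : ℕ) : (unitEnlarge l k).length = l.length + 1 := by
  simp only [unitEnlarge, List.length_append, List.length_cons, List.length_take, List.length_drop]
  omega

theorem length_coarsen (l : OrdPart) (k : ℕ) (h : k + 1 < l.length) :
    (coarsen l k).length + 1 = l.length := by
  induction l generalizing k with
  | nil => simp at h
  | cons a l ih =>
    cases k with
    | zero =>
      cases l with
      | nil => simp at h
      | cons b l => simp [coarsen]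
    | succ k =>
      have : coarsen (a :: l) (k + 1) = a :: coarsen l k := by
        cases l <;> simp [coarsen]
      rw [this]
      simp only [List.length_cons] at h ⊢
      rw [ih k (by omega)]

theorem unitOp_mem (l : OrdPart) : unitOp (Finsupp.single l 1)
    ∈ Finsupp.supported ℤ ℤ {l' : OrdPart | l'.length = l.length + 1} := by
  rw [unitOp_single, unitAux_eq]
  exact Submodule.sum_mem _ fun k _ => Submodule.smul_mem _ _
    (Finsupp.single_mem_supported _ _ (length_unitEnlarge l k))

theorem barOp_mem (l : OrdPart) : barOp (Finsupp.single l 1)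
    ∈ Finsupp.supported ℤ ℤ {l' : OrdPart | l'.length + 1 = l.length} := by
  rw [barOp_single]
  refine Submodule.add_mem _ (Submodule.sum_mem _ fun k hk => Submodule.smul_mem _ _
    (Finsupp.single_mem_supported _ _ (length_coarsen l k ?_))) ?_
  · rw [Finset.mem_range] at hk; omega
  · split_ifs with h
    · exact Submodule.zero_mem _
    · have : 0 < l.length := List.length_pos_iff.2 h
      refine Submodule.add_mem _ (Finsupp.single_mem_supported _ _ ?_) (Submodule.smul_mem _ _
        (Finsupp.single_mem_supported _ _ ?_)) <;>
      · simp only [Set.mem_ofPred_eq, List.length_tail, List.length_dropLast]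
        omega

theorem isOddOp_unitOp : IsOddOp unitOp := by
  intro l l' hl'
  have : l'.length = l.length + 1 := (Finsupp.mem_supported _ _).1 (unitOp_mem l) hl'
  rw [this, pow_succ]; ring

theorem isOddOp_barOp : IsOddOp barOp := by
  intro l l' hl'
  have : l'.length + 1 = l.length := (Finsupp.mem_supported _ _).1 (barOp_mem l) hl'
  rw [← this, pow_succ]; ring

end ListOperators

/-! ### Operators on vectors of partitions -/

section MultiOperators

variable {n : ℕ} [NeZero n]

/-- Put the entries of a combination of partitions into the place `j`. -/
noncomputable def place (lam : Fin n → OrdPart) (j : Fin n) :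
    (OrdPart →₀ ℤ) →ₗ[ℤ] ((Fin n → OrdPart) →₀ ℤ) :=
  Finsupp.lmapDomain ℤ ℤ (Function.update lam j)

theorem place_single (lam : Fin n → OrdPart) (j : Fin n) (l : OrdPart) (r : ℤ) :
    place lam j (Finsupp.single l r) = Finsupp.single (Function.update lam j l) r :=
  Finsupp.mapDomain_single

/-- Apply an operator on partitions to the `j`-th one. -/
noncomputable def atPlace (j : Fin n) (f : Module.End ℤ (OrdPart →₀ ℤ)) :
    Module.End ℤ ((Fin n → OrdPart) →₀ ℤ) :=
  ofBasis fun lam => lenSign lam j • place lam j (f (Finsupp.single (lam j) 1))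

theorem lenSign_sq (lam : Fin n → OrdPart) (j : Fin n) : lenSign lam j * lenSign lam j = 1 := by
  rw [lenSign, ← mul_pow]; simp

theorem lenSign_update_of_le {lam : Fin n → OrdPart} {j k : Fin n} (h : j ≤ k) (l : OrdPart) :
    lenSign (Function.update lam k l) j = lenSign lam j := by
  unfold lenSign
  congr 1
  refine Finset.sum_congr rfl fun i hi => ?_
  rw [Finset.mem_filter] at hi
  rw [Function.update_of_ne (ne_of_lt (lt_of_lt_of_le hi.2 h))]

theorem lenSign_update_of_lt {lam : Fin n → OrdPart} {j k : Fin n} (h : k < j) {l : OrdPart}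
    (hl : (-1 : ℤ) ^ l.length = -(-1) ^ (lam k).length) :
    lenSign (Function.update lam k l) j = -lenSign lam j := by
  unfold lenSign
  have hk : k ∈ univ.filter (fun i => i < j) := by simpa using h
  rw [← Finset.add_sum_erase _ _ hk, ← Finset.add_sum_erase _ _ hk, pow_add, pow_add,
    Function.update_self, hl, neg_mul]
  congr 3
  refine Finset.sum_congr rfl fun i hi => ?_
  rw [Function.update_of_ne (Finset.ne_of_mem_erase hi)]

theorem atPlace_place_self (lam : Fin n → OrdPart) (j : Fin n)
    (f : Module.End ℤ (OrdPart →₀ ℤ)) (m : OrdPart →₀ ℤ) :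
    atPlace j f (place lam j m) = lenSign lam j • place lam j (f m) := by
  induction m using Finsupp.induction_linear with
  | zero => simp
  | add m m' h h' => rw [map_add, map_add, h, h', map_add, map_add, smul_add]
  | single l r =>
    rw [← mul_one r, ← smul_eq_mul, ← Finsupp.smul_single, map_smul, map_smul, map_smul, map_smul,
      place_single, atPlace, ofBasis_single, lenSign_update_of_le le_rfl, Function.update_self,
      smul_comm]
    congr 2
    refine LinearMap.congr_fun (Finsupp.lhom_ext fun l' r' => ?_) _
    rw [place_single, place_single, Function.update_idem]

/-- The sign at `j` depends only on earlier places, so it is the same for both factors and squares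
to one. -/
theorem atPlace_mul_self (j : Fin n) (f g : Module.End ℤ (OrdPart →₀ ℤ)) (lam : Fin n → OrdPart) :
    (atPlace j f * atPlace j g) (Finsupp.single lam 1)
      = place lam j ((f * g) (Finsupp.single (lam j) 1)) := by
  rw [Module.End.mul_apply]
  nth_rw 2 [atPlace]
  rw [ofBasis_single, map_smul, atPlace_place_self, smul_smul, lenSign_sq, one_smul]
  rfl

theorem place_place_comm (lam : Fin n → OrdPart) {j k : Fin n} (hjk : j ≠ k)
    (m m' : OrdPart →₀ ℤ) :
    (m.sum fun l a => a • place (Function.update lam k l) j m')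
      = m'.sum fun l a => a • place (Function.update lam j l) k m := by
  have e : ∀ (j k : Fin n) (m m' : OrdPart →₀ ℤ),
      (m.sum fun l a => a • place (Function.update lam k l) j m')
      = m.sum fun l a => m'.sum fun l' b =>
        Finsupp.single (Function.update (Function.update lam k l) j l') (a * b) := by
    intro j k m m'
    refine Finsupp.sum_congr fun l _ => ?_
    rw [place, Finsupp.lmapDomain_apply, Finsupp.mapDomain, Finsupp.smul_sum]
    simp
  rw [e j k, e k j, Finsupp.sum_comm]
  refine Finsupp.sum_congr fun l _ => Finsupp.sum_congr fun l' _ => ?_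
  rw [Function.update_comm hjk, mul_comm]

/-- The operator at the earlier place changes the sign attached to the later one, but not
conversely. Hence only the parity of `g` matters. -/
theorem atPlace_anticomm_of_lt {j k : Fin n} (hjk : k < j) {f g : Module.End ℤ (OrdPart →₀ ℤ)}
    (hg : IsOddOp g) : atPlace j f * atPlace k g = -(atPlace k g * atPlace j f) := by
  refine end_ext fun lam => ?_
  have h1 : atPlace j f (place lam k (g (Finsupp.single (lam k) 1)))
      = -lenSign lam j • (g (Finsupp.single (lam k) 1)).sum fun l a =>
        a • place (Function.update lam k l) j (f (Finsupp.single (lam j) 1)) := by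
    rw [place, Finsupp.lmapDomain_apply, Finsupp.mapDomain, map_finsuppSum, Finsupp.smul_sum]
    refine Finsupp.sum_congr fun l hl => ?_
    rw [← mul_one ((g (Finsupp.single (lam k) 1)) l), ← smul_eq_mul, ← Finsupp.smul_single,
      map_smul, smul_eq_mul, mul_one, atPlace, ofBasis_single, lenSign_update_of_lt hjk (hg _ _ hl),
      Function.update_of_ne hjk.ne', smul_comm]
  have h2 : atPlace k g (place lam j (f (Finsupp.single (lam j) 1)))
      = lenSign lam k • (f (Finsupp.single (lam j) 1)).sum fun l a =>
        a • place (Function.update lam j l) k (g (Finsupp.single (lam k) 1)) := by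
    rw [place, Finsupp.lmapDomain_apply, Finsupp.mapDomain, map_finsuppSum, Finsupp.smul_sum]
    refine Finsupp.sum_congr fun l hl => ?_
    rw [← mul_one ((f (Finsupp.single (lam j) 1)) l), ← smul_eq_mul, ← Finsupp.smul_single,
      map_smul, smul_eq_mul, mul_one, atPlace, ofBasis_single, lenSign_update_of_le hjk.le,
      Function.update_of_ne hjk.ne, smul_comm]
  have e1 : (atPlace j f * atPlace k g) (Finsupp.single lam 1)
      = lenSign lam k • atPlace j f (place lam k (g (Finsupp.single (lam k) 1))) := by
    rw [Module.End.mul_apply]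
    nth_rw 2 [atPlace]
    rw [ofBasis_single, map_smul]
  have e2 : (atPlace k g * atPlace j f) (Finsupp.single lam 1)
      = lenSign lam j • atPlace k g (place lam j (f (Finsupp.single (lam j) 1))) := by
    rw [Module.End.mul_apply]
    nth_rw 2 [atPlace]
    rw [ofBasis_single, map_smul]
  rw [LinearMap.neg_apply, e1, e2, h1, h2, place_place_comm lam hjk.ne', smul_smul, smul_smul,
    ← neg_smul]
  congr 1; ring

theorem atPlace_anticomm {j k : Fin n} (hjk : j ≠ k) {f g : Module.End ℤ (OrdPart →₀ ℤ)}
    (hf : IsOddOp f) (hg : IsOddOp g) :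
    atPlace j f * atPlace k g = -(atPlace k g * atPlace j f) := by
  rcases lt_or_gt_of_ne hjk with h | h
  · rw [atPlace_anticomm_of_lt h hf, neg_neg]
  · exact atPlace_anticomm_of_lt h hg

theorem atPlace_unitOp_anticomm (j k : Fin n) :
    atPlace j unitOp * atPlace k unitOp = -(atPlace k unitOp * atPlace j unitOp) := by
  by_cases h : j = k
  · subst h
    have : atPlace j unitOp * atPlace j unitOp = 0 := end_ext fun lam => by
      rw [atPlace_mul_self, unitOp_sq]; simp
    rw [this, neg_zero]
  · exact atPlace_anticomm h isOddOp_unitOp isOddOp_unitOp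

theorem atPlace_barOp_anticomm (j k : Fin n) :
    atPlace j barOp * atPlace k barOp = -(atPlace k barOp * atPlace j barOp) := by
  by_cases h : j = k
  · subst h
    have : atPlace j barOp * atPlace j barOp = 0 := end_ext fun lam => by
      rw [atPlace_mul_self, barOp_sq]; simp
    rw [this, neg_zero]
  · exact atPlace_anticomm h isOddOp_barOp isOddOp_barOp

theorem atPlace_barOp_unitOp (j k : Fin n) :
    atPlace j barOp * atPlace k unitOp = -(atPlace k unitOp * atPlace j barOp) := by
  by_cases h : j = k
  · subst h
    refine end_ext fun lam => ?_
    rw [LinearMap.neg_apply, atPlace_mul_self, atPlace_mul_self, barOp_unitOp, LinearMap.neg_apply,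
      map_neg]
  · exact atPlace_anticomm h isOddOp_barOp isOddOp_unitOp

end MultiOperators

/-! ### The differential as an operator, and its square -/

section Differential

variable {n : ℕ} [NeZero n] {G : GridDiagram n}

variable (G) in
/-- The part of the differential that changes the partitions, up to sign. -/
noncomputable def partitionPart : Module.End ℤ (Total G) :=
  ∑ j, onLeft (annulusPart G j) * onRight (atPlace j unitOp) + ∑ j, onRight (atPlace j barOp)

/-- The annulus operators commute and the partition operators anticommute, so each double sum is its
own negative and the mixed sums cancel. -/
theorem partitionPart_sq : partitionPart G * partitionPart G = 0 := by
  have h1 : (∑ j, onLeft (annulusPart G j) * onRight (atPlace j unitOp))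
      * (∑ j, onLeft (annulusPart G j) * onRight (atPlace j unitOp)) = (0 : Module.End ℤ (Total G)) := by
    apply eq_zero_of_eq_neg
    rw [Finset.sum_mul_sum]
    conv_rhs => rw [Finset.sum_comm]
    simp only [← Finset.sum_neg_distrib]
    refine Finset.sum_congr rfl fun j _ => Finset.sum_congr rfl fun k _ => ?_
    have e : ∀ j k, onLeft (annulusPart G j) * onRight (atPlace j unitOp)
        * (onLeft (annulusPart G k) * onRight (atPlace k unitOp))
        = onLeft (annulusPart G j * annulusPart G k)
          * onRight (atPlace j unitOp * atPlace k unitOp) := by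
      intro j k
      rw [mul_assoc, ← mul_assoc (onRight _), onLeft_onRight_comm, map_mul, map_mul]
      simp only [mul_assoc]
    rw [e, e, annulusPart_comm j k, atPlace_unitOp_anticomm j k, map_neg, mul_neg]
  have h2 : (∑ j, onRight (atPlace j barOp)) * (∑ j, onRight (atPlace j barOp))
      = (0 : Module.End ℤ (Total G)) := by
    apply eq_zero_of_eq_neg
    rw [Finset.sum_mul_sum]
    conv_rhs => rw [Finset.sum_comm]
    simp only [← Finset.sum_neg_distrib]
    refine Finset.sum_congr rfl fun j _ => Finset.sum_congr rfl fun k _ => ?_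
    rw [← map_mul, ← map_mul, atPlace_barOp_anticomm j k, map_neg]
  have h3 : (∑ j, onRight (atPlace j barOp))
      * (∑ j, onLeft (annulusPart G j) * onRight (atPlace j unitOp))
      = -((∑ j, onLeft (annulusPart G j) * onRight (atPlace j unitOp))
        * (∑ j, onRight (atPlace j barOp)) : Module.End ℤ (Total G)) := by
    rw [Finset.sum_mul_sum, Finset.sum_mul_sum]
    conv_rhs => rw [Finset.sum_comm]
    simp only [← Finset.sum_neg_distrib]
    refine Finset.sum_congr rfl fun j _ => Finset.sum_congr rfl fun k _ => ?_
    rw [← mul_assoc, onLeft_onRight_comm, mul_assoc, ← map_mul, atPlace_barOp_unitOp j k, map_neg,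
      mul_neg, map_mul, mul_assoc]
  rw [partitionPart, add_mul, mul_add, mul_add, h1, h2, h3]
  abel

theorem onLeft_mul_partitionPart {T : Module.End ℤ (PosDomain G →₀ ℤ)}
    (h : ∀ j, T * annulusPart G j = annulusPart G j * T) :
    onLeft T * partitionPart G = partitionPart G * onLeft T := by
  simp only [partitionPart, mul_add, add_mul, Finset.mul_sum, Finset.sum_mul]
  refine congrArg₂ (· + ·) ?_ ?_
  · refine Finset.sum_congr rfl fun j _ => ?_
    rw [mul_assoc, onLeft_onRight_comm, ← mul_assoc, ← mul_assoc, ← map_mul, ← map_mul, h]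
  · refine Finset.sum_congr rfl fun j _ => ?_
    rw [onLeft_onRight_comm]

theorem parity_single (D : PosDomain G) :
    parity (Finsupp.single D 1) = (-1 : ℤ) ^ D.mu • Finsupp.single D 1 := ofBasis_single _ _

theorem onLeft_parity_single (g : Gen G) :
    onLeft parity (Finsupp.single g 1) = (-1 : ℤ) ^ g.1.mu • Finsupp.single g 1 := by
  rw [onLeft_single, parity_single, map_smul, Finsupp.lmapDomain_apply, Finsupp.mapDomain_single]

theorem onLeft_rectPart_single (s : SignAssignment G) (g : Gen G) :
    onLeft (rectPart s) (Finsupp.single g 1) = deltaI s g := by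
  rw [onLeft_single, rectPart, LinearMap.add_apply, Module.End.mul_apply, parity_single, map_smul,
    front, rear, ofBasis_single, ofBasis_single, map_add, map_smul, map_sum, map_sum, deltaI]
  simp only [map_smul, Finsupp.lmapDomain_apply, Finsupp.mapDomain_single]

theorem onRight_atPlace_single (j : Fin n) (f : Module.End ℤ (OrdPart →₀ ℤ)) (g : Gen G) :
    onRight (atPlace j f) (Finsupp.single g 1) = lenSign g.2 j •
      Finsupp.lmapDomain ℤ ℤ (fun l => (g.1, Function.update g.2 j l))
        (f (Finsupp.single (g.2 j) 1)) := by
  rw [onRight_single, atPlace, ofBasis_single, map_smul, place]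
  congr 1
  rw [Finsupp.lmapDomain_apply, Finsupp.lmapDomain_apply, Finsupp.lmapDomain_apply,
    ← Finsupp.mapDomain_comp]
  rfl

theorem annulus_unit_single (g : Gen G) (j : Fin n) :
    (onLeft (annulusPart G j) * onRight (atPlace j unitOp) : Module.End ℤ (Total G))
        (Finsupp.single g 1)
      = lenSign g.2 j •
    (∑ E ∈ g.1.remove (rowChain (G.oRow j)), ∑ k ∈ range ((g.2 j).length + 1),
        (-1 : ℤ) ^ k •
          Finsupp.single (E, Function.update g.2 j (unitEnlarge (g.2 j) k)) (1 : ℤ)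
      + ∑ E ∈ g.1.remove (colChain (G.oCol j)), ∑ k ∈ range ((g.2 j).length + 1),
        (-1 : ℤ) ^ k •
          Finsupp.single (E, Function.update g.2 j (unitEnlarge (g.2 j) k)) (1 : ℤ)) := by
  rw [← onLeft_onRight_comm, Module.End.mul_apply, onLeft_single, annulusPart, LinearMap.add_apply,
    takeOut, takeOut, ofBasis_single, ofBasis_single]
  simp only [map_add, map_sum, Finsupp.lmapDomain_apply, Finsupp.mapDomain_single,
    onRight_atPlace_single, unitOp_single, unitAux_eq,
    Finsupp.mapDomain_smul, ← Finset.smul_sum, ← smul_add]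

theorem bar_single (g : Gen G) (j : Fin n) :
    onRight (atPlace j barOp) (Finsupp.single g 1)
      = lenSign g.2 j • ∑ k ∈ range ((g.2 j).length - 1), (-1 : ℤ) ^ (k + 1) •
        Finsupp.single (g.1, Function.update g.2 j (coarsen (g.2 j) k)) (1 : ℤ)
      + (if g.2 j = [] then 0 else
        lenSign g.2 j • Finsupp.single (g.1, Function.update g.2 j (g.2 j).tail) (1 : ℤ)
        + (lenSign g.2 j * (-1) ^ (g.2 j).length) •
          Finsupp.single (g.1, Function.update g.2 j (g.2 j).dropLast) (1 : ℤ)) := by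
  rw [onRight_atPlace_single, barOp_single]
  split_ifs with h
  · simp only [add_zero, map_sum, map_smul, Finsupp.lmapDomain_apply, Finsupp.mapDomain_single]
  · simp only [map_add, map_sum, map_smul, Finsupp.lmapDomain_apply, Finsupp.mapDomain_single,
      smul_add, mul_smul]

theorem delta_eq (s : SignAssignment G) :
    delta s = onLeft (rectPart s) + partitionPart G * onLeft parity := by
  refine end_ext fun g => ?_
  rw [delta, Finsupp.linearCombination_single, one_smul, LinearMap.add_apply,
    onLeft_rectPart_single, Module.End.mul_apply, onLeft_parity_single, map_smul, partitionPart,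
    LinearMap.add_apply, LinearMap.sum_apply, LinearMap.sum_apply, add_assoc, add_assoc]
  simp only [annulus_unit_single, bar_single]
  rw [deltaII, deltaIII, deltaIV, Finset.sum_add_distrib, smul_add, smul_add]

/-- `parity` anticommutes with the rectangle part, and both commute with the partition part. The
mixed terms therefore cancel, and the squares of the two parts vanish separately. -/
theorem delta_sq (s : SignAssignment G) : delta s * delta s = 0 := by
  have h1 : onLeft (rectPart s) * onLeft (rectPart s) = (0 : Module.End ℤ (Total G)) := by
    rw [← map_mul, rectPart_sq, map_zero]
  have h2 : onLeft parity * onLeft (rectPart s)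
      = (-(onLeft (rectPart s) * onLeft parity) : Module.End ℤ (Total G)) := by
    rw [← map_mul, parity_mul_rectPart, map_neg, map_mul]
  have h3 : onLeft parity * onLeft parity = (1 : Module.End ℤ (Total G)) := by
    rw [← map_mul, parity_sq, map_one]
  have h4 := onLeft_mul_partitionPart (T := rectPart s) (rectPart_mul_annulusPart s)
  have h5 := onLeft_mul_partitionPart (T := parity) (parity_mul_annulusPart (G := G))
  have h6 := partitionPart_sq (G := G)
  rw [delta_eq, add_mul, mul_add, mul_add, h1, zero_add, ← mul_assoc, h4,
    mul_assoc (partitionPart G) (onLeft parity) (onLeft (rectPart s)), h2,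
    mul_assoc (partitionPart G) (onLeft parity), ← mul_assoc (onLeft parity) (partitionPart G), h5,
    mul_assoc (partitionPart G) (onLeft parity) (onLeft parity), h3, mul_one, h6, mul_neg,
    mul_assoc]
  abel

theorem delta_single (s : SignAssignment G) (g : Gen G) :
    delta s (Finsupp.single g 1) = deltaI s g + deltaII g + deltaIII g + deltaIV g := by
  rw [delta, Finsupp.linearCombination_single, one_smul]

/-- The generators that occur in `delta g`. -/
inductive Below (g : Gen G) : Gen G → Prop
  | first (R E : PosDomain G) (hR : R.mu = 1) (h : PosDomain.IsComp R E g.1) : Below g (E, g.2)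
  | last (E R : PosDomain G) (hR : R.mu = 1) (h : PosDomain.IsComp E R g.1) : Below g (E, g.2)
  | row (j : Fin n) (E : PosDomain G) (k : ℕ) (h : E ∈ g.1.remove (rowChain (G.oRow j))) :
      Below g (E, Function.update g.2 j (unitEnlarge (g.2 j) k))
  | col (j : Fin n) (E : PosDomain G) (k : ℕ) (h : E ∈ g.1.remove (colChain (G.oCol j))) :
      Below g (E, Function.update g.2 j (unitEnlarge (g.2 j) k))
  | coarsen (j : Fin n) (k : ℕ) (h : k + 1 < (g.2 j).length) :
      Below g (g.1, Function.update g.2 j (coarsen (g.2 j) k))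
  | tail (j : Fin n) (h : g.2 j ≠ []) : Below g (g.1, Function.update g.2 j (g.2 j).tail)
  | dropLast (j : Fin n) (h : g.2 j ≠ []) : Below g (g.1, Function.update g.2 j (g.2 j).dropLast)

theorem delta_single_mem (s : SignAssignment G) (g : Gen G) :
    delta s (Finsupp.single g 1) ∈ Finsupp.supported ℤ ℤ {g' | Below g g'} := by
  have sm : ∀ g', Below g g' → Finsupp.single g' (1 : ℤ) ∈ Finsupp.supported ℤ ℤ {g' | Below g g'} :=
    fun g' h => Finsupp.single_mem_supported _ _ h
  rw [delta_single]
  refine Submodule.add_mem _ (Submodule.add_mem _ (Submodule.add_mem _ ?_ ?_) ?_) ?_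
  · refine Submodule.add_mem _ (Submodule.sum_mem _ fun p hp => ?_) (Submodule.smul_mem _ _
      (Submodule.sum_mem _ fun p hp => ?_))
    · by_cases h : p.1.mu = 1
      · exact Submodule.smul_mem _ _ (sm _ (Below.first _ _ h (PosDomain.mem_decompositions.1 hp)))
      · rw [s.val_of_mu_ne h, zero_smul]; exact Submodule.zero_mem _
    · by_cases h : p.2.mu = 1
      · exact Submodule.smul_mem _ _ (sm _ (Below.last _ _ h (PosDomain.mem_decompositions.1 hp)))
      · rw [s.val_of_mu_ne h, zero_smul]; exact Submodule.zero_mem _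
  · refine Submodule.smul_mem _ _ (Submodule.sum_mem _ fun j _ => Submodule.smul_mem _ _
      (Submodule.add_mem _ ?_ ?_)) <;>
    refine Submodule.sum_mem _ fun E hE => Submodule.sum_mem _ fun k _ => Submodule.smul_mem _ _ ?_
    · exact sm _ (Below.row j E k hE)
    · exact sm _ (Below.col j E k hE)
  · refine Submodule.smul_mem _ _ (Submodule.sum_mem _ fun j _ => Submodule.smul_mem _ _
      (Submodule.sum_mem _ fun k hk => Submodule.smul_mem _ _ (sm _ (Below.coarsen j k ?_))))
    rw [Finset.mem_range] at hk; omega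
  · refine Submodule.smul_mem _ _ (Submodule.sum_mem _ fun j _ => ?_)
    split_ifs with h
    · exact Submodule.zero_mem _
    · exact Submodule.add_mem _ (Submodule.smul_mem _ _ (sm _ (Below.tail j h)))
        (Submodule.smul_mem _ _ (sm _ (Below.dropLast j h)))

theorem sum_length_update (lam : Fin n → OrdPart) (j : Fin n) (l : OrdPart) :
    ∑ i, (Function.update lam j l i).length + (lam j).length = ∑ i, (lam i).length + l.length := by
  rw [← Finset.add_sum_erase _ _ (Finset.mem_univ j), ← Finset.add_sum_erase univ
    (fun i => (lam i).length) (Finset.mem_univ j), Function.update_self]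
  have : ∑ i ∈ univ.erase j, (Function.update lam j l i).length
      = ∑ i ∈ univ.erase j, (lam i).length :=
    Finset.sum_congr rfl fun i hi => by rw [Function.update_of_ne (Finset.ne_of_mem_erase hi)]
  rw [this]; ring

/-- A rectangle has index one; an annulus has index two, while the accompanying unit enlargement
adds one part. -/
theorem Below.gr_eq {g g' : Gen G} (h : Below g g') : gr g = gr g' + 1 := by
  cases h with
  | first R E hR h => have := h.mu_add; simp only [gr]; omega
  | last E R hR h => have := h.mu_add; simp only [gr]; omega
  | row j E k h =>
    have h1 := mu_of_mem_remove (Or.inl ⟨_, rfl⟩) h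
    have h2 := sum_length_update g.2 j (unitEnlarge (g.2 j) k)
    rw [length_unitEnlarge] at h2
    simp only [gr]; omega
  | col j E k h =>
    have h1 := mu_of_mem_remove (Or.inr ⟨_, rfl⟩) h
    have h2 := sum_length_update g.2 j (unitEnlarge (g.2 j) k)
    rw [length_unitEnlarge] at h2
    simp only [gr]; omega
  | coarsen j k h =>
    have h1 := length_coarsen _ _ h
    have h2 := sum_length_update g.2 j (GridCDP.coarsen (g.2 j) k)
    simp only [gr]; omega
  | tail j h =>
    have h2 := sum_length_update g.2 j (g.2 j).tail
    have h3 := List.length_pos_iff.2 h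
    rw [List.length_tail] at h2
    simp only [gr]; omega
  | dropLast j h =>
    have h2 := sum_length_update g.2 j (g.2 j).dropLast
    have h3 := List.length_pos_iff.2 h
    rw [List.length_dropLast] at h2
    simp only [gr]; omega

/-- A linear map takes a supported submodule into a submodule as soon as it does so on
generators. -/
theorem map_supported {A M : Type*} [AddCommGroup M] (T : (A →₀ ℤ) →ₗ[ℤ] M) {S : Set A}
    {P : Submodule ℤ M} (h : ∀ a ∈ S, T (Finsupp.single a 1) ∈ P) {c : A →₀ ℤ}
    (hc : c ∈ Finsupp.supported ℤ ℤ S) : T c ∈ P := by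
  rw [← Finsupp.sum_single c, Finsupp.sum, map_sum]
  refine Submodule.sum_mem _ fun a ha => ?_
  rw [← mul_one (c a), ← smul_eq_mul, ← Finsupp.smul_single, map_smul]
  exact Submodule.smul_mem _ _ (h a ((Finsupp.mem_supported _ _).1 hc ha))

theorem eq_nil_or_eq_one_of_size_le {l : OrdPart} (h : size l ≤ 1) : l = [] ∨ l = [1] := by
  match l with
  | [] => exact Or.inl rfl
  | [a] =>
    right
    have : (a : ℕ) ≤ 1 := by simpa [size] using h
    have h2 := a.pos
    have : a = 1 := PNat.eq (by rw [PNat.one_coe]; omega)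
    rw [this]
  | a :: b :: l =>
    have h1 := a.pos
    have h2 := b.pos
    simp [size] at h
    omega

theorem barOp_single_of_size_le {l : OrdPart} (h : size l ≤ 1) :
    barOp (Finsupp.single l 1) = 0 := by
  rcases eq_nil_or_eq_one_of_size_le h with rfl | rfl <;> rw [barOp_single] <;> simp

theorem mu_ne_one_of_isComp {R S D : PosDomain G} (h : PosDomain.IsComp R S D)
    (hD : D.coeff = 0) : R.mu = 0 ∧ S.mu = 0 := by
  have h4 := h.2.2.2
  rw [hD] at h4
  constructor
  · apply PosDomain.mu_eq_zero_of_coeff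
    ext i j
    have := congrFun (congrFun h4 i) j
    exact (Nat.add_eq_zero_iff.1 this).1
  · apply PosDomain.mu_eq_zero_of_coeff
    ext i j
    have := congrFun (congrFun h4 i) j
    exact (Nat.add_eq_zero_iff.1 this).2

theorem remove_eq_empty {D : PosDomain G} (hD : D.coeff = 0) {c : Chain n} (hc : c ≠ 0) :
    D.remove c = ∅ := by
  rw [Finset.eq_empty_iff_forall_notMem]
  intro E hE
  rw [mem_remove, hD] at hE
  apply hc
  ext i j
  have := congrFun (congrFun hE.2.2 i) j
  exact (Nat.add_eq_zero_iff.1 this).2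

theorem rowChain_ne_zero (j : Fin n) : rowChain j ≠ (0 : Chain n) := fun h => by
  have := congrFun (congrFun h 0) j
  simp [rowChain] at this

theorem colChain_ne_zero (j : Fin n) : colChain j ≠ (0 : Chain n) := fun h => by
  have := congrFun (congrFun h j) 0
  simp [colChain] at this

theorem deltaI_eq_zero (s : SignAssignment G) {g : Gen G} (hg : g.1.coeff = 0) :
    deltaI s g = 0 := by
  rw [deltaI, Finset.sum_eq_zero, Finset.sum_eq_zero, smul_zero, add_zero]
  · intro p hp
    have := mu_ne_one_of_isComp (PosDomain.mem_decompositions.1 hp) hg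
    rw [s.val_of_mu_ne (by omega), zero_smul]
  · intro p hp
    have := mu_ne_one_of_isComp (PosDomain.mem_decompositions.1 hp) hg
    rw [s.val_of_mu_ne (by omega), zero_smul]

theorem deltaII_eq_zero {g : Gen G} (hg : g.1.coeff = 0) : deltaII g = 0 := by
  simp [deltaII, remove_eq_empty hg (rowChain_ne_zero _), remove_eq_empty hg (colChain_ne_zero _)]

theorem deltaIII_add_deltaIV (g : Gen G) : deltaIII g + deltaIV g
    = (-1 : ℤ) ^ g.1.mu • ∑ j, onRight (atPlace j barOp) (Finsupp.single g 1) := by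
  simp only [bar_single]
  rw [deltaIII, deltaIV, Finset.sum_add_distrib, smul_add]

/-- A trivial domain has nothing to take out. For the partition `(1)` the removals of the first and
of the last part agree and have opposite signs. -/
theorem delta_single_of_isDagger (s : SignAssignment G) {g : Gen G} (hg : IsDagger g) :
    delta s (Finsupp.single g 1) = 0 := by
  rw [delta_single, deltaI_eq_zero s hg.2.2.1, deltaII_eq_zero hg.2.2.1, add_assoc,
    deltaIII_add_deltaIV, Finset.sum_eq_zero, smul_zero, zero_add, zero_add]
  intro j _
  rw [onRight_atPlace_single, barOp_single_of_size_le (hg.2.2.2 j), map_zero, smul_zero]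

theorem isDifferential (s : SignAssignment G) : IsDifferential s where
  map_chains k c hc := by
    refine map_supported (delta s) (fun g hg => ?_) hc
    refine Finsupp.supported_mono (fun g' h => ?_) (delta_single_mem s g)
    have := Below.gr_eq h
    have hg' : gr g = k + 1 := hg
    show gr g' = k
    omega
  map_chains_zero c hc := by
    have := map_supported (delta s) (P := ⊥) (fun g hg => ?_) hc
    · simpa using this
    · have h2 := delta_single_mem s g
      have : {g' | Below g g'} = ∅ := by
        ext g'
        simp only [Set.mem_ofPred_eq, Set.mem_empty_iff_false, iff_false]
        intro h
        have := Below.gr_eq h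
        have hg' : gr g = 0 := hg
        omega
      rw [this, Finsupp.supported_empty] at h2
      exact h2
  sq_zero c := LinearMap.congr_fun (delta_sq s) c
  map_dagger k c hc := by
    refine map_supported (delta s) (fun g hg => ?_) hc
    rw [delta_single_of_isDagger s hg.2]
    exact Submodule.zero_mem _

end Differential

/-! ### Pivot strips -/

section Pivot

variable {n : ℕ} [NeZero n]

theorem le_last (i : Fin n) : i ≤ last n := by
  have := i.2
  rw [Fin.le_def]
  simp only [last]
  omega

theorem ind_of_lt {p q : Fin n} (h : p < q) (i : Fin n) :
    ind p q i = if p ≤ i ∧ i < q then 1 else 0 := by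
  simp [ind, h]

theorem ind_of_not_lt {p q : Fin n} (h : ¬ p < q) (i : Fin n) :
    ind p q i = if p ≤ i ∨ i < q then 1 else 0 := by
  simp [ind, h]

theorem lt_of_ind_last {p q : Fin n} (h : ind p q (last n) = 0) : p < q := by
  by_contra hpq
  rw [ind_of_not_lt hpq, if_pos (Or.inl (le_last p))] at h
  omega

theorem ind_last_of_lt {p q : Fin n} (h : p < q) : ind p q (last n) = 0 := by
  rw [ind_of_lt h, if_neg]
  rintro ⟨-, h2⟩
  exact absurd (le_last q) (not_le.2 h2)

theorem lt_succ_of_ne_last {i : Fin n} (h : i ≠ last n) : i < i + 1 := by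
  have h1 := val_succ i
  have h2 : (i : ℕ) ≠ n - 1 := fun e => h (Fin.ext e)
  rw [Fin.lt_def, h1, if_neg h2]
  omega

/-- The total multiplicity in the last row and the last column. -/
def edge (c : Chain n) : ℕ := ∑ i, c i (last n) + ∑ j, c (last n) j

theorem edge_add (c d : Chain n) : edge (c + d) = edge c + edge d := by
  simp only [edge, Pi.add_apply, Finset.sum_add_distrib]; ring

theorem edge_eq_zero {c : Chain n} (h : edge c = 0) :
    (∀ i, c i (last n) = 0) ∧ ∀ j, c (last n) j = 0 := by
  obtain ⟨h1, h2⟩ := Nat.add_eq_zero_iff.1 h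
  exact ⟨fun i => Finset.sum_eq_zero_iff.1 h1 i (Finset.mem_univ i),
    fun j => Finset.sum_eq_zero_iff.1 h2 j (Finset.mem_univ j)⟩

theorem one_le_edge_rowChain (j : Fin n) : 1 ≤ edge (rowChain j) := by
  by_contra h
  have := (edge_eq_zero (show edge (rowChain j) = 0 by omega)).2 j
  simp [rowChain] at this

theorem one_le_edge_colChain (j : Fin n) : 1 ≤ edge (colChain j) := by
  by_contra h
  have := (edge_eq_zero (show edge (colChain j) = 0 by omega)).1 j
  simp [colChain] at this

theorem lt_of_edge_rect {x : Equiv.Perm (Fin n)} {a b : Fin n}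
    (h : edge (rect x a b) = 0) : a < b ∧ x a < x b := by
  obtain ⟨h1, h2⟩ := edge_eq_zero h
  constructor
  · apply lt_of_ind_last
    have := h2 (x a)
    rwa [rect, ind_left, mul_one] at this
  · apply lt_of_ind_last
    have := h1 a
    rwa [rect, ind_left, one_mul] at this

theorem edge_rect {x : Equiv.Perm (Fin n)} {a b : Fin n} (hab : a < b) (hx : x a < x b) :
    edge (rect x a b) = 0 := by
  simp [edge, rect, ind_last_of_lt hab, ind_last_of_lt hx]

/-- A weight on permutations that increases when an inversion is created. -/
def invWeight (x : Equiv.Perm (Fin n)) : ℕ :=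
  ∑ i : Fin n, (n - 1 - (i : ℕ)) * (x i : ℕ)

theorem invWeight_lt {x : Equiv.Perm (Fin n)} {a b : Fin n} (hab : a < b) (hx : x a < x b) :
    invWeight x < invWeight (x * Equiv.swap a b) := by
  have split : ∀ f : Fin n → ℕ, ∑ i, f i = f a + (f b + ∑ i ∈ (univ.erase a).erase b, f i) := by
    intro f
    rw [← Finset.add_sum_erase _ _ (Finset.mem_univ a),
      ← Finset.add_sum_erase (univ.erase a) _ (Finset.mem_erase.2 ⟨hab.ne', Finset.mem_univ b⟩)]
  rw [invWeight, invWeight, split, split]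
  have : ∑ i ∈ (univ.erase a).erase b, (n - 1 - (i : ℕ)) * ((x * Equiv.swap a b) i : ℕ)
      = ∑ i ∈ (univ.erase a).erase b, (n - 1 - (i : ℕ)) * (x i : ℕ) := by
    refine Finset.sum_congr rfl fun i hi => ?_
    rw [Finset.mem_erase, Finset.mem_erase] at hi
    rw [Equiv.Perm.mul_apply, Equiv.swap_apply_of_ne_of_ne hi.2.1 hi.1]
  rw [this]
  simp only [Equiv.Perm.mul_apply, Equiv.swap_apply_left, Equiv.swap_apply_right]
  have hb := b.2
  rw [Fin.lt_def] at hab hx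
  obtain ⟨d, hd⟩ := Nat.exists_eq_add_of_lt hab
  obtain ⟨e, he⟩ := Nat.exists_eq_add_of_lt hx
  have h1 : n - 1 - (a : ℕ) = (n - 1 - (b : ℕ)) + (d + 1) := by omega
  rw [h1, he]
  nlinarith

/-- The boundary condition is summed upwards, starting from the last row and passing to row zero;
the jumps met up to row `r` are then counted by inequalities. -/
theorem sub_pred_eq {x y : Equiv.Perm (Fin n)} {c : Chain n} (h : Connects x y c) (i r : Fin n) :
    (c i r : ℤ) - c (i - 1) r = (c i (last n) : ℤ) - c (i - 1) (last n)
      + ((if x i ≤ r then 1 else 0) - (if y i ≤ r then 1 else 0)) := by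
  refine cyclic_induction (P := fun r => (c i r : ℤ) - c (i - 1) r
    = (c i (last n) : ℤ) - c (i - 1) (last n)
      + ((if x i ≤ r then 1 else 0) - (if y i ≤ r then 1 else 0))) (last n) ?_ (fun r hr => ?_) r
  · simp [le_last]
  · have h1 := h i r
    simp only [alphaBoundary] at h1
    have h2 : (c i r : ℤ) - c (i - 1) r = ((c i (r - 1) : ℤ) - c (i - 1) (r - 1))
      + ((if x i = r then 1 else 0) - (if y i = r then 1 else 0)) := by linarith
    rw [h2, hr, add_assoc]
    congr 1
    have h3 := val_pred r
    have h4 := (x i).2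
    have h5 := (y i).2
    have h6 := r.2
    simp only [Fin.le_def, Fin.ext_iff]
    rw [h3]
    generalize ((x i : Fin n) : ℕ) = p at *
    generalize ((y i : Fin n) : ℕ) = q at *
    split_ifs <;> omega

/-- The column `i` can be used to change domains with last row `a` and final generator `y`. -/
def GoodColumn (a : Fin n → ℕ) (y : Equiv.Perm (Fin n)) (i : Fin n) : Prop :=
  i ≠ last n ∧ (a (i - 1) + a (i + 1) < 2 * a i ∨
    (a (i - 1) + a (i + 1) ≤ 2 * a i ∧ y (i + 1) < y i))

/-- Subtract `sub_pred_eq` for columns `i` and `i + 1`. In row `r` the quantity `2 c_i - c_{i-1} -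
c_{i+1}` is its value in the last row, plus `1`, minus `[y i ≤ r]`, plus `[y (i+1) ≤ r]`. Goodness
makes this positive, hence `c_i` is positive. -/
theorem one_le_of_goodColumn {x y : Equiv.Perm (Fin n)} {c : Chain n} (h : Connects x y c)
    {i : Fin n} (hi : GoodColumn (fun i => c i (last n)) y i) {r : Fin n} (h1 : x i ≤ r)
    (h2 : r < x (i + 1)) : 1 ≤ c i r := by
  have e1 := sub_pred_eq h i r
  have e2 := sub_pred_eq h (i + 1) r
  rw [add_sub_cancel_right, if_neg (not_le.2 h2)] at e2
  rw [if_pos h1] at e1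
  obtain ⟨-, hi⟩ := hi
  simp only at hi
  rcases hi with hi | ⟨hi, hy⟩
  · split_ifs at e1 e2 <;> omega
  · have : y i ≤ r → y (i + 1) ≤ r := fun h => hy.le.trans h
    split_ifs at e1 e2 <;> omega

/-- Take the first index at which `a` is maximal. Its left neighbour is strictly smaller, also for
index zero, where the neighbour is the last index and has value zero. -/
theorem exists_goodColumn_of_ne_zero {a : Fin n → ℕ} (ha : a (last n) = 0) (h : a ≠ 0)
    (y : Equiv.Perm (Fin n)) : ∃ i, GoodColumn a y i := by
  obtain ⟨m, -, hm⟩ := Finset.exists_max_image univ a ⟨0, Finset.mem_univ _⟩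
  obtain ⟨i, hi, hmin⟩ := Finset.exists_min_image (univ.filter fun i => ∀ k, a k ≤ a i) id
    ⟨m, by simpa using fun k => hm k (Finset.mem_univ k)⟩
  rw [Finset.mem_filter] at hi
  obtain ⟨k, hk⟩ : ∃ k, a k ≠ 0 := by
    by_contra hcon
    push Not at hcon
    exact h (funext hcon)
  have hpos : 0 < a i := lt_of_lt_of_le (Nat.pos_of_ne_zero hk) (hi.2 k)
  have hil : i ≠ last n := by rintro rfl; omega
  refine ⟨i, hil, Or.inl ?_⟩
  have h1 : a (i - 1) < a i := by
    by_contra hcon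
    have hle : i ≤ i - 1 := hmin (i - 1) (by
      rw [Finset.mem_filter]
      exact ⟨Finset.mem_univ _, fun k => (hi.2 k).trans (not_lt.1 hcon)⟩)
    have h2 := val_pred i
    have h3 := i.2
    rw [Fin.le_def, h2] at hle
    have h0 : (i : ℕ) = 0 := by
      split_ifs at hle with h0
      · exact h0
      · omega
    have : i - 1 = last n := Fin.ext (by rw [h2, if_pos h0]; rfl)
    rw [this, ha] at hcon
    exact hcon hpos
  have h2 := hi.2 (i + 1)
  omega

/-- Induction gives `k ≤ y k`, and equality holds because the two sides have the same sum. -/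
theorem eq_one_of_forall_lt {y : Equiv.Perm (Fin n)}
    (h : ∀ i, i ≠ last n → y i < y (i + 1)) : y = 1 := by
  have hle : ∀ k (hk : k < n), k ≤ (y ⟨k, hk⟩ : ℕ) := by
    intro k
    induction k with
    | zero => intro _; exact Nat.zero_le _
    | succ k ih =>
      intro hk
      have hkl : (⟨k, by omega⟩ : Fin n) ≠ last n := by
        rw [ne_eq, Fin.ext_iff]; simp only [last]; omega
      have h1 := h _ hkl
      have h2 := ih (by omega)
      have h3 : (⟨k, by omega⟩ + 1 : Fin n) = ⟨k + 1, hk⟩ := by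
        rw [Fin.ext_iff, val_succ, if_neg]
        simp only; omega
      rw [h3, Fin.lt_def] at h1
      omega
  have hsum : ∑ i, (y i : ℕ) = ∑ i : Fin n, (i : ℕ) := Equiv.sum_comp y (fun i => (i : ℕ))
  have heq := (Finset.sum_eq_sum_iff_of_le (fun (i : Fin n) _ => hle i i.2)).1 hsum.symm
  ext i
  rw [← heq i (Finset.mem_univ i)]
  rfl

theorem exists_goodColumn_of_ne_one {y : Equiv.Perm (Fin n)} (h : y ≠ 1) :
    ∃ i, GoodColumn (fun _ => 0) y i := by
  by_contra hcon
  push Not at hcon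
  apply h
  refine eq_one_of_forall_lt fun i hi => ?_
  by_contra hlt
  refine hcon i ⟨hi, Or.inr ⟨by simp, lt_of_le_of_ne (not_lt.1 hlt) ?_⟩⟩
  exact y.injective.ne (lt_succ_of_ne_last hi).ne'

/-- Columns are treated from left to right. If the previous column vanishes, column `k` is `[x k ≤
r] - [k ≤ r]`. Nonnegativity at `r = k` gives `x k ≤ k`; smaller values are already taken, so `x k =
k` and the column vanishes. -/
theorem eq_zero_of_edge_eq_zero {x : Equiv.Perm (Fin n)} {c : Chain n} (h : Connects x 1 c)
    (hc : edge c = 0) : c = 0 := by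
  obtain ⟨h1, h2⟩ := edge_eq_zero hc
  have key : ∀ k (hk : k < n), x ⟨k, hk⟩ = ⟨k, hk⟩ ∧ ∀ r, c ⟨k, hk⟩ r = 0 := by
    intro k
    induction k using Nat.strong_induction_on with
    | _ k ih =>
    intro hk
    have hprev : ∀ r, c (⟨k, hk⟩ - 1) r = 0 := by
      intro r
      have hv := val_pred (⟨k, hk⟩ : Fin n)
      by_cases h0 : k = 0
      · have : (⟨k, hk⟩ - 1 : Fin n) = last n := Fin.ext (by rw [hv, if_pos h0]; rfl)
        rw [this, h2]
      · have : (⟨k, hk⟩ - 1 : Fin n) = ⟨k - 1, by omega⟩ := Fin.ext (by rw [hv, if_neg h0])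
        rw [this]
        exact (ih (k - 1) (by omega) (by omega)).2 r
    have hu : ∀ r, (c ⟨k, hk⟩ r : ℤ)
        = (if x ⟨k, hk⟩ ≤ r then 1 else 0) - (if (1 : Equiv.Perm (Fin n)) ⟨k, hk⟩ ≤ r then 1 else 0) := by
      intro r
      have := sub_pred_eq h ⟨k, hk⟩ r
      rw [hprev, hprev, h1] at this
      simpa using this
    have hle : x ⟨k, hk⟩ ≤ ⟨k, hk⟩ := by
      by_contra hcon
      have := hu ⟨k, hk⟩
      rw [if_neg hcon, if_pos (show (1 : Equiv.Perm (Fin n)) ⟨k, hk⟩ ≤ ⟨k, hk⟩ from le_rfl)] at this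
      omega
    have hx : x ⟨k, hk⟩ = ⟨k, hk⟩ := by
      by_contra hne
      have hlt : x ⟨k, hk⟩ < ⟨k, hk⟩ := lt_of_le_of_ne hle hne
      have h3 := (ih (x ⟨k, hk⟩ : ℕ) hlt (x ⟨k, hk⟩).2).1
      exact hne (x.injective h3)
    refine ⟨hx, fun r => ?_⟩
    have hr := hu r
    rw [hx] at hr
    by_cases hkr : (⟨k, hk⟩ : Fin n) ≤ r
    · rw [if_pos hkr, if_pos (show (1 : Equiv.Perm (Fin n)) ⟨k, hk⟩ ≤ r from hkr)] at hr
      omega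
    · rw [if_neg hkr, if_neg (show ¬ (1 : Equiv.Perm (Fin n)) ⟨k, hk⟩ ≤ r from hkr)] at hr
      omega
  ext i r
  exact (key i i.2).2 r

/-- Reflection in the diagonal reduces statements on rows to statements on columns. -/
theorem connects_transpose {x y : Equiv.Perm (Fin n)} {c : Chain n} (h : Connects x y c) :
    Connects x⁻¹ y⁻¹ (fun i j => c j i) := by
  intro i j
  have h1 : alphaBoundary (fun i j => c j i) i j = alphaBoundary c j i := by
    simp only [alphaBoundary]; ring
  rw [h1, h j i]
  simp only [Equiv.Perm.inv_eq_iff_eq]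
  simp only [eq_comm]

/-- A column (`inl`) or a row (`inr`). -/
abbrev Strip (n : ℕ) : Type := Fin n ⊕ Fin n

namespace Strip

/-- The strip is suitable for changing domains with last row `a`, last column `b`, and
final generator `y`. -/
def Good (a b : Fin n → ℕ) (y : Equiv.Perm (Fin n)) : Strip n → Prop
  | .inl i => GoodColumn a y i
  | .inr j => GoodColumn b y⁻¹ j

/-- The strip contains the square. -/
def Contains (i j : Fin n) : Strip n → Prop
  | .inl k => i = k
  | .inr k => j = k

/-- The strip is neither the last row nor the last column. -/
def Inner : Strip n → Prop
  | .inl k => k ≠ last n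
  | .inr k => k ≠ last n

/-- The column of the coordinate of `x` at the left or lower side of the strip. -/
def fst (x : Equiv.Perm (Fin n)) : Strip n → Fin n
  | .inl k => k
  | .inr k => x⁻¹ k

/-- The column of the coordinate of `x` at the right or upper side of the strip. -/
def snd (x : Equiv.Perm (Fin n)) : Strip n → Fin n
  | .inl k => k + 1
  | .inr k => x⁻¹ (k + 1)

/-- There is a rectangle from `x` in the strip that does not meet the last row and column. -/
def Ascent (x : Equiv.Perm (Fin n)) : Strip n → Prop
  | .inl k => x k < x (k + 1)
  | .inr k => x⁻¹ k < x⁻¹ (k + 1)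

variable {x y : Equiv.Perm (Fin n)} {p : Strip n}

/-- Exchange the coordinates of `x` on the two sides of the strip. -/
def flip (p : Strip n) (x : Equiv.Perm (Fin n)) : Equiv.Perm (Fin n) :=
  x * Equiv.swap (p.fst x) (p.snd x)

theorem Good.inner {a b : Fin n → ℕ} (h : p.Good a b y) : p.Inner := by
  cases p with
  | inl k => exact h.1
  | inr k => exact h.1

theorem Inner.fst_ne_snd (h : p.Inner) : p.fst x ≠ p.snd x := by
  cases p with
  | inl k => exact (lt_succ_of_ne_last h).ne
  | inr k => exact x⁻¹.injective.ne (lt_succ_of_ne_last h).ne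

theorem Ascent.lt (hp : p.Inner) (h : p.Ascent x) :
    p.fst x < p.snd x ∧ x (p.fst x) < x (p.snd x) := by
  cases p with
  | inl k => exact ⟨lt_succ_of_ne_last hp, h⟩
  | inr k =>
    refine ⟨h, ?_⟩
    simpa [fst, snd] using lt_succ_of_ne_last hp

theorem flip_inl (k : Fin n) : flip (.inl k) x = x * Equiv.swap k (k + 1) := rfl

theorem flip_inr (k : Fin n) : flip (.inr k) x = Equiv.swap k (k + 1) * x := by
  rw [flip, fst, snd, Equiv.mul_swap_eq_swap_mul]
  simp

theorem flip_flip : p.flip (p.flip x) = x := by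
  cases p with
  | inl k => rw [flip_inl, flip_inl, mul_assoc, Equiv.swap_mul_self, mul_one]
  | inr k => rw [flip_inr, flip_inr, ← mul_assoc, Equiv.swap_mul_self, one_mul]

theorem ascent_flip (hp : p.Inner) : p.Ascent (p.flip x) ↔ ¬ p.Ascent x := by
  cases p with
  | inl k =>
    rw [flip_inl]
    simp only [Ascent, Equiv.Perm.mul_apply, Equiv.swap_apply_left, Equiv.swap_apply_right, not_lt]
    exact ⟨le_of_lt, fun h => lt_of_le_of_ne h (x.injective.ne (lt_succ_of_ne_last hp).ne')⟩
  | inr k =>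
    rw [flip_inr]
    simp only [Ascent, mul_inv_rev, Equiv.swap_inv, Equiv.Perm.mul_apply, Equiv.swap_apply_left,
      Equiv.swap_apply_right, not_lt]
    exact ⟨le_of_lt, fun h => lt_of_le_of_ne h (x⁻¹.injective.ne (lt_succ_of_ne_last hp).ne')⟩

theorem contains_of_rect_ne_zero (hp : p.Inner) {i j : Fin n}
    (h : rect x (p.fst x) (p.snd x) i j ≠ 0) : p.Contains i j := by
  cases p with
  | inl k =>
    have h1 : ind k (k + 1) i ≠ 0 := fun e => h (by simp [rect, fst, snd, e])
    rw [ind_succ] at h1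
    by_contra hne
    exact h1 (if_neg hne)
  | inr k =>
    have h1 : ind k (k + 1) j ≠ 0 := fun e => h (by simp [rect, fst, snd, e])
    rw [ind_succ] at h1
    by_contra hne
    exact h1 (if_neg hne)

theorem rect_apply_eq_zero (hp : p.Inner) {i : Fin n} (h1 : i ≠ p.fst x) :
    rect x (p.fst x) (p.snd x) i (x i) = 0 := by
  by_contra h
  have := contains_of_rect_ne_zero hp h
  cases p with
  | inl k => exact h1 this
  | inr k =>
    apply h1
    simp only [Contains] at this
    simp [fst, ← this]

theorem eq_of_rect_contains (hp : p.Inner) {a b : Fin n} (hab : a < b) (hx : x a < x b)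
    (h : ∀ i j, rect x a b i j ≠ 0 → p.Contains i j) :
    p.Ascent x ∧ a = p.fst x ∧ b = p.snd x := by
  cases p with
  | inl k =>
    obtain ⟨rfl, rfl⟩ := eq_of_ind_le_single hab.ne (j := k) (fun i hi => by
      by_contra h0
      exact hi (h i (x a) (by rw [rect, ind_left, mul_one]; exact h0)))
    exact ⟨hx, rfl, rfl⟩
  | inr k =>
    obtain ⟨e1, e2⟩ := eq_of_ind_le_single hx.ne (j := k) (fun j hj => by
      by_contra h0
      exact hj (h a j (by rw [rect, ind_left, one_mul]; exact h0)))
    have e3 : a = x⁻¹ k := by rw [← e1]; simp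
    have e4 : b = x⁻¹ (k + 1) := by rw [← e2]; simp
    refine ⟨?_, e3, e4⟩
    simp only [Ascent]
    rwa [← e3, ← e4]

theorem rect_le_of_good {c : Chain n} (h : Connects x y c)
    (hp : p.Good (fun i => c i (last n)) (fun j => c (last n) j) y) (ha : p.Ascent x) :
    rect x (p.fst x) (p.snd x) ≤ c := by
  have hlt := ha.lt hp.inner
  intro i j
  by_cases h0 : rect x (p.fst x) (p.snd x) i j = 0
  · rw [h0]; exact Nat.zero_le _
  have hc := contains_of_rect_ne_zero hp.inner h0
  have hle : rect x (p.fst x) (p.snd x) i j ≤ 1 :=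
    Nat.mul_le_mul (ind_le_one _ _ i) (ind_le_one _ _ j)
  refine hle.trans ?_
  have hi : ind (p.fst x) (p.snd x) i ≠ 0 := left_ne_zero_of_mul h0
  have hj : ind (x (p.fst x)) (x (p.snd x)) j ≠ 0 := right_ne_zero_of_mul h0
  have hi' : p.fst x ≤ i ∧ i < p.snd x := by
    by_contra hcon
    rw [ind_of_lt hlt.1, if_neg hcon] at hi
    exact hi rfl
  have hj' : x (p.fst x) ≤ j ∧ j < x (p.snd x) := by
    by_contra hcon
    rw [ind_of_lt hlt.2, if_neg hcon] at hj
    exact hj rfl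
  cases p with
  | inl k =>
    obtain rfl : i = k := hc
    exact one_le_of_goodColumn h hp hj'.1 hj'.2
  | inr k =>
    obtain rfl : j = k := hc
    exact one_le_of_goodColumn (connects_transpose h) hp hi'.1 hi'.2

open Classical in
/-- A chosen suitable strip. -/
noncomputable def choose (a b : Fin n → ℕ) (y : Equiv.Perm (Fin n)) : Option (Strip n) :=
  if h : ∃ p : Strip n, p.Good a b y then some h.choose else none

theorem good_of_choose {a b : Fin n → ℕ} (h : choose a b y = some p) : p.Good a b y := by
  unfold choose at h
  split_ifs at h with he
  rw [← Option.some_injective _ h]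
  exact he.choose_spec

theorem eq_of_choose_eq_none {a b : Fin n → ℕ} (ha : a (last n) = 0) (hb : b (last n) = 0)
    (h : choose a b y = none) : a = 0 ∧ b = 0 ∧ y = 1 := by
  unfold choose at h
  split_ifs at h with he
  push Not at he
  have h1 : a = 0 := by
    by_contra hne
    obtain ⟨i, hi⟩ := exists_goodColumn_of_ne_zero ha hne y
    exact he (.inl i) hi
  have h2 : b = 0 := by
    by_contra hne
    obtain ⟨i, hi⟩ := exists_goodColumn_of_ne_zero hb hne y⁻¹
    exact he (.inr i) hi
  refine ⟨h1, h2, ?_⟩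
  by_contra hne
  obtain ⟨i, hi⟩ := exists_goodColumn_of_ne_one hne
  exact he (.inl i) (by rw [h1]; exact hi)

theorem choose_zero_one : choose (0 : Fin n → ℕ) 0 1 = none := by
  unfold choose
  rw [dif_neg]
  rintro ⟨p, hp⟩
  cases p with
  | inl k =>
    obtain ⟨h1, h2⟩ := hp
    rcases h2 with h2 | ⟨-, h2⟩
    · simp at h2
    · exact absurd (lt_succ_of_ne_last h1) (not_lt.2 h2.le)
  | inr k =>
    obtain ⟨h1, h2⟩ := hp
    rcases h2 with h2 | ⟨-, h2⟩
    · simp at h2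
    · exact absurd (lt_succ_of_ne_last h1) (not_lt.2 h2.le)

open Classical in
/-- The total multiplicity outside the strip. -/
noncomputable def outside (p : Strip n) (c : Chain n) : ℕ :=
  ∑ i, ∑ j, if p.Contains i j then 0 else c i j

theorem outside_add (c d : Chain n) : p.outside (c + d) = p.outside c + p.outside d := by
  simp only [outside, ← Finset.sum_add_distrib]
  refine Finset.sum_congr rfl fun i _ => Finset.sum_congr rfl fun j _ => ?_
  split_ifs <;> rfl

theorem outside_eq_zero {c : Chain n} :
    p.outside c = 0 ↔ ∀ i j, c i j ≠ 0 → p.Contains i j := by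
  simp only [outside, Finset.sum_eq_zero_iff, Finset.mem_univ, true_implies]
  refine forall_congr' fun i => forall_congr' fun j => ?_
  split_ifs with h
  · simp [h]
  · simp [h]

end Strip

end Pivot

/-! ### The pairing of domains along the pivot -/

namespace PosDomain

variable {n : ℕ} [NeZero n] {G : GridDiagram n}

/-- This is where the position of the last `X` is used: the multiplicities along the last row and
column vanish at the last index, as `Strip.eq_of_choose_eq_none` requires. -/
theorem corner_eq_zero (D : PosDomain G) : D.coeff (last n) (last n) = 0 := by
  have := D.avoids
  rwa [G.xCol_last, G.xRow_last] at this

/-- The strip used to pair the domain with another one. -/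
noncomputable def pivot (D : PosDomain G) : Option (Strip n) :=
  Strip.choose (fun i => D.coeff i (last n)) (fun j => D.coeff (last n) j) D.tgt

theorem good_of_pivot {D : PosDomain G} {p : Strip n} (h : D.pivot = some p) :
    p.Good (fun i => D.coeff i (last n)) (fun j => D.coeff (last n) j) D.tgt :=
  Strip.good_of_choose h

/-- Without a suitable strip the last row and column are empty and the final generator is the
identity, which leaves only the zero domain. -/
theorem pivot_eq_none {D : PosDomain G} :
    D.pivot = none ↔ D.src = 1 ∧ D.tgt = 1 ∧ D.coeff = 0 := by
  constructor
  · intro h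
    obtain ⟨h1, h2, h3⟩ := Strip.eq_of_choose_eq_none
      (a := fun i => D.coeff i (last n)) D.corner_eq_zero D.corner_eq_zero h
    have h4 : D.coeff = 0 := by
      refine eq_zero_of_edge_eq_zero (h3 ▸ D.connects) ?_
      simp only [edge, congrFun h1, congrFun h2]
      simp
    exact ⟨(src_eq_tgt_of_coeff h4).trans h3, h3, h4⟩
  · rintro ⟨h1, h2, h3⟩
    rw [pivot, h2, h3]
    exact Strip.choose_zero_one

/-- The pivot sees only the last row, the last column and the final generator. Removing an initial
factor that avoids the last row and column preserves all three. -/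
theorem pivot_eq_of {D E : PosDomain G} (h1 : D.tgt = E.tgt) {c : Chain n} (hc : edge c = 0)
    (h2 : c + E.coeff = D.coeff) : E.pivot = D.pivot := by
  obtain ⟨e1, e2⟩ := edge_eq_zero hc
  rw [pivot, pivot, h1, ← h2]
  simp [e1, e2]

theorem IsComp.edge_eq {R E D : PosDomain G} (h : IsComp R E D) :
    edge D.coeff = edge R.coeff + edge E.coeff := by
  rw [← h.2.2.2, edge_add]

/-- Taking out a final rectangle decreases the pair `(edge, invWeight)`. -/
theorem IsComp.lt_of_snd {R E D : PosDomain G} (h : IsComp E R D) (hR : R.mu = 1) :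
    edge E.coeff < edge D.coeff ∨
      (edge E.coeff = edge D.coeff ∧ invWeight E.tgt < invWeight D.tgt) := by
  have he := h.edge_eq
  by_cases h0 : edge R.coeff = 0
  · right
    refine ⟨by omega, ?_⟩
    obtain ⟨a, b, hab, ht, hc, -⟩ := exists_rect hR
    rw [hc] at h0
    obtain ⟨h1, h2⟩ := lt_of_edge_rect h0
    rw [← h.2.2.1, ht, h.2.1]
    exact invWeight_lt h1 h2
  · left; omega

/-- Taking out an initial rectangle decreases `edge` or the multiplicity outside the pivot strip,
unless the rectangle is the one in that strip. -/
theorem IsComp.lt_of_fst {R E D : PosDomain G} (h : IsComp R E D) (hR : R.mu = 1) :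
    edge E.coeff < edge D.coeff ∨
    (edge E.coeff = edge D.coeff ∧ E.tgt = D.tgt ∧ ∃ p, D.pivot = some p ∧ E.pivot = some p ∧
      (p.outside E.coeff < p.outside D.coeff ∨
        (p.Ascent D.src ∧ R.tgt = p.flip D.src ∧
          R.coeff = rect D.src (p.fst D.src) (p.snd D.src)))) := by
  have he := h.edge_eq
  by_cases h0 : edge R.coeff = 0
  · right
    refine ⟨by omega, h.2.2.1, ?_⟩
    have hpe := pivot_eq_of h.2.2.1.symm h0 h.2.2.2
    rcases hp : D.pivot with _ | p
    · have := (mu_ne_one_of_isComp h (pivot_eq_none.1 hp).2.2).1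
      omega
    refine ⟨p, rfl, hpe.trans hp, ?_⟩
    have ho : p.outside D.coeff = p.outside R.coeff + p.outside E.coeff := by
      rw [← h.2.2.2, Strip.outside_add]
    by_cases ho0 : p.outside R.coeff = 0
    · right
      obtain ⟨a, b, hab, ht, hc, -⟩ := exists_rect hR
      rw [hc] at h0 ho0
      obtain ⟨h1, h2⟩ := lt_of_edge_rect h0
      obtain ⟨k1, rfl, rfl⟩ := Strip.eq_of_rect_contains (good_of_pivot hp).inner h1 h2
        (Strip.outside_eq_zero.1 ho0)
      rw [h.1] at *
      exact ⟨k1, ht, hc⟩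
    · left; omega
  · left; omega

theorem edge_lt_of_mem_remove {D E : PosDomain G} {c : Chain n} (h : E ∈ D.remove c)
    (hc : 1 ≤ edge c) : edge E.coeff < edge D.coeff := by
  rw [mem_remove] at h
  rw [← h.2.2, edge_add]
  omega

/-- The upper domain of a pair with the given pivot strip splits off a rectangle in the strip. -/
theorem exists_isComp_of_ascent {D : PosDomain G} {p : Strip n} (hp : D.pivot = some p)
    (ha : p.Ascent D.src) : ∃ R E : PosDomain G, R.mu = 1 ∧ IsComp R E D ∧
      R.tgt = p.flip D.src ∧ R.coeff = rect D.src (p.fst D.src) (p.snd D.src) := by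
  have hg := good_of_pivot hp
  have hne := hg.inner.fst_ne_snd (x := D.src)
  obtain ⟨R, E, h, ht, hc⟩ := D.exists_isComp_of_le (connects_rect D.src hne)
    (Strip.rect_le_of_good D.connects hg ha)
  refine ⟨R, E, ?_, h, ht, hc⟩
  refine mu_eq_one_of_rect (a := p.fst D.src) (b := p.snd D.src) hne (by rw [ht, h.1])
    (by rw [hc, h.1]) fun i h1 h2 => ?_
  rw [h.1]
  exact Strip.rect_apply_eq_zero hg.inner h1

/-- To a domain without ascent in its pivot strip a rectangle can be added. -/
theorem exists_isComp_of_not_ascent {E : PosDomain G} {p : Strip n} (hp : E.pivot = some p)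
    (ha : ¬ p.Ascent E.src) : ∃ R D : PosDomain G, R.mu = 1 ∧ IsComp R E D ∧ D.pivot = some p ∧
      D.src = p.flip E.src ∧ p.Ascent D.src ∧
      R.coeff = rect D.src (p.fst D.src) (p.snd D.src) := by
  have hg := good_of_pivot hp
  set x := p.flip E.src with hx
  have hax : p.Ascent x := (Strip.ascent_flip hg.inner).2 ha
  have hlt := hax.lt hg.inner
  have hne := hg.inner.fst_ne_snd (x := x)
  have hxE : E.src = x * Equiv.swap (p.fst x) (p.snd x) := (Strip.flip_flip (p := p)).symm
  have hz : edge (rect x (p.fst x) (p.snd x)) = 0 := edge_rect hlt.1 hlt.2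
  let R : PosDomain G := ⟨x, E.src, rect x (p.fst x) (p.snd x),
    hxE ▸ connects_rect x hne, by
      rw [G.xCol_last]
      exact (edge_eq_zero hz).2 _⟩
  have hR : R.mu = 1 := mu_eq_one_of_rect (a := p.fst x) (b := p.snd x) hne hxE rfl
    fun i h1 h2 => Strip.rect_apply_eq_zero hg.inner h1
  have hcomp := isComp_comp R E rfl
  refine ⟨R, R.comp E rfl, hR, hcomp, ?_, rfl, hax, rfl⟩
  rw [← hp]
  exact (pivot_eq_of hcomp.2.2.1.symm hz hcomp.2.2.2).symm

end PosDomain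

/-! ### Acyclic matchings -/

section Matching

variable {ι L : Type} [LinearOrder L] [WellFoundedLT L]

/-- An acyclic matching: every generator is critical, the lower element, or the upper element of a
matched pair; the differential of an upper element is a unit times the lower element, up to terms
of smaller rank, and the differential of a lower element has smaller rank. A chain whose
differential is critical is then a boundary up to a critical chain. -/
theorem exists_sub_mem_supported_of_matching (ρ : ι → L) (deg : ι → ℕ) (δ : Module.End ℤ (ι →₀ ℤ))
    (crit : ι → Prop) (M : ι → ι → Prop)
    (hcrit : ∀ g, crit g → δ (Finsupp.single g 1) = 0)
    (hsq : ∀ c, δ (δ c) = 0)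
    (hdeg : ∀ k, ∀ c ∈ Finsupp.supported ℤ ℤ {g | deg g = k + 1},
      δ c ∈ Finsupp.supported ℤ ℤ {g | deg g = k})
    (hcases : ∀ g, crit g ∨ (∃ g', M g g') ∨ ∃ g', M g' g)
    (hfun : ∀ g g' g'', M g g' → M g g'' → g' = g'')
    (hexcl : ∀ g g', M g g' → ¬ crit g ∧ ∀ g'', ¬ M g' g'')
    (hlow : ∀ g g', M g g' → δ (Finsupp.single g 1) ∈ Finsupp.supported ℤ ℤ {h | ρ h < ρ g})
    (hup : ∀ g g', M g g' → ρ g' = ρ g ∧ deg g' = deg g + 1 ∧ ∃ e : ℤˣ,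
      δ (Finsupp.single g' 1) - (e : ℤ) • Finsupp.single g 1 ∈
        Finsupp.supported ℤ ℤ {h | ρ h < ρ g})
    (k : ℕ) (z : ι →₀ ℤ) (hz : z ∈ Finsupp.supported ℤ ℤ {g | deg g = k})
    (hδ : δ z ∈ Finsupp.supported ℤ ℤ {g | crit g}) :
    ∃ w ∈ Finsupp.supported ℤ ℤ {g | deg g = k + 1},
      z - δ w ∈ Finsupp.supported ℤ ℤ {g | crit g} := by
  classical
  choose e he using fun g g' (h : M g g') => (hup g g' h).2.2
  let η : Module.End ℤ (ι →₀ ℤ) := ofBasis fun g =>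
    if h : ∃ g', M g g' then (e g h.choose h.choose_spec : ℤ) • Finsupp.single h.choose 1 else 0
  have η_pair : ∀ g g' (h : M g g'),
      η (Finsupp.single g 1) = (e g g' h : ℤ) • Finsupp.single g' 1 := by
    intro g g' h
    have hex : ∃ g', M g g' := ⟨g', h⟩
    have := hfun g _ _ hex.choose_spec h
    simp only [η, ofBasis_single]
    rw [dif_pos hex]
    have aux : ∀ g'' (h'' : M g g''), g'' = g' → (e g g'' h'' : ℤ) • Finsupp.single g'' (1 : ℤ) =
        (e g g' h : ℤ) • Finsupp.single g' 1 := by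
      rintro _ _ rfl
      rfl
    exact aux _ hex.choose_spec this
  have η_zero : ∀ g, (∀ g', ¬ M g g') → η (Finsupp.single g 1) = 0 := by
    intro g h
    simp only [η, ofBasis_single]
    rw [dif_neg (not_exists.2 h)]
  have crit_low : ∀ g, crit g → ∀ g', ¬ M g g' := fun g hg g' h => (hexcl g g' h).1 hg
  have η_rank : ∀ r : L, ∀ c ∈ Finsupp.supported ℤ ℤ {h | ρ h < r},
      η c ∈ Finsupp.supported ℤ ℤ {h | ρ h < r} := by
    intro r c hc
    refine map_supported η (fun g hg => ?_) hc
    by_cases h : ∃ g', M g g'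
    · obtain ⟨g', h⟩ := h
      rw [η_pair g g' h]
      refine Submodule.smul_mem _ _ (Finsupp.single_mem_supported _ _ ?_)
      show ρ g' < r
      rw [(hup g g' h).1]
      exact hg
    · rw [η_zero g (not_exists.1 h)]
      exact Submodule.zero_mem _
  have η_deg : ∀ c ∈ Finsupp.supported ℤ ℤ {g | deg g = k},
      η c ∈ Finsupp.supported ℤ ℤ {g | deg g = k + 1} := by
    intro c hc
    refine map_supported η (fun g hg => ?_) hc
    by_cases h : ∃ g', M g g'
    · obtain ⟨g', h⟩ := h
      rw [η_pair g g' h]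
      refine Submodule.smul_mem _ _ (Finsupp.single_mem_supported _ _ ?_)
      show deg g' = k + 1
      rw [(hup g g' h).2.1, show deg g = k from hg]
    · rw [η_zero g (not_exists.1 h)]
      exact Submodule.zero_mem _
  have η_crit : ∀ c ∈ Finsupp.supported ℤ ℤ {g | crit g}, η c = 0 := by
    intro c hc
    have := map_supported η (P := ⊥) (fun g hg => ?_) hc
    · simpa using this
    · rw [Submodule.mem_bot]
      exact η_zero g (crit_low g hg)
  -- `Φ` is chain homotopic to the identity. Up to smaller rank, `δ η` reproduces a lower element
  -- and `η δ` an upper one, so `Φ` lowers the rank of every noncritical generator.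
  let Φ : Module.End ℤ (ι →₀ ℤ) := 1 - δ * η - η * δ
  have hΦ : ∀ g, ¬ crit g → Φ (Finsupp.single g 1) ∈ Finsupp.supported ℤ ℤ {h | ρ h < ρ g} := by
    intro g hg
    simp only [Φ, LinearMap.sub_apply, Module.End.mul_apply, Module.End.one_apply]
    have unit_sq : ∀ u : ℤˣ, (u : ℤ) * u = 1 := fun u => by
      rw [← Units.val_mul, Int.units_mul_self]; rfl
    rcases hcases g with h | ⟨g', h⟩ | ⟨g', h⟩
    · exact absurd h hg
    · rw [η_pair g g' h, map_smul]
      refine Submodule.sub_mem _ ?_ (η_rank _ _ (hlow g g' h))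
      have := Submodule.smul_mem _ (-(e g g' h : ℤ)) (he g g' h)
      rw [smul_sub, smul_smul, neg_mul, unit_sq] at this
      convert this using 1
      rw [neg_smul, neg_smul, one_smul]; abel
    · rw [η_zero g (hexcl g' g h).2, map_zero, sub_zero]
      have := η_rank _ _ (he g' g h)
      rw [map_sub, map_smul, η_pair g' g h, smul_smul, unit_sq, one_smul] at this
      rw [(hup g' g h).1, ← Submodule.neg_mem_iff, neg_sub]
      exact this
  have hΦ_crit : ∀ g, crit g → Φ (Finsupp.single g 1) = Finsupp.single g 1 := by
    intro g hg
    simp only [Φ, LinearMap.sub_apply, Module.End.mul_apply, Module.End.one_apply]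
    rw [hcrit g hg, η_zero g (crit_low g hg)]
    simp
  have main : ∀ r : L, ∀ z ∈ Finsupp.supported ℤ ℤ {g | crit g ∨ ρ g ≤ r},
      z ∈ Finsupp.supported ℤ ℤ {g | deg g = k} →
      δ z ∈ Finsupp.supported ℤ ℤ {g | crit g} →
      ∃ w ∈ Finsupp.supported ℤ ℤ {g | deg g = k + 1},
        z - δ w ∈ Finsupp.supported ℤ ℤ {g | crit g} := by
    intro r
    induction r using WellFoundedLT.induction with
    | ind r ih =>
    intro z hr hz hδ
    -- Since `δ z` is critical it is killed by `η`; thus `Φ` changes `z` by a boundary only.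
    have hzΦ : Φ z = z - δ (η z) := by
      simp only [Φ, LinearMap.sub_apply, Module.End.mul_apply, Module.End.one_apply]
      rw [η_crit _ hδ, sub_zero]
    have hη := η_deg z hz
    set z' := z - δ (η z) with hz'
    have hlt : z' ∈ Finsupp.supported ℤ ℤ {g | crit g ∨ ρ g < r} := by
      rw [← hzΦ]
      refine map_supported Φ (fun g hg => ?_) hr
      by_cases hc : crit g
      · rw [hΦ_crit g hc]
        exact Finsupp.single_mem_supported _ _ (Or.inl hc)
      · refine Finsupp.supported_mono (fun h hh => Or.inr ?_) (hΦ g hc)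
        exact lt_of_lt_of_le hh (hg.resolve_left hc)
    have hdeg' : z' ∈ Finsupp.supported ℤ ℤ {g | deg g = k} :=
      Submodule.sub_mem _ hz (hdeg k _ hη)
    have hδ' : δ z' ∈ Finsupp.supported ℤ ℤ {g | crit g} := by
      rw [hz', map_sub, hsq, sub_zero]; exact hδ
    rcases (z'.support.filter fun g => ¬ crit g).eq_empty_or_nonempty with hemp | hne
    · refine ⟨η z, hη, (Finsupp.mem_supported _ _).2 fun g hg => ?_⟩
      by_contra hc
      exact Finset.notMem_empty g (hemp ▸ Finset.mem_filter.2 ⟨hg, hc⟩)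
    -- The largest rank of a noncritical generator in `z'` is the new bound, and it is smaller than
    -- `r`.
    · obtain ⟨g₀, hg₀, hmax⟩ := Finset.exists_max_image _ ρ hne
      rw [Finset.mem_filter] at hg₀
      have hr₀ : ρ g₀ < r := ((Finsupp.mem_supported _ _).1 hlt hg₀.1).resolve_left hg₀.2
      obtain ⟨w, hw, hw'⟩ := ih (ρ g₀) hr₀ z' ((Finsupp.mem_supported _ _).2 fun g hg => by
        by_cases hc : crit g
        · exact Or.inl hc
        · exact Or.inr (hmax g (Finset.mem_filter.2 ⟨hg, hc⟩))) hdeg' hδ'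
      refine ⟨η z + w, Submodule.add_mem _ hη hw, ?_⟩
      rw [map_add, ← sub_sub]
      exact hw'
  rcases (z.support.filter fun g => ¬ crit g).eq_empty_or_nonempty with hemp | hne
  · refine ⟨0, Submodule.zero_mem _, (Finsupp.mem_supported _ _).2 fun g hg => ?_⟩
    rw [map_zero, sub_zero] at hg
    by_contra hc
    exact Finset.notMem_empty g (hemp ▸ Finset.mem_filter.2 ⟨hg, hc⟩)
  · obtain ⟨g₀, hg₀, hmax⟩ := Finset.exists_max_image _ ρ hne
    refine main (ρ g₀) z ((Finsupp.mem_supported _ _).2 fun g hg => ?_) hz hδ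
    by_cases hc : crit g
    · exact Or.inl hc
    · exact Or.inr (hmax g (Finset.mem_filter.2 ⟨hg, hc⟩))

end Matching

/-! ### Sizes of partitions and the first partition of a number bigger than one -/

section Partitions

theorem size_cons (a : ℕ+) (l : OrdPart) : size (a :: l) = a + size l := by simp [size]

theorem size_coarsen (l : OrdPart) (k : ℕ) : size (coarsen l k) = size l := by
  induction l generalizing k with
  | nil => cases k <;> rfl
  | cons a l ih =>
    cases k with
    | zero =>
      cases l with
      | nil => rfl
      | cons b l => simp only [coarsen, size_cons, PNat.add_coe]; ring
    | succ k =>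
      have : coarsen (a :: l) (k + 1) = a :: coarsen l k := by cases l <;> simp [coarsen]
      rw [this, size_cons, size_cons, ih]

theorem size_tail_lt {l : OrdPart} (h : l ≠ []) : size l.tail < size l := by
  cases l with
  | nil => exact absurd rfl h
  | cons a l =>
    have := a.pos
    rw [List.tail_cons, size_cons]; omega

theorem size_dropLast_lt {l : OrdPart} (h : l ≠ []) : size l.dropLast < size l := by
  have h1 := congrArg size (List.dropLast_append_getLast h)
  have h2 : size (l.dropLast ++ [l.getLast h]) = size l.dropLast + (l.getLast h : ℕ) := by
    simp [size]
  have := (l.getLast h).pos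
  omega

variable {n : ℕ} [NeZero n]

theorem sum_update_add (f : OrdPart → ℕ) (lam : Fin n → OrdPart) (j : Fin n) (l : OrdPart) :
    ∑ i, f (Function.update lam j l i) + f (lam j) = ∑ i, f (lam i) + f l := by
  rw [← Finset.add_sum_erase _ _ (Finset.mem_univ j), ← Finset.add_sum_erase univ
    (fun i => f (lam i)) (Finset.mem_univ j), Function.update_self]
  have : ∑ i ∈ univ.erase j, f (Function.update lam j l i) = ∑ i ∈ univ.erase j, f (lam i) :=
    Finset.sum_congr rfl fun i hi => by rw [Function.update_of_ne (Finset.ne_of_mem_erase hi)]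
  rw [this]; ring

/-- The `j`-th partition is the first one of a number bigger than one. -/
def IsFirst (lam : Fin n → OrdPart) (j : Fin n) : Prop :=
  2 ≤ size (lam j) ∧ ∀ k < j, size (lam k) ≤ 1

/-- The first partition of a number bigger than one begins with the part one. -/
def HeadOne (lam : Fin n → OrdPart) : Prop :=
  ∃ j, IsFirst lam j ∧ (lam j).head? = some 1

theorem IsFirst.unique {lam : Fin n → OrdPart} {j k : Fin n} (hj : IsFirst lam j)
    (hk : IsFirst lam k) : j = k := by
  rcases lt_trichotomy j k with h | h | h
  · have h1 := hk.2 j h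
    have h2 := hj.1
    omega
  · exact h
  · have h1 := hj.2 k h
    have h2 := hk.1
    omega

theorem IsFirst.congr {lam mu : Fin n → OrdPart} {j : Fin n} (hj : IsFirst lam j)
    (h : ∀ i, size (mu i) = size (lam i)) : IsFirst mu j :=
  ⟨by rw [h]; exact hj.1, fun k hk => by rw [h]; exact hj.2 k hk⟩

theorem size_update {lam : Fin n → OrdPart} {j : Fin n} {l : OrdPart} (h : size l = size (lam j))
    (i : Fin n) : size (Function.update lam j l i) = size (lam i) := by
  by_cases hij : i = j
  · subst hij; rw [Function.update_self, h]
  · rw [Function.update_of_ne hij]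

theorem exists_isFirst {lam : Fin n → OrdPart} (h : ∃ j, 2 ≤ size (lam j)) :
    ∃ j, IsFirst lam j := by
  obtain ⟨j, hj⟩ := h
  obtain ⟨i, hi, hmin⟩ := Finset.exists_min_image (univ.filter fun i => 2 ≤ size (lam i)) id
    ⟨j, by simpa using hj⟩
  rw [Finset.mem_filter] at hi
  refine ⟨i, hi.2, fun k hk => ?_⟩
  by_contra hc
  have : i ≤ k := hmin k (by rw [Finset.mem_filter]; exact ⟨Finset.mem_univ _, by omega⟩)
  exact absurd hk (not_lt.2 this)

end Partitions

/-! ### The rank and the matching -/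

section Rank

variable {n : ℕ} [NeZero n] {G : GridDiagram n}

open PosDomain

/-- The multiplicity outside the pivot strip. -/
noncomputable def outsidePivot (D : PosDomain G) : ℕ :=
  D.pivot.elim 0 fun p => p.outside D.coeff

theorem outsidePivot_eq {D : PosDomain G} {p : Strip n} (h : D.pivot = some p) :
    outsidePivot D = p.outside D.coeff := by
  rw [outsidePivot, h]; rfl

open Classical in
/-- The total length of the partitions, corrected for the trivial domain so that matched
generators have the same value. -/
noncomputable def lengthRank (g : Gen G) : ℕ :=
  ∑ j, (g.2 j).length + if g.1.pivot = none ∧ ¬ HeadOne g.2 then 1 else 0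

/-- The order used in the matching argument. -/
noncomputable def rank (g : Gen G) : ℕ ×ₗ ℕ ×ₗ ℕ ×ₗ ℕ ×ₗ ℕ :=
  -- Annuli lower the first entry. A final rectangle lowers the first or else the second, and an
  -- initial one the first or else the third, unless it is the matched one. Removing a part lowers
  -- the fourth entry. An unmatched coarsening lowers the fifth.
  toLex (edge g.1.coeff, toLex (invWeight g.1.tgt, toLex (outsidePivot g.1,
    toLex (∑ j, size (g.2 j), lengthRank g))))

theorem rank_lt_iff (g h : Gen G) : rank h < rank g ↔
    edge h.1.coeff < edge g.1.coeff ∨ edge h.1.coeff = edge g.1.coeff ∧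
    (invWeight h.1.tgt < invWeight g.1.tgt ∨ invWeight h.1.tgt = invWeight g.1.tgt ∧
    (outsidePivot h.1 < outsidePivot g.1 ∨ outsidePivot h.1 = outsidePivot g.1 ∧
    (∑ j, size (h.2 j) < ∑ j, size (g.2 j) ∨ ∑ j, size (h.2 j) = ∑ j, size (g.2 j) ∧
      lengthRank h < lengthRank g))) := by
  simp only [rank, Prod.Lex.toLex_lt_toLex]

/-- The matching: `lo` is obtained from `hi` by taking out the rectangle in the pivot strip or, for
the trivial domain, by merging an initial part one with its successor. -/
inductive Matched : Gen G → Gen G → Prop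
  | domain (lo hi R : PosDomain G) (lam : Fin n → OrdPart) (p : Strip n)
      (hlo : lo.pivot = some p) (hhi : hi.pivot = some p) (hsrc : hi.src = p.flip lo.src)
      (ha : p.Ascent hi.src) (hR : R.mu = 1) (h : IsComp R lo hi)
      (hc : R.coeff = rect hi.src (p.fst hi.src) (p.snd hi.src)) :
      Matched (lo, lam) (hi, lam)
  | partition (D : PosDomain G) (lam : Fin n → OrdPart) (j : Fin n) (a : ℕ+) (l : OrdPart)
      (hD : D.pivot = none) (hj : IsFirst lam j) (hl : lam j = (a + 1) :: l) :
      Matched (D, lam) (D, Function.update lam j (1 :: a :: l))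

theorem pivot_eq_none_of_isDagger {g : Gen G} (h : IsDagger g) : g.1.pivot = none :=
  pivot_eq_none.2 ⟨h.1, h.2.1, h.2.2.1⟩

theorem size_one_cons (a : ℕ+) (l : OrdPart) : size (1 :: a :: l) = size ((a + 1) :: l) := by
  simp only [size_cons, PNat.add_coe]; ring

theorem Matched.upper_unique {g g' g'' : Gen G} (h : Matched g g') (h' : Matched g g'') :
    g' = g'' := by
  cases h with
  | domain lo hi R lam p hlo hhi hsrc ha hR h hc =>
    cases h' with
    | domain _ hi' R' _ p' hlo' hhi' hsrc' ha' hR' h' hc' =>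
      obtain rfl : p = p' := Option.some_injective _ (hlo.symm.trans hlo')
      have : hi = hi' := by
        have e := hsrc.trans hsrc'.symm
        refine PosDomain.ext e (h.2.2.1.symm.trans h'.2.2.1) ?_
        rw [← h.2.2.2, ← h'.2.2.2, hc, hc', e]
      rw [this]
    | partition _ _ j a l hD hj hl => rw [hlo] at hD; cases hD
  | partition D lam j a l hD hj hl =>
    cases h' with
    | domain _ hi' R' _ p' hlo' hhi' hsrc' ha' hR' h' hc' => rw [hlo'] at hD; cases hD
    | partition _ _ j' a' l' hD' hj' hl' =>
      obtain rfl := hj.unique hj'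
      rw [hl] at hl'
      obtain ⟨h1, rfl⟩ := List.cons_eq_cons.1 hl'
      obtain rfl := add_right_cancel h1
      rfl

theorem Matched.lower_unique {g g' g'' : Gen G} (h : Matched g g'') (h' : Matched g' g'') :
    g = g' := by
  cases h with
  | domain lo hi R lam p hlo hhi hsrc ha hR h hc =>
    cases h' with
    | domain lo' _ R' _ p' hlo' hhi' hsrc' ha' hR' h' hc' =>
      obtain rfl : p = p' := Option.some_injective _ (hhi.symm.trans hhi')
      have e : lo.src = lo'.src := by
        rw [← Strip.flip_flip (p := p) (x := lo.src), ← hsrc, hsrc', Strip.flip_flip]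
      have : R = R' := PosDomain.ext (h.1.trans h'.1.symm)
        (h.2.1.trans (e.trans h'.2.1.symm)) (hc.trans hc'.symm)
      subst this
      rw [h.ext_of_fst h']
    | partition _ _ j a l hD hj hl => rw [hhi] at hD; cases hD
  | partition D lam j a l hD hj hl =>
    generalize hmu : Function.update lam j (1 :: a :: l) = mu at h'
    cases h' with
    | domain lo' _ R' _ p' hlo' hhi' hsrc' ha' hR' h' hc' => rw [hhi'] at hD; cases hD
    | partition _ lam' j' a' l' hD' hj' hl' =>
      have k1 := hj.congr (size_update (lam := lam) (j := j) (l := 1 :: a :: l)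
        (by rw [hl, size_one_cons]))
      have k2 := hj'.congr (size_update (lam := lam') (j := j') (l := 1 :: a' :: l')
        (by rw [hl', size_one_cons]))
      rw [hmu] at k1
      obtain rfl := k1.unique k2
      have k3 := congrFun hmu j
      simp only [Function.update_self, List.cons.injEq, true_and] at k3
      obtain ⟨rfl, rfl⟩ := k3
      have : lam = lam' := by
        funext i
        by_cases hij : i = j
        · rw [hij, hl, hl']
        · have := congrFun hmu i
          rwa [Function.update_of_ne hij, Function.update_of_ne hij] at this
      rw [this]

theorem Matched.not_isDagger {g g' : Gen G} (h : Matched g g') : ¬ IsDagger g := by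
  intro hd
  have hp := pivot_eq_none_of_isDagger hd
  cases h with
  | domain lo hi R lam p hlo hhi hsrc ha hR h hc => rw [hlo] at hp; cases hp
  | partition D lam j a l hD hj hl =>
    have h1 := hd.2.2.2 j
    have h2 := hj.1
    simp only at h1
    omega

theorem Matched.upper_not_lower {g g' g'' : Gen G} (h : Matched g g') : ¬ Matched g' g'' := by
  intro h'
  cases h with
  | domain lo hi R lam p hlo hhi hsrc ha hR h hc =>
    cases h' with
    | domain _ hi' R' _ p' hlo' hhi' hsrc' ha' hR' h' hc' =>
      obtain rfl : p = p' := Option.some_injective _ (hhi.symm.trans hlo')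
      rw [hsrc'] at ha'
      exact (Strip.ascent_flip (good_of_pivot hhi).inner).1 ha' ha
    | partition _ _ j a l hD hj hl => rw [hhi] at hD; cases hD
  | partition D lam j a l hD hj hl =>
    generalize hmu : Function.update lam j (1 :: a :: l) = mu at h'
    cases h' with
    | domain _ hi' R' _ p' hlo' hhi' hsrc' ha' hR' h' hc' => rw [hlo'] at hD; cases hD
    | partition _ _ j' a' l' hD' hj' hl' =>
      have k1 := hj.congr (size_update (lam := lam) (j := j) (l := 1 :: a :: l)
        (by rw [hl, size_one_cons]))
      rw [hmu] at k1
      obtain rfl := k1.unique hj'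
      rw [← hmu, Function.update_self] at hl'
      have h1 := (List.cons_eq_cons.1 hl').1
      exact absurd h1.symm (PNat.lt_add_left 1 a').ne'

/-- With a pivot, ascent or its absence decides between upper and lower element. Without one, the
first partition of a number bigger than one decides: it is upper if its first part is one, and lower
otherwise. If there is no such partition, the generator is critical. -/
theorem isDagger_or_matched (g : Gen G) :
    IsDagger g ∨ (∃ g', Matched g g') ∨ ∃ g', Matched g' g := by
  obtain ⟨D, lam⟩ := g
  rcases hp : D.pivot with _ | p
  · by_cases hs : ∃ j, 2 ≤ size (lam j)
    · right
      obtain ⟨j, hj⟩ := exists_isFirst hs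
      rcases hl : lam j with _ | ⟨b, l⟩
      · have := hj.1
        rw [hl] at this
        simp [size] at this
      by_cases hb : b = 1
      · right
        subst hb
        rcases l with _ | ⟨a, l⟩
        · have := hj.1
          rw [hl] at this
          simp [size] at this
        · have hsz : size ((a + 1) :: l) = size (lam j) := by rw [hl, size_one_cons]
          have := Matched.partition D (Function.update lam j ((a + 1) :: l)) j a l hp
            (hj.congr (size_update hsz)) (Function.update_self _ _ _)
          rw [Function.update_idem, ← hl, Function.update_eq_self] at this
          exact ⟨_, this⟩
      · left
        obtain ⟨a, rfl⟩ := PNat.exists_eq_succ_of_ne_one hb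
        exact ⟨_, Matched.partition D lam j a l hp hj hl⟩
    · left
      push Not at hs
      obtain ⟨h1, h2, h3⟩ := pivot_eq_none.1 hp
      exact ⟨h1, h2, h3, fun j => by have := hs j; simp only; omega⟩
  · right
    by_cases ha : p.Ascent D.src
    · right
      obtain ⟨R, E, hR, h, ht, hc⟩ := exists_isComp_of_ascent hp ha
      have hlt := ha.lt (good_of_pivot hp).inner
      refine ⟨(E, lam), Matched.domain E D R lam p ?_ hp ?_ ha hR h hc⟩
      · rw [← hp]
        exact pivot_eq_of h.2.2.1.symm (hc ▸ edge_rect hlt.1 hlt.2) h.2.2.2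
      · rw [← h.2.1, ht, Strip.flip_flip]
    · left
      obtain ⟨R, E, hR, h, hpE, hsrc, ha', hc⟩ := exists_isComp_of_not_ascent hp ha
      exact ⟨(E, lam), Matched.domain D E R lam p hp hpE hsrc ha' hR h hc⟩

theorem Below.rank_lt_or_matched {g h : Gen G} (hgh : Below g h) :
    rank h < rank g ∨ Matched h g := by
  rw [rank_lt_iff]
  cases hgh with
  | first R E hR h =>
    rcases h.lt_of_fst hR with h1 | ⟨h1, h2, p, hp, hpE, h3 | ⟨ha, ht, hc⟩⟩
    · exact Or.inl (Or.inl h1)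
    · refine Or.inl (Or.inr ⟨h1, Or.inr ⟨congrArg invWeight h2, Or.inl ?_⟩⟩)
      simp only
      rw [outsidePivot_eq hp, outsidePivot_eq hpE]
      exact h3
    · refine Or.inr (Matched.domain E g.1 R g.2 p hpE hp ?_ ha hR h hc)
      rw [← h.2.1, ht, Strip.flip_flip]
  | last E R hR h =>
    rcases h.lt_of_snd hR with h1 | ⟨h1, h2⟩
    · exact Or.inl (Or.inl h1)
    · exact Or.inl (Or.inr ⟨h1, Or.inl h2⟩)
  | row j E k h => exact Or.inl (Or.inl (edge_lt_of_mem_remove h (one_le_edge_rowChain _)))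
  | col j E k h => exact Or.inl (Or.inl (edge_lt_of_mem_remove h (one_le_edge_colChain _)))
  | tail j h =>
    refine Or.inl (Or.inr ⟨rfl, Or.inr ⟨rfl, Or.inr ⟨rfl, Or.inl ?_⟩⟩⟩)
    have h1 := sum_update_add size g.2 j (g.2 j).tail
    have h2 := size_tail_lt h
    simp only
    omega
  | dropLast j h =>
    refine Or.inl (Or.inr ⟨rfl, Or.inr ⟨rfl, Or.inr ⟨rfl, Or.inl ?_⟩⟩⟩)
    have h1 := sum_update_add size g.2 j (g.2 j).dropLast
    have h2 := size_dropLast_lt h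
    simp only
    omega
  | coarsen j k h =>
    have h1 := sum_update_add size g.2 j (GridCDP.coarsen (g.2 j) k)
    rw [size_coarsen] at h1
    have h2 := sum_length_update g.2 j (GridCDP.coarsen (g.2 j) k)
    have h3 := length_coarsen _ _ h
    set mu := Function.update g.2 j (GridCDP.coarsen (g.2 j) k) with hmu
    have hsz : ∀ i, size (mu i) = size (g.2 i) := size_update (size_coarsen _ _)
    -- A coarsening shortens the partitions by one, and the correction in `lengthRank` compensates
    -- only if the initial part one is lost. That happens only when this part is merged with its
    -- successor, which is the matched pair.
    by_cases hex : g.1.pivot = none ∧ HeadOne g.2 ∧ ¬ HeadOne mu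
    · obtain ⟨hp, ⟨i, hi, hh⟩, hn⟩ := hex
      right
      have hij : i = j := by
        by_contra hne
        refine hn ⟨i, hi.congr hsz, ?_⟩
        rw [hmu, Function.update_of_ne hne, hh]
      subst hij
      have hk : k = 0 := by
        by_contra hne
        obtain ⟨k, rfl⟩ := Nat.exists_eq_succ_of_ne_zero hne
        refine hn ⟨i, hi.congr hsz, ?_⟩
        rw [hmu, Function.update_self]
        rcases hl : g.2 i with _ | ⟨b, _ | ⟨c, l⟩⟩
        · rw [hl] at hh; cases hh
        · rw [hl] at hh; simpa [GridCDP.coarsen] using hh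
        · rw [hl] at hh; simpa [GridCDP.coarsen] using hh
      subst hk
      rcases hl : g.2 i with _ | ⟨b, _ | ⟨c, l⟩⟩
      · rw [hl] at hh; cases hh
      · rw [hl] at h; simp at h
      · rw [hl] at hh
        simp only [List.head?_cons, Option.some.injEq] at hh
        subst hh
        have hmi : mu i = (c + 1) :: l := by
          rw [hmu, Function.update_self, hl, GridCDP.coarsen, add_comm]
        have := Matched.partition g.1 mu i c l hp (hi.congr hsz) hmi
        rw [hmu, Function.update_idem, ← hl, Function.update_eq_self] at this
        exact this
    · refine Or.inl (Or.inr ⟨rfl, Or.inr ⟨rfl, Or.inr ⟨rfl, Or.inr ⟨by simp only; omega, ?_⟩⟩⟩⟩)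
      simp only [lengthRank]
      have : (g.1.pivot = none ∧ ¬ HeadOne mu) → (g.1.pivot = none ∧ ¬ HeadOne g.2) :=
        fun hm => ⟨hm.1, fun hg => hex ⟨hm.1, hg, hm.2⟩⟩
      split_ifs with c1 c2 c2
      · omega
      · exact absurd (this c1) c2
      · omega
      · omega

theorem Matched.rank_eq {g g' : Gen G} (h : Matched g g') : rank g' = rank g := by
  cases h with
  | domain lo hi R lam p hlo hhi hsrc ha hR h hc =>
    have hlt := ha.lt (good_of_pivot hhi).inner
    have h1 := h.edge_eq
    rw [hc, edge_rect hlt.1 hlt.2, zero_add] at h1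
    have h2 : p.outside hi.coeff = p.outside lo.coeff := by
      rw [← h.2.2.2, Strip.outside_add, hc, Strip.outside_eq_zero.2, zero_add]
      intro i j
      exact Strip.contains_of_rect_ne_zero (good_of_pivot hhi).inner
    simp only [rank, h1, h.2.2.1, outsidePivot_eq hlo, outsidePivot_eq hhi, h2, lengthRank]
    simp [hlo, hhi]
  | partition D lam j a l hD hj hl =>
    have h1 := sum_update_add size lam j (1 :: a :: l)
    have h2 := sum_length_update lam j (1 :: a :: l)
    have hs : size (1 :: a :: l) = size (lam j) := by rw [hl, size_one_cons]
    have h3 : HeadOne (Function.update lam j (1 :: a :: l)) :=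
      ⟨j, hj.congr (size_update hs), by rw [Function.update_self]; rfl⟩
    have h4 : ¬ HeadOne lam := by
      rintro ⟨i, hi, hh⟩
      obtain rfl := hi.unique hj
      rw [hl] at hh
      simp only [List.head?_cons, Option.some.injEq] at hh
      exact absurd hh.symm (PNat.lt_add_left 1 a).ne
    have h5 : ∑ i, size (Function.update lam j (1 :: a :: l) i) = ∑ i, size (lam i) := by omega
    have h6 : lengthRank (D, Function.update lam j (1 :: a :: l)) = lengthRank (D, lam) := by
      simp only [lengthRank]
      rw [if_neg (by simp [h3]), if_pos ⟨hD, h4⟩]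
      rw [hl] at h2
      simp only [List.length_cons] at h2
      omega
    simp only [rank, h5, h6]

theorem Matched.gr_eq {g g' : Gen G} (h : Matched g g') : gr g' = gr g + 1 := by
  cases h with
  | domain lo hi R lam p hlo hhi hsrc ha hR h hc =>
    have := h.mu_add
    simp only [gr]; omega
  | partition D lam j a l hD hj hl =>
    have h2 := sum_length_update lam j (1 :: a :: l)
    rw [hl] at h2
    simp only [List.length_cons] at h2
    simp only [gr]; omega

end Rank

/-! ### Matched pairs have incidence `±1` -/

section MatchedCoefficient

variable {n : ℕ} [NeZero n] {G : GridDiagram n}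

open PosDomain

theorem consOp_apply_of_ne {b c : ℕ+} (h : b ≠ c) (m : OrdPart →₀ ℤ) (l : OrdPart) :
    consOp b m (c :: l) = 0 := by
  induction m using Finsupp.induction_linear with
  | zero => simp
  | add m m' h h' => rw [map_add, Finsupp.add_apply, h, h', add_zero]
  | single l' r =>
    rw [← mul_one r, ← smul_eq_mul, ← Finsupp.smul_single, map_smul, consOp_single,
      Finsupp.smul_apply, Finsupp.single_eq_of_ne (by simp [Ne.symm h]), smul_zero]

/-- Only the merge of the first two parts contributes: removing the first part leaves a list
beginning with `a`, and the remaining terms begin with `1`. -/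
theorem barOp_coefficient (a : ℕ+) (l : OrdPart) :
    barOp (Finsupp.single (1 :: a :: l) 1) ((a + 1) :: l) = -1 := by
  have h1 : (1 : ℕ+) ≠ a + 1 := (PNat.lt_add_left 1 a).ne
  have h2 : a ≠ a + 1 := (PNat.lt_add_right a 1).ne
  rw [barOp, LinearMap.add_apply, tailOp_single_cons, mergeOp_single, mergeAux, bumpOp_single_cons,
    Finsupp.add_apply, Finsupp.sub_apply, Finsupp.neg_apply, consOp_apply_of_ne h1, add_comm 1 a,
    Finsupp.single_eq_same, Finsupp.single_eq_of_ne (by simp [Ne.symm h2])]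
  rfl

theorem apply_eq_zero_of_mem {A : Type*} {S : Set A} {m : A →₀ ℤ}
    (h : m ∈ Finsupp.supported ℤ ℤ S) {a : A} (ha : a ∉ S) : m a = 0 :=
  Finsupp.notMem_support_iff.1 fun h' => ha ((Finsupp.mem_supported _ _).1 h h')

/-- All terms that touch the partitions change their total length, so none of them can hit the
partner of a domain, which has the same partitions. -/
theorem annulus_bar_mem (g : Gen G) : deltaII g + deltaIII g + deltaIV g
    ∈ Finsupp.supported ℤ ℤ {h : Gen G | ∑ j, (h.2 j).length ≠ ∑ j, (g.2 j).length} := by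
  have hu : ∀ (E : PosDomain G) j l, l.length ≠ (g.2 j).length →
      Finsupp.single (E, Function.update g.2 j l) (1 : ℤ)
      ∈ Finsupp.supported ℤ ℤ {h : Gen G | ∑ j, (h.2 j).length ≠ ∑ j, (g.2 j).length} := by
    intro E j l hl
    refine Finsupp.single_mem_supported _ _ ?_
    have := sum_length_update g.2 j l
    simp only [Set.mem_ofPred_eq]
    omega
  refine Submodule.add_mem _ (Submodule.add_mem _ ?_ ?_) ?_
  · refine Submodule.smul_mem _ _ (Submodule.sum_mem _ fun j _ => Submodule.smul_mem _ _
      (Submodule.add_mem _ ?_ ?_)) <;>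
    · refine Submodule.sum_mem _ fun E hE => Submodule.sum_mem _ fun k _ =>
        Submodule.smul_mem _ _ (hu _ _ _ ?_)
      rw [length_unitEnlarge]; omega
  · refine Submodule.smul_mem _ _ (Submodule.sum_mem _ fun j _ => Submodule.smul_mem _ _
      (Submodule.sum_mem _ fun k hk => Submodule.smul_mem _ _ (hu _ _ _ ?_)))
    rw [Finset.mem_range] at hk
    have := length_coarsen (g.2 j) k (by omega)
    omega
  · refine Submodule.smul_mem _ _ (Submodule.sum_mem _ fun j _ => ?_)
    split_ifs with h
    · exact Submodule.zero_mem _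
    · have := List.length_pos_iff.2 h
      refine Submodule.add_mem _ (Submodule.smul_mem _ _ (hu _ _ _ ?_))
        (Submodule.smul_mem _ _ (hu _ _ _ ?_))
      · rw [List.length_tail]; omega
      · rw [List.length_dropLast]; omega

theorem Matched.exists_unit (s : SignAssignment G) {g g' : Gen G} (h : Matched g g') :
    ∃ e : ℤˣ, delta s (Finsupp.single g' 1) g = e := by
  cases h with
  | domain lo hi R lam p hlo hhi hsrc ha hR h hc =>
    refine ⟨s.sign ⟨R, hR⟩, ?_⟩
    rw [delta_single, add_assoc, add_assoc, Finsupp.add_apply, ← add_assoc,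
      apply_eq_zero_of_mem (annulus_bar_mem _) (by simp), add_zero, deltaI, Finsupp.add_apply,
      Finsupp.smul_apply, Finsupp.finsetSum_apply, Finsupp.finsetSum_apply,
      Finset.sum_eq_single (R, lo), Finset.sum_eq_zero]
    · simp [s.val_of_mu hR]
    -- Removing a final factor keeps the initial generator, which ascends across the pivot; that of
    -- `lo` does not.
    · rintro ⟨E, S⟩ hp
      have hcomp := mem_decompositions.1 hp
      rw [Finsupp.smul_apply, Finsupp.single_eq_of_ne, smul_zero]
      intro e
      have e1 : lo = E := congrArg Prod.fst e
      have e2 : p.Ascent lo.src := by rw [e1, hcomp.1]; exact ha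
      rw [hsrc, Strip.ascent_flip (good_of_pivot hlo).inner] at ha
      exact ha e2
    · rintro ⟨R', E⟩ hp hne
      have hcomp := mem_decompositions.1 hp
      rw [Finsupp.smul_apply, Finsupp.single_eq_of_ne, smul_zero]
      intro e
      have e1 : lo = E := congrArg Prod.fst e
      subst e1
      refine hne (Prod.ext ?_ rfl)
      exact PosDomain.ext (hcomp.1.trans h.1.symm) (hcomp.2.1.trans h.2.1.symm)
        (add_right_cancel (hcomp.2.2.2.trans h.2.2.2.symm))
    · intro hn
      exact absurd (mem_decompositions.2 h) hn
  | partition D lam j a l hD hj hl =>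
    have hc := (pivot_eq_none.1 hD).2.2
    set mu := Function.update lam j (1 :: a :: l) with hmu
    have hmj : mu j = 1 :: a :: l := Function.update_self _ _ _
    have hlam : lam = Function.update mu j ((a + 1) :: l) := by
      rw [hmu, Function.update_idem, ← hl, Function.update_eq_self]
    have hinj : Function.Injective fun l' : OrdPart => (D, Function.update mu j l') :=
      fun l₁ l₂ e => Function.update_injective mu j (congrArg Prod.snd e)
    have key : delta s (Finsupp.single (D, mu) 1) (D, lam)
        = (-1) ^ D.mu * (lenSign mu j * -1) := by
      rw [delta_single, deltaI_eq_zero s (g := (D, mu)) hc, deltaII_eq_zero (g := (D, mu)) hc,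
        add_assoc, deltaIII_add_deltaIV, zero_add, zero_add, Finsupp.smul_apply,
        Finsupp.finsetSum_apply, Finset.sum_eq_single j]
      · rw [onRight_atPlace_single, Finsupp.smul_apply, Finsupp.lmapDomain_apply, hlam]
        simp only
        rw [Finsupp.mapDomain_apply hinj, hmj, barOp_coefficient]
        rfl
      -- A change at another place leaves the entry at `j` with first part one, whereas the target
      -- begins with `a + 1` there.
      · intro j' _ hj'
        rw [onRight_atPlace_single, Finsupp.smul_apply, Finsupp.lmapDomain_apply,
          Finsupp.mapDomain_of_notMem_range, smul_zero]
        rintro ⟨l', e⟩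
        have e1 := congrFun (congrArg Prod.snd e) j
        simp only at e1
        rw [Function.update_of_ne (Ne.symm hj'), hmj, hl] at e1
        exact absurd (List.cons_eq_cons.1 e1).1 (PNat.lt_add_left 1 a).ne
      · intro hn
        exact absurd (Finset.mem_univ j) hn
    rw [key]
    refine ⟨(-1) ^ D.mu * ((-1) ^ (∑ i ∈ univ.filter (fun i => i < j), (mu i).length) * -1), ?_⟩
    simp [lenSign]

/-- A chain with boundary in `CDP†` is homologous to a chain in `CDP†`. -/
theorem exists_sub_mem_dagger (s : SignAssignment G) (k : ℕ) (z : Total G) (hz : z ∈ chains G k)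
    (hδ : delta s z ∈ Finsupp.supported ℤ ℤ {g : Gen G | IsDagger g}) :
    ∃ w ∈ chains G (k + 1), z - delta s w ∈ Finsupp.supported ℤ ℤ {g : Gen G | IsDagger g} := by
  refine exists_sub_mem_supported_of_matching rank gr (delta s) IsDagger Matched
    (fun g hg => delta_single_of_isDagger s hg) (fun c => (isDifferential s).sq_zero c)
    (fun k c hc => (isDifferential s).map_chains k c hc) isDagger_or_matched
    (fun g g' g'' h h' => h.upper_unique h')
    (fun g g' h => ⟨h.not_isDagger, fun g'' => h.upper_not_lower⟩) ?_ ?_ k z hz hδ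
  · intro g g' h
    refine Finsupp.supported_mono (fun h' hb => ?_) (delta_single_mem s g)
    exact (Below.rank_lt_or_matched hb).resolve_right fun hm => hm.upper_not_lower h
  · intro g g' h
    refine ⟨h.rank_eq, h.gr_eq, ?_⟩
    obtain ⟨e, he⟩ := h.exists_unit s
    refine ⟨e, (Finsupp.mem_supported _ _).2 fun h' hh' => ?_⟩
    have hh'' : (delta s (Finsupp.single g' (1 : ℤ)) -
        (e : ℤ) • Finsupp.single g (1 : ℤ) : Total G) h' ≠ 0 :=
      Finsupp.mem_support_iff.1 hh'
    rw [Finsupp.sub_apply, Finsupp.smul_apply] at hh''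
    have hne : h' ≠ g := by
      rintro rfl
      apply hh''
      rw [he]; simp
    rw [Finsupp.single_eq_of_ne hne, smul_zero, sub_zero] at hh''
    have hb : Below g' h' := (Finsupp.mem_supported _ _).1 (delta_single_mem s g')
      (Finsupp.mem_support_iff.2 hh'')
    show rank h' < rank g
    rw [← h.rank_eq]
    exact (Below.rank_lt_or_matched hb).resolve_right fun hm => hne (hm.lower_unique h)

end MatchedCoefficient

open CategoryTheory

/-! ### The quotient complex and the short exact sequence -/

section Homology

variable {n : ℕ} [NeZero n] {G : GridDiagram n} {s : SignAssignment G}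

theorem delta_eq_zero_of_dagger (s : SignAssignment G) {c : Total G}
    (hc : c ∈ Finsupp.supported ℤ ℤ {g : Gen G | IsDagger g}) : delta s c = 0 :=
  (Submodule.mem_bot ℤ).1 (map_supported (P := ⊥) (delta s)
    (fun _ hg => (Submodule.mem_bot ℤ).2 (delta_single_of_isDagger s hg)) hc)

theorem mem_daggerChains {k : ℕ} {c : Total G} :
    c ∈ daggerChains G k ↔
      c ∈ chains G k ∧ c ∈ Finsupp.supported ℤ ℤ {g : Gen G | IsDagger g} := by
  simp only [daggerChains, chains, Finsupp.mem_supported, Set.subset_def, Set.mem_ofPred_eq]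
  exact ⟨fun h => ⟨fun g hg => (h g hg).1, fun g hg => (h g hg).2⟩,
    fun h g hg => ⟨h.1 g hg, h.2 g hg⟩⟩

theorem cdpQuot_d (h : IsDifferential s) (k : ℕ) : (CDPQuot h).d (k + 1) k =
    ModuleCat.ofHom (Submodule.mapQ (daggerIn G (k + 1)) (daggerIn G k)
      ((delta s).restrict (h.map_chains k)) (fun c hc => h.map_dagger k c.1 hc)) := by
  simp only [CDPQuot, ChainComplex.of_d]

theorem cdpDagger_d (h : IsDifferential s) (k : ℕ) : (CDPDagger h).d (k + 1) k =
    ModuleCat.ofHom ((delta s).restrict (h.map_dagger k)) := by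
  simp only [CDPDagger, ChainComplex.of_d]

/-- A cycle of the quotient lifts to a chain with boundary in `CDP†`, and `exists_sub_mem_dagger`
makes it a boundary modulo `CDP†`. In degree zero the boundary condition is empty. -/
theorem cdpQuot_acyclic (h : IsDifferential s) : (CDPQuot h).Acyclic := by
  intro k
  rcases k with _ | k
  · rw [HomologicalComplex.exactAt_iff' _ 1 0 0 (by simp) (by simp),
      ShortComplex.moduleCat_exact_iff]
    intro q _
    obtain ⟨⟨z, hz⟩, rfl⟩ := Submodule.Quotient.mk_surjective _ q
    obtain ⟨w, hw, hd⟩ := exists_sub_mem_dagger s 0 z hz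
      (by rw [h.map_chains_zero z hz]; exact Submodule.zero_mem _)
    refine ⟨Submodule.Quotient.mk ⟨w, hw⟩, ?_⟩
    change (CDPQuot h).d 1 0 _ = _
    rw [cdpQuot_d]
    refine (sub_eq_zero.1 ((Submodule.Quotient.mk_eq_zero (daggerIn G 0)).2 ?_)).symm
    exact mem_daggerChains.2 ⟨Submodule.sub_mem _ hz (h.map_chains 0 w hw), hd⟩
  · rw [HomologicalComplex.exactAt_iff' _ (k + 2) (k + 1) k (by simp) (by simp),
      ShortComplex.moduleCat_exact_iff]
    intro q hq
    obtain ⟨⟨z, hz⟩, rfl⟩ := Submodule.Quotient.mk_surjective _ q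
    change (CDPQuot h).d (k + 1) k _ = _ at hq
    rw [cdpQuot_d] at hq
    have hq' : delta s z ∈ daggerChains G k :=
      (Submodule.Quotient.mk_eq_zero (daggerIn G k)).1 hq
    obtain ⟨w, hw, hd⟩ := exists_sub_mem_dagger s (k + 1) z hz (mem_daggerChains.1 hq').2
    refine ⟨Submodule.Quotient.mk ⟨w, hw⟩, ?_⟩
    change (CDPQuot h).d (k + 2) (k + 1) _ = _
    rw [cdpQuot_d]
    refine (sub_eq_zero.1 ((Submodule.Quotient.mk_eq_zero (daggerIn G (k + 1))).2 ?_)).symm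
    exact mem_daggerChains.2 ⟨Submodule.sub_mem _ hz (h.map_chains (k + 1) w hw), hd⟩

/-- The projection of `CDP_*` to `CDP'_*`. -/
noncomputable def projection (h : IsDifferential s) : CDP h ⟶ CDPQuot h :=
  ChainComplex.ofHom (fun k => ModuleCat.ofHom (daggerIn G k).mkQ)
    (fun k => by
      simp only [CDP, CDPQuot, ChainComplex.of_d]
      ext c
      rfl)

theorem inclusion_comp_projection (h : IsDifferential s) : inclusion h ≫ projection h = 0 := by
  ext k c
  exact (Submodule.Quotient.mk_eq_zero (daggerIn G k)).2 c.2

theorem shortExact (h : IsDifferential s) :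
    (ShortComplex.mk _ _ (inclusion_comp_projection h)).ShortExact := by
  refine HomologicalComplex.shortExact_of_degreewise_shortExact _ fun k => ?_
  refine ModuleCat.shortComplex_shortExact _ ?_ ?_ ?_
  · intro y
    constructor
    · intro hy
      have hy' : y.1 ∈ daggerChains G k := (Submodule.Quotient.mk_eq_zero (daggerIn G k)).1 hy
      exact ⟨⟨y.1, hy'⟩, rfl⟩
    · rintro ⟨c, rfl⟩
      exact (Submodule.Quotient.mk_eq_zero (daggerIn G k)).2 c.2
  · exact Submodule.inclusion_injective (daggerChains_le k)
  · exact Submodule.mkQ_surjective (daggerIn G k)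

end Homology

/-! ### Quasi-isomorphism from an acyclic quotient -/

section QuasiIso

open CategoryTheory.Limits HomologicalComplex

/-- In a short exact sequence of complexes with acyclic quotient, the inclusion is a
quasi-isomorphism. -/
theorem quasiIso_of_acyclic {C ι : Type*} [Category C] [Abelian C] {c : ComplexShape ι}
    {S : ShortComplex (HomologicalComplex C c)} (hS : S.ShortExact) (h : S.X₃.Acyclic)
    (hc : ∀ i, ∃ j, c.Rel j i) : QuasiIso S.f := by
  refine ⟨fun i => (quasiIsoAt_iff_isIso_homologyMap _ _).2 ?_⟩
  obtain ⟨j, hj⟩ := hc i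
  have h₃ := fun i => (exactAt_iff_isZero_homology _ _).1 (h i)
  have : Epi (homologyMap S.f i) := (hS.homology_exact₂ i).epi_f ((h₃ i).eq_of_tgt _ _)
  have : Mono (homologyMap S.f i) := (hS.homology_exact₁ j i hj).mono_g ((h₃ j).eq_of_src _ _)
  exact isIso_of_mono_of_epi _

end QuasiIso

/-! ### Ranks of the homology groups -/

section Ranks

variable {n : ℕ} [NeZero n] {G : GridDiagram n} {s : SignAssignment G}

theorem quasiIso_inclusion (h : IsDifferential s) : QuasiIso (inclusion h) :=
  quasiIso_of_acyclic (shortExact h) (cdpQuot_acyclic h) fun i => ⟨i + 1, rfl⟩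

theorem cdpDagger_d_eq_zero (h : IsDifferential s) (i j : ℕ) : (CDPDagger h).d i j = 0 := by
  by_cases hij : (ComplexShape.down ℕ).Rel i j
  · obtain rfl : j + 1 = i := hij
    rw [cdpDagger_d]
    exact ModuleCat.hom_ext (LinearMap.ext fun c =>
      Subtype.ext (delta_eq_zero_of_dagger s (mem_daggerChains.1 c.2).2))
  · exact (CDPDagger h).shape i j hij

/-- The homology of `CDP†_*` is its chain group. -/
noncomputable def homologyDaggerEquiv (h : IsDifferential s) (k : ℕ) :
    (CDPDagger h).homology k ≃ₗ[ℤ] daggerChains G k :=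
  have := (CDPDagger h).isIso_iCycles k _ rfl (cdpDagger_d_eq_zero h k _)
  have := (CDPDagger h).isIso_homologyπ _ k rfl (cdpDagger_d_eq_zero h _ k)
  ((asIso ((CDPDagger h).homologyπ k)).symm ≪≫ asIso ((CDPDagger h).iCycles k)).toLinearEquiv

/-- The trivial domain at the identity permutation. -/
def trivialDomain (G : GridDiagram n) : PosDomain G where
  src := 1
  tgt := 1
  coeff := 0
  boundary i j := by simp [alphaBoundary]
  avoids := rfl

/-- The dagger generator whose `j`-th partition is `(1)` for `j ∈ t` and empty otherwise. -/
def daggerGen (G : GridDiagram n) (t : Finset (Fin n)) : Gen G :=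
  (trivialDomain G, fun j => if j ∈ t then [1] else [])

theorem gr_daggerGen (t : Finset (Fin n)) : gr (daggerGen G t) = t.card := by
  have h : ∀ j, ((daggerGen G t).2 j).length = if j ∈ t then 1 else 0 := by
    intro j
    simp only [daggerGen]
    split_ifs <;> rfl
  rw [gr, PosDomain.mu_eq_zero_of_coeff (D := (daggerGen G t).1) rfl, zero_add, Finset.sum_congr rfl fun j _ => h j]
  simp

theorem isDagger_daggerGen (t : Finset (Fin n)) : IsDagger (daggerGen G t) := by
  refine ⟨rfl, rfl, rfl, fun j => ?_⟩
  simp only [daggerGen]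
  split_ifs <;> simp [size]

theorem daggerGen_injective : Function.Injective (daggerGen G) := by
  intro t t' e
  ext j
  have := congrFun (congrArg Prod.snd e) j
  simp only [daggerGen] at this
  split_ifs at this with h h' h' <;> simp_all

theorem exists_daggerGen {g : Gen G} (hg : IsDagger g) : ∃ t, daggerGen G t = g := by
  obtain ⟨⟨x, y, c, _, _⟩, lam⟩ := g
  obtain ⟨h₁, h₂, h₃, h⟩ := hg
  simp only at h₁ h₂ h₃ h
  subst h₁ h₂ h₃
  refine ⟨univ.filter fun j => lam j ≠ [], Prod.ext rfl (funext fun j => ?_)⟩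
  rcases eq_nil_or_eq_one_of_size_le (h j) with hj | hj <;> simp [daggerGen, hj]

/-- The dagger generators of degree `k` correspond to the `k`-element sets of indices. -/
noncomputable def daggerGenEquiv (G : GridDiagram n) (k : ℕ) :
    {t : Finset (Fin n) // t.card = k} ≃ {g : Gen G | gr g = k ∧ IsDagger g} :=
  Equiv.ofBijective
    (fun t => ⟨daggerGen G t.1, (gr_daggerGen t.1).trans t.2, isDagger_daggerGen t.1⟩)
    ⟨fun _ _ e => Subtype.ext (daggerGen_injective (congrArg Subtype.val e)), by
      rintro ⟨g, hk, hg⟩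
      obtain ⟨t, rfl⟩ := exists_daggerGen hg
      exact ⟨⟨t, (gr_daggerGen t).symm.trans hk⟩, rfl⟩⟩

/-- `CDP†_k` is free on the `k`-element sets of indices. -/
noncomputable def daggerChainsEquiv (G : GridDiagram n) (k : ℕ) :
    daggerChains G k ≃ₗ[ℤ] ({t : Finset (Fin n) // t.card = k} → ℤ) :=
  Finsupp.supportedEquivFinsupp _ ≪≫ₗ Finsupp.domLCongr (daggerGenEquiv G k).symm ≪≫ₗ
    Finsupp.linearEquivFunOnFinite ℤ ℤ _

/-- The `k`-th homology of `CDP†_*` is free on the `k`-element sets of indices. -/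
noncomputable def homologyDaggerEquivFun (h : IsDifferential s) (k : ℕ) :
    (CDPDagger h).homology k ≃ₗ[ℤ] ({t : Finset (Fin n) // t.card = k} → ℤ) :=
  homologyDaggerEquiv h k ≪≫ₗ daggerChainsEquiv G k

/-- The `k`-th homology of `CDP_*` is free on the `k`-element sets of indices. -/
noncomputable def homologyEquivFun (h : IsDifferential s) (k : ℕ) :
    (CDP h).homology k ≃ₗ[ℤ] ({t : Finset (Fin n) // t.card = k} → ℤ) :=
  have := quasiIso_inclusion h
  (asIso (HomologicalComplex.homologyMap (inclusion h) k)).symm.toLinearEquiv ≪≫ₗ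
    homologyDaggerEquivFun h k

/-- Functions on the `k`-element subsets of an `n`-element set. -/
noncomputable def funCardEquiv (n k : ℕ) :
    ({t : Finset (Fin n) // t.card = k} → ℤ) ≃ₗ[ℤ] (Fin (n.choose k) → ℤ) :=
  LinearEquiv.funCongrLeft ℤ ℤ (Fintype.equivFinOfCardEq (by simp)).symm

/-- The direct sum over `k` of the functions on the `k`-element subsets of an `n`-element set. -/
noncomputable def directSumCardEquiv (n : ℕ) (M : ℕ → Type) [∀ k, AddCommGroup (M k)]
    (e : ∀ k, M k ≃+ ({t : Finset (Fin n) // t.card = k} → ℤ)) :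
    DirectSum ℕ M ≃+ (Fin (2 ^ n) → ℤ) :=
  (DFinsupp.mapRange.linearEquiv
      (fun k => (e k).toIntLinearEquiv ≪≫ₗ (Finsupp.linearEquivFunOnFinite ℤ ℤ _).symm) ≪≫ₗ
    (sigmaFinsuppLequivDFinsupp ℤ).symm ≪≫ₗ
    Finsupp.domLCongr ((Equiv.sigmaFiberEquiv Finset.card).trans
      (Fintype.equivFinOfCardEq (by simp))) ≪≫ₗ
    Finsupp.linearEquivFunOnFinite ℤ ℤ _).toAddEquiv

end Ranks

end GridCDP

theorem proposition4p6 (n : ℕ) [NeZero n] (G : GridCDP.GridDiagram n)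
    (s : GridCDP.SignAssignment G) :
    ∃ h : GridCDP.IsDifferential s,
      (GridCDP.CDPQuot h).Acyclic ∧
      QuasiIso (GridCDP.inclusion h) ∧
      (∀ k : ℕ, Nonempty ((GridCDP.CDPDagger h).homology k ≃ₗ[ℤ] (Fin (n.choose k) → ℤ))) ∧
      (∀ k : ℕ, Nonempty ((GridCDP.CDP h).homology k ≃ₗ[ℤ] (Fin (n.choose k) → ℤ))) ∧
      Nonempty (DirectSum ℕ (fun k => (GridCDP.CDPDagger h).homology k)
        ≃ₗ[ℤ] (Fin (2 ^ n) → ℤ)) ∧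
      Nonempty (DirectSum ℕ (fun k => (GridCDP.CDP h).homology k)
        ≃ₗ[ℤ] (Fin (2 ^ n) → ℤ)) := by
  have h := GridCDP.isDifferential s
  exact ⟨h, GridCDP.cdpQuot_acyclic h, GridCDP.quasiIso_inclusion h,
    fun k => ⟨GridCDP.homologyDaggerEquivFun h k ≪≫ₗ GridCDP.funCardEquiv n k⟩,
    fun k => ⟨GridCDP.homologyEquivFun h k ≪≫ₗ GridCDP.funCardEquiv n k⟩,
    ⟨(GridCDP.directSumCardEquiv n _
      fun k => (GridCDP.homologyDaggerEquivFun h k).toAddEquiv).toIntLinearEquiv⟩,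
    ⟨(GridCDP.directSumCardEquiv n _
      fun k => (GridCDP.homologyEquivFun h k).toAddEquiv).toIntLinearEquiv⟩⟩
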